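/- Let $n\ge 1$ and let $\lambda=(\lambda_{ij})_{0\le i,j<n}$ be a complex alternating matrix ($\lambda_{ij}=-\lambda_{ji}$) that is normalized ($\sum_j\lambda_{ij}=0$ for all $i$) and has rank $n-1$. Let $\mathsf B_\lambda$ be $\mathbb C[x_0,\dots,x_{n-1}]$ with the Poisson bracket $\{x_i,x_j\}=\lambda_{ij}x_ix_j$. Let $b$ be the biresidue matrix of $\lambda$, that is, the unique normalized alternating matrix which is inverse to $\lambda$ on $\Delta=\{z\in\mathbb C^n:\sum_i z_i=0\}$. An edge joining $i\ne j$ is called smoothable if $b_{ij}\ne0$ and there is a (necessarily unique) weight $\boldsymbol\theta\in\mathbb Z^n$ with $\theta_i=\theta_j=-1$ and $\theta_k=(b_{jk}+b_{ki})/b_{ij}\in\mathbb Z_{\ge0}$ for all $k\ne i,j$; then $\boldsymbol\theta$ is its smoothable weight. Let $I$ be a set of smoothable edges that contains no cycle, with smoothable weights $\boldsymbol\theta_e$, $e\in I$, and for $m\ge0$ let $\Theta_m$ be the set of all sums $\boldsymbol\theta_{e_1}+\dots+\boldsymbol\theta_{e_m}$ with $e_1,\dots,e_m\in I$ (so $\Theta_0=\{0\}$).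 Let $\mathcal F_p\subseteq\mathbb C[x_0,\dots,x_{n-1}]$ be the span of the monomials $x^{\mathbf w}$ with $\mathbf w\in\Theta_m+\mathbb Z_{\ge0}^n$ for some $m\ge p$, and let $\mathrm e_a$ be the standard basis vectors of $\mathbb Z^n$. For constants $\gamma=(\gamma_e)_{e\in I}$, an integer $N\ge1$ and coefficients $c=(c_{ba}^{k\ell})$ such that $c_{ba}^{k\ell}=\gamma_e$ whenever $a<b$, $k\le\ell$, $e\in I$ and $-\mathrm e_a-\mathrm e_b+\mathrm e_k+\mathrm e_\ell=\boldsymbol\theta_e$, consider the formula $$\{x_a,x_b\}=\lambda_{ab}\,x_ax_b+\sum_{m=1}^N\varepsilon^m\Bigg(\sum_{\substack{k\le\ell\\-\mathrm e_a-\mathrm e_b+\mathrm e_k+\mathrm e_\ell\in\Theta_m}}c_{ba}^{k\ell}\,x_kx_\ell\Bigg),\qquad a<b.\tag{$*$}$$ 1. (Existence.) For all non-zero constants $\gamma_e$, $e\in I$, there are $N$ and $c$ as above such that $(*)$ defines a $\mathbb C[\varepsilon]$-linear Poisson bracket on $\mathbb C[\varepsilon][x_0,\dots,x_{n-1}]$,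 and a Poisson bracket on $\mathbb C[x_0,\dots,x_{n-1}]$ for each $\varepsilon\in\mathbb C$. It is a filtered deformation of $\mathsf B_\lambda$: if $\{f,g\}=\sum_m\varepsilon^m\mu_m(f,g)$ for $f,g\in\mathbb C[x_0,\dots,x_{n-1}]$, then $\mu_0$ is the bracket of $\mathsf B_\lambda$ and $\mu_m(\mathcal F_p,\mathcal F_q)\subseteq\mathcal F_{p+q+m}$ for all $m,p,q\ge0$. 2. (Uniqueness.) Any two Poisson brackets on $\mathbb C[\varepsilon][x_0,\dots,x_{n-1}]$ of the form $(*)$ with the same non-zero constants $\gamma_e$ (but possibly different $N$ and $c$) are intertwined by the $\mathbb C[\varepsilon]$-algebra automorphism induced by a filtered unipotent linear automorphism $$x_a\mapsto x_a+\sum_{m=1}^M\varepsilon^m\sum_{d:\ \mathrm e_d-\mathrm e_a\in\Theta_m}\alpha_{ad}\,x_d,\qquad \alpha_{ad}\in\mathbb C.$$ 3. (Independence of $\varepsilon$ and $\gamma$.) Any two Poisson brackets on $\mathbb C[x_0,\dots,x_{n-1}]$ of the form $(*)$, with parameters $\varepsilon,\varepsilon'\in\mathbb C\setminus\{0\}$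 and non-zero constants $(\gamma_e)$, $(\gamma'_e)$ (and any $N,N'$ and $c,c'$), are intertwined by the algebra automorphism induced by a filtered linear automorphism, that is, an invertible linear substitution sending each $x_a$ to a linear combination of those $x_d$ with $\mathrm e_d-\mathrm e_a\in\bigcup_{m\ge0}\Theta_m$. -/

import Mathlib

open scoped Polynomial

namespace TorusDeform

noncomputable section

/-! ### Poisson algebras -/

/-- A Poisson bracket on the commutative `R`-algebra `A`: an `R`-bilinear alternating bracket
satisfying the Jacobi identity and the Leibniz rule. -/
structure PoissonBracket (R A : Type*) [CommRing R] [CommRing A] [Algebra R A] where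
  bracket : A →ₗ[R] A →ₗ[R] A
  bracket_self : ∀ f, bracket f f = 0
  jacobi : ∀ f g h,
    bracket f (bracket g h) + bracket g (bracket h f) + bracket h (bracket f g) = 0
  leibniz : ∀ f g h, bracket f (g * h) = bracket f g * h + g * bracket f h

/-- The Euler derivation `x_i ∂_i` of the polynomial ring. -/
def euler {n : ℕ} (i : Fin n) :
    Derivation ℂ (MvPolynomial (Fin n) ℂ) (MvPolynomial (Fin n) ℂ) :=
  (MvPolynomial.X i : MvPolynomial (Fin n) ℂ) • MvPolynomial.pderiv i

theorem euler_X {n : ℕ} (i j : Fin n) :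
    euler i (MvPolynomial.X j) = if i = j then (MvPolynomial.X j : MvPolynomial (Fin n) ℂ) else 0 := by
  classical
  by_cases h : i = j
  · subst h; simp [euler]
  · simp [euler, h, MvPolynomial.pderiv_X, Ne.symm h]

theorem euler_comm {n : ℕ} (i j : Fin n) (f : MvPolynomial (Fin n) ℂ) :
    euler i (euler j f) = euler j (euler i f) := by
  have h : ⁅euler i, euler j⁆ =
      (0 : Derivation ℂ (MvPolynomial (Fin n) ℂ) (MvPolynomial (Fin n) ℂ)) := by
    apply MvPolynomial.derivation_ext
    intro k
    rw [Derivation.commutator_apply, euler_X, euler_X]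
    split_ifs with h1 h2 h2 <;> simp [euler_X, h1, h2]
  have h2 := congrArg (fun D => D f) h
  simp only [Derivation.commutator_apply, Derivation.zero_apply] at h2
  exact sub_eq_zero.mp h2

/-- The bilinear map `{f,g} = ∑ᵢⱼ λᵢⱼ xᵢ xⱼ ∂ᵢf ∂ⱼg`. -/
def toricBilin {n : ℕ} (lam : Matrix (Fin n) (Fin n) ℂ) :
    MvPolynomial (Fin n) ℂ →ₗ[ℂ] MvPolynomial (Fin n) ℂ →ₗ[ℂ] MvPolynomial (Fin n) ℂ :=
  LinearMap.mk₂ ℂ (fun f g => ∑ i, ∑ j, lam i j • (euler i f * euler j g))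
    (by intro f f' g; simp [add_mul, Finset.sum_add_distrib])
    (by intro c f g; simp only [Derivation.map_smul, smul_mul_assoc, Finset.smul_sum, smul_comm c])
    (by intro f g g'; simp [mul_add, Finset.sum_add_distrib])
    (by intro c f g; simp only [Derivation.map_smul, mul_smul_comm, Finset.smul_sum, smul_comm c])

theorem toricBilin_apply {n : ℕ} (lam : Matrix (Fin n) (Fin n) ℂ) (f g : MvPolynomial (Fin n) ℂ) :
    toricBilin lam f g = ∑ i, ∑ j, lam i j • (euler i f * euler j g) := rfl

theorem toricBilin_swap {n : ℕ} (lam : Matrix (Fin n) (Fin n) ℂ) (h : lam.transpose = -lam)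
    (f g : MvPolynomial (Fin n) ℂ) : toricBilin lam f g = -toricBilin lam g f := by
  rw [toricBilin_apply, toricBilin_apply, Finset.sum_comm, ← Finset.sum_neg_distrib]
  refine Finset.sum_congr rfl fun j _ => ?_
  rw [← Finset.sum_neg_distrib]
  refine Finset.sum_congr rfl fun i _ => ?_
  have : lam i j = -lam j i := by
    have := congrFun (congrFun h j) i
    simpa using this
  rw [this, neg_smul, mul_comm]

theorem toricBilin_nested {n : ℕ} (lam : Matrix (Fin n) (Fin n) ℂ)
    (f g h : MvPolynomial (Fin n) ℂ) :
    toricBilin lam f (toricBilin lam g h) =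
      (∑ i, ∑ j, ∑ k, ∑ l, (lam i j * lam k l) •
        (euler i f * euler j (euler k g) * euler l h)) +
      ∑ i, ∑ j, ∑ k, ∑ l, (lam i j * lam k l) •
        (euler i f * euler k g * euler j (euler l h)) := by
  simp only [← Finset.sum_add_distrib]
  rw [toricBilin_apply]
  refine Finset.sum_congr rfl fun i _ => Finset.sum_congr rfl fun j _ => ?_
  rw [toricBilin_apply, map_sum, Finset.mul_sum, Finset.smul_sum]
  refine Finset.sum_congr rfl fun k _ => ?_
  rw [map_sum, Finset.mul_sum, Finset.smul_sum]
  refine Finset.sum_congr rfl fun l _ => ?_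
  rw [Derivation.map_smul, Derivation.leibniz, smul_eq_mul, smul_eq_mul, mul_smul_comm, smul_smul,
    ← smul_add]
  congr 1
  ring

theorem sum_reindex {n : ℕ} {M : Type*} [AddCommMonoid M]
    (F : Fin n → Fin n → Fin n → Fin n → M) :
    ∑ i, ∑ j, ∑ k, ∑ l, F i j k l = ∑ i, ∑ j, ∑ k, ∑ l, F k l j i := by
  calc ∑ i, ∑ j, ∑ k, ∑ l, F i j k l
      = ∑ p : (Fin n × Fin n), ∑ q : (Fin n × Fin n), F p.1 p.2 q.1 q.2 := by
        simp only [Fintype.sum_prod_type]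
    _ = ∑ q : (Fin n × Fin n), ∑ p : (Fin n × Fin n), F p.1 p.2 q.1 q.2 := Finset.sum_comm
    _ = ∑ j, ∑ i, ∑ k, ∑ l, F k l j i := by simp only [Fintype.sum_prod_type]
    _ = ∑ i, ∑ j, ∑ k, ∑ l, F k l j i := Finset.sum_comm

theorem toricBilin_cancel {n : ℕ} (lam : Matrix (Fin n) (Fin n) ℂ) (hl : lam.transpose = -lam)
    (f g h : MvPolynomial (Fin n) ℂ) :
    (∑ i, ∑ j, ∑ k, ∑ l, (lam i j * lam k l) •
        (euler i g * euler j (euler k h) * euler l f)) +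
      ∑ i, ∑ j, ∑ k, ∑ l, (lam i j * lam k l) •
        (euler i f * euler k g * euler j (euler l h)) = 0 := by
  rw [sum_reindex fun i j k l => (lam i j * lam k l) •
        (euler i g * euler j (euler k h) * euler l f), ← Finset.sum_add_distrib]
  refine Finset.sum_eq_zero fun i _ => ?_
  rw [← Finset.sum_add_distrib]
  refine Finset.sum_eq_zero fun j _ => ?_
  rw [← Finset.sum_add_distrib]
  refine Finset.sum_eq_zero fun k _ => ?_
  rw [← Finset.sum_add_distrib]
  refine Finset.sum_eq_zero fun l _ => ?_
  have hij : lam j i = -lam i j := by simpa using congrFun (congrFun hl i) j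
  have hs : lam k l * lam j i = -(lam i j * lam k l) := by rw [hij]; ring
  rw [hs, euler_comm l j, neg_smul]
  generalize euler j (euler l h) = x
  generalize euler k g = y
  generalize euler i f = z
  rw [show y * x * z = z * y * x by ring, neg_add_cancel]

/-- The toric (log canonical) Poisson algebra `B_λ`: the polynomial ring with `{xᵢ,xⱼ} = λᵢⱼ xᵢ xⱼ`. -/
def toricPoisson {n : ℕ} (lam : Matrix (Fin n) (Fin n) ℂ) (h : lam.transpose = -lam) :
    PoissonBracket ℂ (MvPolynomial (Fin n) ℂ) where
  bracket := toricBilin lam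
  bracket_self f := by
    have := toricBilin_swap lam h f f
    exact self_eq_neg.mp this
  jacobi f g k := by
    change toricBilin lam _ (toricBilin lam _ _) + toricBilin lam _ (toricBilin lam _ _) +
      toricBilin lam _ (toricBilin lam _ _) = 0
    rw [toricBilin_nested, toricBilin_nested, toricBilin_nested]
    linear_combination toricBilin_cancel lam h f g k + toricBilin_cancel lam h g k f +
      toricBilin_cancel lam h k f g
  leibniz f g k := by
    simp only [toricBilin_apply, Derivation.leibniz, smul_eq_mul, Finset.sum_mul, Finset.mul_sum,
      ← Finset.sum_add_distrib]
    refine Finset.sum_congr rfl fun i _ => Finset.sum_congr rfl fun j _ => ?_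
    simp only [smul_mul_assoc, mul_smul_comm, ← smul_add]
    congr 1
    ring

theorem toricPoisson_X {n : ℕ} (lam : Matrix (Fin n) (Fin n) ℂ) (h : lam.transpose = -lam)
    (i j : Fin n) :
    (toricPoisson lam h).bracket (MvPolynomial.X i) (MvPolynomial.X j) =
      MvPolynomial.C (lam i j) * MvPolynomial.X i * MvPolynomial.X j := by
  change toricBilin lam _ _ = _
  simp [toricBilin_apply, euler_X, MvPolynomial.smul_eq_C_mul, mul_assoc]

/-! ### Biresidue matrix and smoothable edges -/

/-- `β` is the biresidue matrix of the normalized alternating matrix `lam`: the normalized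
alternating matrix inverse to `lam` on the hyperplane `Δ` of vectors with coordinate sum zero. -/
structure IsBiresidueMatrix {n : ℕ} (lam β : Matrix (Fin n) (Fin n) ℂ) : Prop where
  alternating : β.transpose = -β
  normalized : ∀ i, ∑ j, β i j = 0
  left_inv : ∀ z : Fin n → ℂ, ∑ i, z i = 0 → β.mulVec (lam.mulVec z) = z
  right_inv : ∀ z : Fin n → ℂ, ∑ i, z i = 0 → lam.mulVec (β.mulVec z) = z

theorem sum_mulVec_eq_zero {n : ℕ} {A : Matrix (Fin n) (Fin n) ℂ} (ha : A.transpose = -A)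
    (hn : ∀ i, ∑ j, A i j = 0) (z : Fin n → ℂ) : ∑ i, A.mulVec z i = 0 := by
  have h : ∀ j, ∑ i, A i j = 0 := by
    intro j
    have : ∀ i, A i j = -A j i := fun i => by simpa using congrFun (congrFun ha j) i
    simp [this, hn]
  simp only [Matrix.mulVec, dotProduct]
  rw [Finset.sum_comm]
  simp [← Finset.sum_mul, h]

theorem mulVec_const {n : ℕ} {A : Matrix (Fin n) (Fin n) ℂ}
    (hn : ∀ i, ∑ j, A i j = 0) (c : ℂ) : A.mulVec (fun _ => c) = 0 := by
  ext i
  simp [Matrix.mulVec, dotProduct, ← Finset.sum_mul, hn]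

/-- A normalized alternating matrix of corank one has exactly one biresidue matrix. -/
theorem existsUnique_isBiresidueMatrix {n : ℕ} (lam : Matrix (Fin n) (Fin n) ℂ)
    (halt : lam.transpose = -lam) (hnorm : ∀ i, ∑ j, lam i j = 0) (hrank : lam.rank + 1 = n) :
    ∃! β, IsBiresidueMatrix lam β := by
  have hn0 : (n : ℂ) ≠ 0 := by
    have : n ≠ 0 := by omega
    exact_mod_cast this
  -- the kernel of `lam` consists of the constant vectors
  have hker : ∀ z : Fin n → ℂ, ∑ i, z i = 0 → lam.mulVec z = 0 → z = 0 := by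
    intro z hz hlz
    have h1 : Module.finrank ℂ (LinearMap.ker lam.mulVecLin) = 1 := by
      have := LinearMap.finrank_range_add_finrank_ker lam.mulVecLin
      rw [Module.finrank_fin_fun] at this
      have h2 : Module.finrank ℂ (LinearMap.range lam.mulVecLin) = lam.rank := rfl
      omega
    have hone : (fun _ => 1 : Fin n → ℂ) ∈ LinearMap.ker lam.mulVecLin := by
      simpa using mulVec_const hnorm 1
    have hzk : z ∈ LinearMap.ker lam.mulVecLin := by simpa using hlz
    have hne : (⟨_, hone⟩ : LinearMap.ker lam.mulVecLin) ≠ 0 := by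
      intro h
      have h' := congrFun (congrArg Subtype.val h) ⟨0, by omega⟩
      simp at h'
    obtain ⟨c, hc⟩ := (finrank_eq_one_iff_of_nonzero' _ hne).mp h1 ⟨z, hzk⟩
    have hc' : ∀ i, z i = c := by
      intro i
      have := congrFun (congrArg Subtype.val hc) i
      simpa using this.symm
    have : (n : ℂ) * c = 0 := by simpa [hc'] using hz
    have hc0 : c = 0 := by
      rcases mul_eq_zero.mp this with h | h
      · exact absurd h hn0
      · exact h
    ext i
    simp [hc', hc0]
  set J : Matrix (Fin n) (Fin n) ℂ := Matrix.of fun _ _ => 1 with hJ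
  have hJv : ∀ z : Fin n → ℂ, J.mulVec z = fun _ => ∑ i, z i := by
    intro z; ext i; simp [hJ, Matrix.mulVec, dotProduct]
  have hJJ : J * J = (n : ℂ) • J := by
    ext i j; simp [hJ, Matrix.mul_apply]
  have hJt : J.transpose = J := by ext i j; simp [hJ]
  have hlJ : lam * J = 0 := by
    ext i j; simp [hJ, Matrix.mul_apply, hnorm]
  have hJl : J * lam = 0 := by
    have := congrArg Matrix.transpose hlJ
    rw [Matrix.transpose_mul, hJt, halt] at this
    simpa using this
  have hunit : IsUnit (lam + J) := by
    rw [← Matrix.mulVec_injective_iff_isUnit]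
    intro x y hxy
    have h0 : (lam + J).mulVec (x - y) = 0 := by
      rw [Matrix.mulVec_sub]; exact sub_eq_zero.mpr hxy
    rw [Matrix.add_mulVec, hJv] at h0
    have hs : ∑ i, (x - y) i = 0 := by
      have := congrArg (fun v => ∑ i, v i) h0
      simp only [Pi.add_apply, Finset.sum_add_distrib, sum_mulVec_eq_zero halt hnorm] at this
      simp only [Finset.sum_const, Finset.card_univ, Fintype.card_fin, nsmul_eq_mul, zero_add,
        Pi.zero_apply, mul_zero] at this
      rcases mul_eq_zero.mp this with h | h
      · exact absurd h hn0
      · exact h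
    have hl : lam.mulVec (x - y) = 0 := by
      rw [hs] at h0
      ext i
      simpa using congrFun h0 i
    exact sub_eq_zero.mp (hker _ hs hl)
  have hdet : IsUnit (lam + J).det := (Matrix.isUnit_iff_isUnit_det _).mp hunit
  have hM1 : (lam + J)⁻¹ * (lam + J) = 1 := Matrix.nonsing_inv_mul _ hdet
  have hM2 : (lam + J) * (lam + J)⁻¹ = 1 := Matrix.mul_nonsing_inv _ hdet
  -- `(lam + J)⁻¹ J = n⁻¹ J` and `J (lam + J)⁻¹ = n⁻¹ J`
  have hMJ : (lam + J)⁻¹ * J = (n : ℂ)⁻¹ • J := by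
    have : (lam + J) * J = (n : ℂ) • J := by rw [add_mul, hlJ, hJJ, zero_add]
    calc (lam + J)⁻¹ * J = (n : ℂ)⁻¹ • ((lam + J)⁻¹ * ((n : ℂ) • J)) := by
          rw [Matrix.mul_smul, smul_smul, inv_mul_cancel₀ hn0, one_smul]
      _ = (n : ℂ)⁻¹ • J := by rw [← this, ← mul_assoc, hM1, one_mul]
  have hJM : J * (lam + J)⁻¹ = (n : ℂ)⁻¹ • J := by
    have : J * (lam + J) = (n : ℂ) • J := by rw [mul_add, hJl, hJJ, zero_add]
    calc J * (lam + J)⁻¹ = (n : ℂ)⁻¹ • (((n : ℂ) • J) * (lam + J)⁻¹) := by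
          rw [Matrix.smul_mul, smul_smul, inv_mul_cancel₀ hn0, one_smul]
      _ = (n : ℂ)⁻¹ • J := by rw [← this, mul_assoc, hM2, mul_one]
  set β : Matrix (Fin n) (Fin n) ℂ := (lam + J)⁻¹ - ((n : ℂ)⁻¹ * (n : ℂ)⁻¹) • J with hβ
  have hβl : β * lam = 1 - (n : ℂ)⁻¹ • J := by
    have : (lam + J)⁻¹ * lam = 1 - (n : ℂ)⁻¹ • J := by
      rw [← hMJ, ← hM1, mul_add, add_sub_cancel_right]
    rw [hβ, sub_mul, Matrix.smul_mul, hJl, smul_zero, sub_zero, this]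
  have hlβ : lam * β = 1 - (n : ℂ)⁻¹ • J := by
    have : lam * (lam + J)⁻¹ = 1 - (n : ℂ)⁻¹ • J := by
      rw [← hJM, ← hM2, add_mul, add_sub_cancel_right]
    rw [hβ, mul_sub, Matrix.mul_smul, hlJ, smul_zero, sub_zero, this]
  have hβJ : β * J = 0 := by
    rw [hβ, sub_mul, hMJ, Matrix.smul_mul, hJJ, smul_smul, mul_assoc, inv_mul_cancel₀ hn0, mul_one,
      sub_self]
  have hJβ : J * β = 0 := by
    rw [hβ, mul_sub, hJM, Matrix.mul_smul, hJJ, smul_smul, mul_assoc, inv_mul_cancel₀ hn0, mul_one,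
      sub_self]
  have hβn : ∀ i, ∑ j, β i j = 0 := by
    intro i
    have := congrFun (congrFun hβJ i) i
    simpa [hJ, Matrix.mul_apply] using this
  have hβa : β.transpose = -β := by
    have h1 : β.transpose * lam.transpose = 1 - (n : ℂ)⁻¹ • J := by
      rw [← Matrix.transpose_mul, hlβ, Matrix.transpose_sub, Matrix.transpose_smul, hJt,
        Matrix.transpose_one]
    have hβtJ : β.transpose * J = 0 := by
      have := congrArg Matrix.transpose hJβ
      rwa [Matrix.transpose_mul, hJt, Matrix.transpose_zero] at this
    rw [halt, mul_neg] at h1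
    calc β.transpose = β.transpose * (lam * β + (n : ℂ)⁻¹ • J) := by
          rw [hlβ, sub_add_cancel, mul_one]
      _ = -(-(β.transpose * lam) * β) := by
          rw [mul_add, Matrix.mul_smul, hβtJ, smul_zero, add_zero, neg_mul, neg_neg, mul_assoc]
      _ = -β := by
          rw [h1, sub_mul, one_mul, Matrix.smul_mul, hJβ, smul_zero, sub_zero]
  have hproj : ∀ z : Fin n → ℂ, ∑ i, z i = 0 → (1 - (n : ℂ)⁻¹ • J).mulVec z = z := by
    intro z hz
    rw [Matrix.sub_mulVec, Matrix.one_mulVec, Matrix.smul_mulVec, hJv, hz]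
    ext i; simp
  refine ⟨β, ⟨hβa, hβn, fun z hz => ?_, fun z hz => ?_⟩, ?_⟩
  · rw [Matrix.mulVec_mulVec, hβl, hproj z hz]
  · rw [Matrix.mulVec_mulVec, hlβ, hproj z hz]
  · intro β' h'
    have key : ∀ z : Fin n → ℂ, β'.mulVec z = β.mulVec z := by
      intro z
      set c : ℂ := (n : ℂ)⁻¹ * ∑ i, z i with hc
      have hz : z = (fun i => z i - c) + (fun _ => c) := by ext i; simp
      have hs : ∑ i, (z i - c) = 0 := by
        simp [hc, hn0]
      rw [hz, Matrix.mulVec_add, Matrix.mulVec_add, mulVec_const h'.normalized, mulVec_const hβn]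
      congr 1
      have h2 : lam.mulVec (β.mulVec fun i => z i - c) = fun i => z i - c := by
        rw [Matrix.mulVec_mulVec, hlβ, hproj _ hs]
      calc β'.mulVec (fun i => z i - c)
          = β'.mulVec (lam.mulVec (β.mulVec fun i => z i - c)) := by rw [h2]
        _ = _ := h'.left_inv _ (sum_mulVec_eq_zero hβa hβn _)
    ext i j
    have := congrFun (key (Pi.single j 1)) i
    simpa using this

/-- `w` is the smoothable weight of the edge joining `i` and `j`. -/
def IsSmoothableWeight {n : ℕ} (β : Matrix (Fin n) (Fin n) ℂ) (i j : Fin n) (w : Fin n → ℤ) :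
    Prop :=
  i ≠ j ∧ w i = -1 ∧ w j = -1 ∧ β i j ≠ 0 ∧
    ∀ k, k ≠ i → k ≠ j → 0 ≤ w k ∧ (β j k + β k i) / β i j = (w k : ℂ)

/-- The edge joining `i` and `j` is smoothable. -/
def IsSmoothableEdge {n : ℕ} (β : Matrix (Fin n) (Fin n) ℂ) (i j : Fin n) : Prop :=
  ∃ w, IsSmoothableWeight β i j w

/-- `Θ_m`: all sums of `m` smoothable weights (with repetitions) of edges of `G`. -/
def Theta {n : ℕ} (β : Matrix (Fin n) (Fin n) ℂ) (G : SimpleGraph (Fin n)) (m : ℕ) :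
    Set (Fin n → ℤ) :=
  {w | ∃ θ : Fin m → (Fin n → ℤ),
    (∀ s, ∃ i j, G.Adj i j ∧ IsSmoothableWeight β i j (θ s)) ∧ w = ∑ s, θ s}

/-- The standard basis vector `e_a` of `ℤⁿ`. -/
def unitWeight {n : ℕ} (a : Fin n) : Fin n → ℤ := Pi.single a 1

/-- The weight `-e_a - e_b + e_k + e_l`. -/
def quadWeight {n : ℕ} (a b k l : Fin n) : Fin n → ℤ :=
  -unitWeight a - unitWeight b + unitWeight k + unitWeight l

/-! ### The filtration and filtered deformations -/

/-- The filtration of the polynomial ring: `F_p` is spanned by the monomials `x^s` with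
`s ∈ Θ_m + ℤ_{≥0}ⁿ` for some `m ≥ p`. -/
def smoothableFiltration {n : ℕ} (β : Matrix (Fin n) (Fin n) ℂ) (G : SimpleGraph (Fin n)) (p : ℕ) :
    Submodule ℂ (MvPolynomial (Fin n) ℂ) :=
  Submodule.span ℂ {f | ∃ s : Fin n →₀ ℕ, (∃ m, p ≤ m ∧ ∃ θ ∈ Theta β G m, ∀ i, θ i ≤ (s i : ℤ)) ∧
    f = MvPolynomial.monomial s 1}

/-- The coefficient of `ε^m` of a polynomial in `x` with coefficients in `ℂ[ε]`. -/
def epsCoeff {n : ℕ} (m : ℕ) (f : MvPolynomial (Fin n) ℂ[X]) : MvPolynomial (Fin n) ℂ :=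
  ∑ s ∈ f.support, MvPolynomial.monomial s ((MvPolynomial.coeff s f).coeff m)

/-- The `ℂ[ε]`-linear Poisson bracket `P` is a filtered deformation of `P₀`: writing
`P(f, g) = ∑ₘ εᵐ μₘ(f, g)` for `f, g ∈ ℂ[x]`, one has `μ₀ = P₀` and `μₘ(F_p, F_q) ⊆ F_{p+q+m}`. -/
structure IsFilteredDeformation {n : ℕ} (F : ℕ → Submodule ℂ (MvPolynomial (Fin n) ℂ))
    (P₀ : PoissonBracket ℂ (MvPolynomial (Fin n) ℂ))
    (P : PoissonBracket ℂ[X] (MvPolynomial (Fin n) ℂ[X])) : Prop where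
  specializes : ∀ f g : MvPolynomial (Fin n) ℂ,
    epsCoeff 0 (P.bracket (MvPolynomial.map Polynomial.C f) (MvPolynomial.map Polynomial.C g)) =
      P₀.bracket f g
  filtered : ∀ (p q m : ℕ) (f g : MvPolynomial (Fin n) ℂ), f ∈ F p → g ∈ F q →
    epsCoeff m (P.bracket (MvPolynomial.map Polynomial.C f) (MvPolynomial.map Polynomial.C g)) ∈
      F (p + q + m)

/-- The coefficient family `c` takes the prescribed value `γ` on the smoothable weights of the
edges of `G`. Here `c b a k l` stands for `c_{ba}^{kl}`. -/
def HasLeadingCoeffs {n : ℕ} (β : Matrix (Fin n) (Fin n) ℂ) (G : SimpleGraph (Fin n))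
    (γ : Sym2 (Fin n) → ℂ) (c : Fin n → Fin n → Fin n → Fin n → ℂ) : Prop :=
  ∀ i j θ, G.Adj i j → IsSmoothableWeight β i j θ →
    ∀ a b k l, a < b → k ≤ l → quadWeight a b k l = θ → c b a k l = γ s(i, j)

open Classical in
/-- The Poisson bracket `P` over the `ℂ`-algebra `R` is given on generators, for `a < b`, by
`{x_a, x_b} = λ_ab x_a x_b + ∑_{m=1}^N ε^m ∑_{k ≤ l, -e_a-e_b+e_k+e_l ∈ Θ_m} c_{ba}^{kl} x_k x_l`. -/
def IsDeformedBracket {n : ℕ} {R : Type*} [CommRing R] [Algebra ℂ R]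
    (lam β : Matrix (Fin n) (Fin n) ℂ) (G : SimpleGraph (Fin n))
    (N : ℕ) (c : Fin n → Fin n → Fin n → Fin n → ℂ) (ε : R)
    (P : PoissonBracket R (MvPolynomial (Fin n) R)) : Prop :=
  ∀ a b : Fin n, a < b →
    P.bracket (MvPolynomial.X a) (MvPolynomial.X b) =
      MvPolynomial.C (algebraMap ℂ R (lam a b)) * MvPolynomial.X a * MvPolynomial.X b +
      ∑ m ∈ Finset.Icc 1 N, MvPolynomial.C (ε ^ m) *
        ∑ k, ∑ l, if k ≤ l ∧ quadWeight a b k l ∈ Theta β G m then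
          MvPolynomial.C (algebraMap ℂ R (c b a k l)) * MvPolynomial.X k * MvPolynomial.X l
        else 0

/-! ### Filtered linear automorphisms -/

/-- The algebra automorphism `φ` intertwines the Poisson brackets `P` and `P'`. -/
def Intertwines {R A : Type*} [CommRing R] [CommRing A] [Algebra R A] (φ : A ≃ₐ[R] A)
    (P P' : PoissonBracket R A) : Prop :=
  ∀ f g, φ (P.bracket f g) = P'.bracket (φ f) (φ g)

/-- `φ` is induced by a filtered linear automorphism of the space of linear coordinates over `ℂ`:
`x_a` is sent to a combination of those `x_d` with `e_d - e_a ∈ ⋃ₘ Θ_m` (where `Θ_0 = {0}`). -/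
def IsFilteredLinear {n : ℕ} (β : Matrix (Fin n) (Fin n) ℂ) (G : SimpleGraph (Fin n))
    (φ : MvPolynomial (Fin n) ℂ ≃ₐ[ℂ] MvPolynomial (Fin n) ℂ) : Prop :=
  ∃ α : Matrix (Fin n) (Fin n) ℂ,
    (∀ a, φ (MvPolynomial.X a) = ∑ d, MvPolynomial.C (α a d) * MvPolynomial.X d) ∧
    ∀ a d, α a d ≠ 0 → ∃ m, unitWeight d - unitWeight a ∈ Theta β G m

open Classical in
/-- `φ` is induced by a `ℂ[ε]`-linear filtered unipotent automorphism:
`x_a ↦ x_a + ∑_{m=1}^M ε^m ∑_{d : e_d - e_a ∈ Θ_m} α_{ad} x_d`. -/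
def IsFilteredUnipotent {n : ℕ} (β : Matrix (Fin n) (Fin n) ℂ) (G : SimpleGraph (Fin n))
    (φ : MvPolynomial (Fin n) ℂ[X] ≃ₐ[ℂ[X]] MvPolynomial (Fin n) ℂ[X]) : Prop :=
  ∃ (M : ℕ) (α : Matrix (Fin n) (Fin n) ℂ), ∀ a,
    φ (MvPolynomial.X a) = MvPolynomial.X a +
      ∑ m ∈ Finset.Icc 1 M, MvPolynomial.C ((Polynomial.X : ℂ[X]) ^ m) *
        ∑ d, if unitWeight d - unitWeight a ∈ Theta β G m then
          MvPolynomial.C (Polynomial.C (α a d)) * MvPolynomial.X d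
        else 0

end

end TorusDeform

open TorusDeform

/-!
The biresidue matrix being inverse to `λ`, the matrix `λ` sends the smoothable weight of an edge
`{i, j}` to `(e_i - e_j) / b_ij`. Alternating functions on the edges of a forest are gradients, so
the smoothable weights are linearly independent. Hence a weight of `Θ_m` determines its order `m`,
and bracket coefficients are filtered by order.

In weight `W` the Poisson differential of the toric bracket is exterior multiplication by `λ W`.
For `W ∈ Θ_m` this vector is the divergence of a flow on the forest that carries `1 / b_ij` along
each edge of the sum. The combinatorial heart of the proof is that if `m ≥ 2` and `W` has all
coordinates at least `-1`, with at most three equal to `-1`, then `(λ W)_k ≠ 0` for some `k` with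
`W_k ≠ -1`. Contraction with `dx_k / x_k` is then a contracting homotopy. Obstructions of order
at least two to the Jacobi identity therefore vanish, which gives existence, and cocycles of order
at least two come from linear vector fields, so that differences of brackets are removed by
filtered linear automorphisms, which gives uniqueness. Both corrections end after finitely many
steps, because the weights of a given degree have bounded order.

The parameters `ε` and `γ` enter the first order only through the products `γ_e ε`. These are
matched by an automorphism `x_a ↦ exp (τ_a) x_a` with `∑ τ_a θ_a` prescribed on the linearly
independent smoothable weights `θ`.
-/

namespace TorusDeform

/-! ### Graphs -/

section Graphs

variable {V : Type*} {G : SimpleGraph V}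

/-- Every edge leaving `X` ends at `j`. -/
def IsGate (G : SimpleGraph V) (X : Set V) (j : V) : Prop :=
  ∀ v ∈ X, ∀ l, G.Adj v l → l ∈ X ∨ l = j

theorem IsGate.compl {X : Set V} {j : V} (h : IsGate G X j) : IsGate G (insert j X)ᶜ j := by
  intro v hv l hvl
  simp only [Set.mem_compl_iff, Set.mem_insert_iff, not_or] at hv ⊢
  by_cases hl : l = j
  · exact Or.inr hl
  · exact Or.inl ⟨hl, fun hlX => (h l hlX v hvl.symm).elim hv.2 hv.1⟩

theorem isGate_singleton {v j : V} (h : ∀ l, G.Adj v l → l = j) : IsGate G {v} j := by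
  rintro _ rfl l hl
  exact Or.inr (h l hl)

theorem reachable_deleteEdges_iff {e : Sym2 V} {i p q : V} (hpq : G.Adj p q) (he : s(p, q) ≠ e) :
    (G.deleteEdges {e}).Reachable i p ↔ (G.deleteEdges {e}).Reachable i q := by
  have hadj : (G.deleteEdges {e}).Adj p q := (SimpleGraph.deleteEdges_adj ..).mpr ⟨hpq, he⟩
  exact ⟨fun h => h.trans hadj.reachable, fun h => h.trans hadj.symm.reachable⟩

theorem not_reachable_deleteEdges (hG : G.IsAcyclic) {i j : V} (hij : G.Adj i j) :
    ¬(G.deleteEdges {s(i, j)}).Reachable i j :=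
  SimpleGraph.isBridge_iff.mp (SimpleGraph.isAcyclic_iff_forall_adj_isBridge.mp hG hij)

theorem exists_isGate_of_isAcyclic (hG : G.IsAcyclic) {i j k : V} (hi : G.Adj j i)
    (hk : G.Adj j k) (hik : i ≠ k) : ∃ X, IsGate G X j ∧ j ∉ X ∧ i ∈ X ∧ k ∉ X := by
  have hj := not_reachable_deleteEdges hG hi.symm
  refine ⟨{v | (G.deleteEdges {s(i, j)}).Reachable i v}, fun v hv l hvl => ?_, hj, .refl i, ?_⟩
  · by_cases h : s(v, l) = s(i, j)
    · rcases Sym2.eq_iff.mp h with ⟨_, h⟩ | ⟨h, _⟩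
      · exact Or.inr h
      · exact absurd (h ▸ hv) hj
    · exact Or.inl ((reachable_deleteEdges_iff hvl h).mp hv)
  · have hne : s(k, j) ≠ s(i, j) := fun h => hik (Sym2.congr_left.mp h).symm
    exact fun h => hj ((reachable_deleteEdges_iff hk.symm hne).mp h)

theorem exists_potential_of_isAcyclic [Finite V] {M : Type*} [AddCommGroup M] (hG : G.IsAcyclic)
    (f : V → V → M) (hf : ∀ p q, f p q = -f q p) :
    ∃ σ : V → M, ∀ p q, G.Adj p q → σ p - σ q = f p q := by
  classical
  have := Fintype.ofFinite V
  refine ⟨fun v => ∑ e ∈ G.edgeFinset,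
    if (G.deleteEdges {e}).Reachable e.out.1 v then f e.out.1 e.out.2 else 0, fun p q hpq => ?_⟩
  rw [← Finset.sum_sub_distrib, Finset.sum_eq_single_of_mem s(p, q) (by simpa using hpq)]
  · have hp := not_reachable_deleteEdges hG hpq
    have hq := not_reachable_deleteEdges hG hpq.symm
    rw [Sym2.eq_swap] at hq
    have hout : s(s(p, q).out.1, s(p, q).out.2) = s(p, q) := Quot.out_eq _
    rcases Sym2.eq_iff.mp hout with ⟨h1, h2⟩ | ⟨h1, h2⟩
    · simp [h1, h2, hp]
    · simp [h1, h2, hq, hf q p]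
  · intro e _ he
    simp only [reachable_deleteEdges_iff hpq he.symm, sub_self]

theorem even_card_degree_eq_one [Fintype V] [DecidableRel G.Adj] (hG : ∀ v, G.degree v ≤ 2) :
    Even (Finset.univ.filter fun v => G.degree v = 1).card := by
  convert G.even_card_odd_degree_vertices using 5 with v
  have := hG v
  interval_cases G.degree v <;> decide

end Graphs

/-! ### Weights of smoothable edges -/

section Weights

variable {n : ℕ} {lam β : Matrix (Fin n) (Fin n) ℂ} {G : SimpleGraph (Fin n)}

theorem apply_swap_of_transpose_eq_neg {A : Matrix (Fin n) (Fin n) ℂ} (hA : A.transpose = -A)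
    (i j : Fin n) : A i j = -A j i := by
  simpa using congrFun (congrFun hA j) i

theorem apply_self_of_transpose_eq_neg {A : Matrix (Fin n) (Fin n) ℂ} (hA : A.transpose = -A)
    (i : Fin n) : A i i = 0 :=
  self_eq_neg.mp (apply_swap_of_transpose_eq_neg hA i i)

/-- The vector `(e_i - e_j) / β_ij`, which `β` sends to the smoothable weight of the edge. -/
noncomputable def edgeVector (β : Matrix (Fin n) (Fin n) ℂ) (i j : Fin n) : Fin n → ℂ :=
  fun v => ((if v = i then 1 else 0) - (if v = j then 1 else 0)) / β i j

theorem sum_mul_edgeVector (f : Fin n → ℂ) (i j : Fin n) :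
    ∑ v, f v * edgeVector β i j v = (f i - f j) / β i j := by
  simp [edgeVector, mul_div_assoc', mul_sub, ← Finset.sum_div]

theorem sum_edgeVector (i j : Fin n) : ∑ v, edgeVector β i j v = 0 := by
  simpa using sum_mul_edgeVector (β := β) (fun _ => 1) i j

theorem edgeVector_eq_zero {i j v : Fin n} (hi : v ≠ i) (hj : v ≠ j) : edgeVector β i j v = 0 := by
  simp [edgeVector, hi, hj]

namespace IsSmoothableWeight

variable {i j k : Fin n} {w w' : Fin n → ℤ}

theorem ne (h : IsSmoothableWeight β i j w) : i ≠ j := h.1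

theorem apply_left (h : IsSmoothableWeight β i j w) : w i = -1 := h.2.1

theorem apply_right (h : IsSmoothableWeight β i j w) : w j = -1 := h.2.2.1

theorem biresidue_ne_zero (h : IsSmoothableWeight β i j w) : β i j ≠ 0 := h.2.2.2.1

theorem nonneg (h : IsSmoothableWeight β i j w) (hi : k ≠ i) (hj : k ≠ j) : 0 ≤ w k :=
  (h.2.2.2.2 k hi hj).1

theorem apply_eq (hβ : β.transpose = -β) (h : IsSmoothableWeight β i j w) (k : Fin n) :
    (w k : ℂ) = (β k i - β k j) / β i j := by
  have hb := h.biresidue_ne_zero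
  rcases eq_or_ne k i with rfl | hi
  · simp [h.apply_left, apply_self_of_transpose_eq_neg hβ, hb]
  rcases eq_or_ne k j with rfl | hj
  · rw [apply_swap_of_transpose_eq_neg hβ k i]
    simp [h.apply_right, apply_self_of_transpose_eq_neg hβ, hb]
  · rw [← (h.2.2.2.2 k hi hj).2, apply_swap_of_transpose_eq_neg hβ k j]
    ring

theorem symm (hβ : β.transpose = -β) (h : IsSmoothableWeight β i j w) :
    IsSmoothableWeight β j i w := by
  refine ⟨h.ne.symm, h.apply_right, h.apply_left, ?_, fun k hj hi => ⟨h.nonneg hi hj, ?_⟩⟩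
  · rw [apply_swap_of_transpose_eq_neg hβ]
    exact neg_ne_zero.mpr h.biresidue_ne_zero
  · rw [h.apply_eq hβ k, apply_swap_of_transpose_eq_neg hβ j i,
      apply_swap_of_transpose_eq_neg hβ i k]
    ring

theorem eq_mulVec (hβ : β.transpose = -β) (h : IsSmoothableWeight β i j w) :
    (fun k => (w k : ℂ)) = β.mulVec (edgeVector β i j) := by
  ext k
  rw [Matrix.mulVec, dotProduct, sum_mul_edgeVector, h.apply_eq hβ]

theorem mulVec_eq (hβ : IsBiresidueMatrix lam β) (h : IsSmoothableWeight β i j w) :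
    lam.mulVec (fun k => (w k : ℂ)) = edgeVector β i j := by
  rw [h.eq_mulVec hβ.alternating, hβ.right_inv _ (sum_edgeVector i j)]

theorem sum_eq_zero (hβ : IsBiresidueMatrix lam β) (h : IsSmoothableWeight β i j w) :
    ∑ k, w k = 0 := by
  have hsum : ∑ k, (w k : ℂ) = 0 := by
    simpa only [← h.eq_mulVec hβ.alternating] using
      sum_mulVec_eq_zero hβ.alternating hβ.normalized (edgeVector β i j)
  exact_mod_cast hsum

theorem exists_pos_mul_eq (hβ : β.transpose = -β) (hik : i ≠ k)
    (h : IsSmoothableWeight β i j w) (h' : IsSmoothableWeight β j k w') :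
    ∃ r : ℝ, 0 < r ∧ β i j = r * β j k := by
  have hw : (0 : ℝ) < 1 + w k := by exact_mod_cast by linarith [h.nonneg hik.symm h'.ne.symm]
  have hw' : (0 : ℝ) < 1 + w' i := by exact_mod_cast by linarith [h'.nonneg h.ne hik]
  have e := h.apply_eq hβ k
  have e' := h'.apply_eq hβ i
  rw [eq_div_iff h.biresidue_ne_zero, apply_swap_of_transpose_eq_neg hβ k i,
    apply_swap_of_transpose_eq_neg hβ k j] at e
  rw [eq_div_iff h'.biresidue_ne_zero] at e'
  refine ⟨(1 + w' i) / (1 + w k), by positivity, ?_⟩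
  have hne : (1 + (w k : ℂ)) ≠ 0 := by exact_mod_cast hw.ne'
  push_cast
  field_simp
  linear_combination e - e'

end IsSmoothableWeight

/-- Going around three smoothable edges at `j`, the positive ratios of consecutive biresidues
would multiply to `-1`. -/
theorem not_three_isSmoothableEdge (hβ : β.transpose = -β) {i j k l : Fin n} (hik : i ≠ k)
    (hil : i ≠ l) (hkl : k ≠ l) (hi : IsSmoothableEdge β i j) (hk : IsSmoothableEdge β k j) :
    ¬IsSmoothableEdge β l j := by
  rintro ⟨wl, hl⟩
  obtain ⟨wi, hi⟩ := hi
  obtain ⟨wk, hk⟩ := hk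
  obtain ⟨r, hr, e⟩ := hi.exists_pos_mul_eq hβ hik (hk.symm hβ)
  obtain ⟨r', hr', e'⟩ := hk.exists_pos_mul_eq hβ hkl (hl.symm hβ)
  obtain ⟨r'', hr'', e''⟩ := hl.exists_pos_mul_eq hβ hil.symm (hi.symm hβ)
  rw [apply_swap_of_transpose_eq_neg hβ j] at e e' e''
  have hprod : β i j * ((r * r' * r'' + 1 : ℝ) : ℂ) = 0 := by
    push_cast
    linear_combination e - r * e' + r * r' * e''
  have hpos : 0 < r * r' * r'' + 1 := by positivity
  exact mul_ne_zero hi.biresidue_ne_zero (by exact_mod_cast hpos.ne') hprod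

/-- For a forest, the smoothable weights of the edges are linearly independent. -/
theorem exists_dual_smoothableWeight (hβ : IsBiresidueMatrix lam β) (hG : G.IsAcyclic)
    (ρ : Sym2 (Fin n) → ℂ) :
    ∃ τ : Fin n → ℂ, ∀ i j w, G.Adj i j → IsSmoothableWeight β i j w →
      ∑ a, τ a * w a = ρ s(i, j) := by
  obtain ⟨σ, hσ⟩ := exists_potential_of_isAcyclic hG (fun i j => ρ s(i, j) * β i j) fun i j => by
    rw [Sym2.eq_swap, apply_swap_of_transpose_eq_neg hβ.alternating, mul_neg]
  refine ⟨Matrix.vecMul σ lam, fun i j w hij hw => ?_⟩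
  calc ∑ a, Matrix.vecMul σ lam a * w a
      = ∑ v, σ v * lam.mulVec (fun a => (w a : ℂ)) v :=
        (Matrix.dotProduct_mulVec σ lam fun a => (w a : ℂ)).symm
    _ = ρ s(i, j) := by
      rw [hw.mulVec_eq hβ, sum_mul_edgeVector, hσ i j hij,
        mul_div_cancel_right₀ _ hw.biresidue_ne_zero]

theorem Theta_zero : Theta β G 0 = {0} := by
  ext w
  constructor
  · rintro ⟨θ, _, rfl⟩
    simp
  · rintro rfl
    exact ⟨Fin.elim0, fun s => s.elim0, by simp⟩

theorem mem_Theta_one {w : Fin n → ℤ} :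
    w ∈ Theta β G 1 ↔ ∃ i j, G.Adj i j ∧ IsSmoothableWeight β i j w := by
  constructor
  · rintro ⟨θ, h, rfl⟩
    simpa using h 0
  · intro h
    exact ⟨fun _ => w, fun _ => h, by simp⟩

theorem add_mem_Theta {p q : ℕ} {v w : Fin n → ℤ} (hv : v ∈ Theta β G p) (hw : w ∈ Theta β G q) :
    v + w ∈ Theta β G (p + q) := by
  obtain ⟨θ, h, rfl⟩ := hv
  obtain ⟨θ', h', rfl⟩ := hw
  refine ⟨Fin.append θ θ', Fin.addCases (fun i => ?_) (fun i => ?_), by simp [Fin.sum_univ_add]⟩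
  · simpa using h i
  · simpa using h' i

theorem sum_eq_zero_of_mem_Theta (hβ : IsBiresidueMatrix lam β) {m : ℕ} {w : Fin n → ℤ}
    (hw : w ∈ Theta β G m) : ∑ k, w k = 0 := by
  obtain ⟨θ, h, rfl⟩ := hw
  simp only [Finset.sum_apply]
  rw [Finset.sum_comm]
  refine Finset.sum_eq_zero fun s _ => ?_
  obtain ⟨i, j, _, hs⟩ := h s
  exact hs.sum_eq_zero hβ

theorem exists_order_functional (hβ : IsBiresidueMatrix lam β) (hG : G.IsAcyclic) :
    ∃ τ : Fin n → ℂ, ∀ m, ∀ w ∈ Theta β G m, ∑ a, τ a * w a = m := by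
  obtain ⟨τ, hτ⟩ := exists_dual_smoothableWeight hβ hG fun _ => 1
  refine ⟨τ, ?_⟩
  rintro m _ ⟨θ, h, rfl⟩
  have hone : ∀ s, ∑ a, τ a * (θ s a : ℂ) = 1 := by
    intro s
    obtain ⟨i, j, hij, hs⟩ := h s
    exact hτ i j _ hij hs
  simp only [Finset.sum_apply, Int.cast_sum, Finset.mul_sum]
  rw [Finset.sum_comm]
  simp [hone]

theorem eq_of_mem_Theta (hβ : IsBiresidueMatrix lam β) (hG : G.IsAcyclic) {m m' : ℕ}
    {w : Fin n → ℤ} (h : w ∈ Theta β G m) (h' : w ∈ Theta β G m') : m = m' := by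
  obtain ⟨τ, hτ⟩ := exists_order_functional hβ hG
  exact_mod_cast (hτ m w h).symm.trans (hτ m' w h')

end Weights

/-! ### Sums of smoothable weights -/

section Flow

variable {n : ℕ} {ι : Type*} {lam β : Matrix (Fin n) (Fin n) ℂ} {G : SimpleGraph (Fin n)}
  {p q : ι → Fin n} {θ : ι → Fin n → ℤ}

/-- The divergence of the flow carrying `1 / β_ij` along each edge of the family `A`. It is the
image under the matrix `lam` of the sum of the smoothable weights of these edges. -/
noncomputable def flow (β : Matrix (Fin n) (Fin n) ℂ) (p q : ι → Fin n) (A : Finset ι) :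
    Fin n → ℂ :=
  ∑ s ∈ A, edgeVector β (p s) (q s)

/-- The graph formed by the edges of a family of pairs. -/
def edgeGraph (p q : ι → Fin n) : SimpleGraph (Fin n) :=
  SimpleGraph.fromEdgeSet (Set.range fun s => s(p s, q s))

theorem edgeGraph_le (hadj : ∀ s, G.Adj (p s) (q s)) : edgeGraph p q ≤ G := by
  intro v w h
  obtain ⟨⟨s, hs⟩, _⟩ := (SimpleGraph.fromEdgeSet_adj _).mp h
  rw [← SimpleGraph.mem_edgeSet, ← hs]
  exact hadj s

theorem edgeGraph_adj (hθ : ∀ s, IsSmoothableWeight β (p s) (q s) (θ s)) (s : ι) :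
    (edgeGraph p q).Adj (p s) (q s) :=
  (SimpleGraph.fromEdgeSet_adj _).mpr ⟨⟨s, rfl⟩, (hθ s).ne⟩

theorem sum_flow (A : Finset ι) : ∑ v, flow β p q A v = 0 := by
  simp only [flow, Finset.sum_apply]
  rw [Finset.sum_comm]
  exact Finset.sum_eq_zero fun s _ => sum_edgeVector _ _

theorem flow_eq_zero {A : Finset ι} {v : Fin n} (h : ∀ s ∈ A, v ≠ p s ∧ v ≠ q s) :
    flow β p q A v = 0 := by
  rw [flow, Finset.sum_apply]
  exact Finset.sum_eq_zero fun s hs => edgeVector_eq_zero (h s hs).1 (h s hs).2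

theorem sum_eq_mulVec_flow (hβ : β.transpose = -β)
    (hθ : ∀ s, IsSmoothableWeight β (p s) (q s) (θ s)) (A : Finset ι) :
    (fun k => (((∑ s ∈ A, θ s) k : ℤ) : ℂ)) = β.mulVec (flow β p q A) := by
  rw [flow, Matrix.mulVec_sum]
  ext k
  simp only [Finset.sum_apply, Int.cast_sum]
  exact Finset.sum_congr rfl fun s _ => congrFun ((hθ s).eq_mulVec hβ) k

theorem mulVec_sum_eq_flow (hβ : IsBiresidueMatrix lam β)
    (hθ : ∀ s, IsSmoothableWeight β (p s) (q s) (θ s)) (A : Finset ι) :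
    lam.mulVec (fun k => (((∑ s ∈ A, θ s) k : ℤ) : ℂ)) = flow β p q A := by
  rw [sum_eq_mulVec_flow hβ.alternating hθ, hβ.right_inv _ (sum_flow A)]

theorem exists_flow_ne_zero (hβ : IsBiresidueMatrix lam β) (hG : G.IsAcyclic)
    (hadj : ∀ s, G.Adj (p s) (q s)) (hθ : ∀ s, IsSmoothableWeight β (p s) (q s) (θ s))
    {A : Finset ι} (hA : A.Nonempty) (j : Fin n) : ∃ v ≠ j, flow β p q A v ≠ 0 := by
  by_contra! h
  have hj : flow β p q A j = 0 := by
    rw [← sum_flow (β := β) (p := p) (q := q) A]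
    exact (Finset.sum_eq_single j (fun v _ hv => h v hv) (by simp)).symm
  have hflow : flow β p q A = 0 := by
    ext v
    rcases eq_or_ne v j with rfl | hv
    exacts [hj, h v hv]
  have hsum := sum_eq_mulVec_flow hβ.alternating hθ A
  rw [hflow, Matrix.mulVec_zero] at hsum
  obtain ⟨τ, hτ⟩ := exists_dual_smoothableWeight hβ hG fun _ => 1
  have hcard : ∑ a, τ a * (((∑ s ∈ A, θ s) a : ℤ) : ℂ) = A.card := by
    simp only [Finset.sum_apply, Int.cast_sum, Finset.mul_sum]
    rw [Finset.sum_comm, Finset.sum_congr rfl fun s _ => hτ _ _ _ (hadj s) (hθ s)]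
    simp
  have hzero : ∑ a, τ a * (((∑ s ∈ A, θ s) a : ℤ) : ℂ) = 0 :=
    Finset.sum_eq_zero fun a _ => by rw [congrFun hsum a, Pi.zero_apply, mul_zero]
  exact hA.card_pos.ne' (by exact_mod_cast hcard.symm.trans hzero)

theorem sum_apply_eq_of_flow (hβ : β.transpose = -β)
    (hθ : ∀ s, IsSmoothableWeight β (p s) (q s) (θ s)) {A : Finset ι} {a j : Fin n} (haj : a ≠ j)
    (hflow : ∀ v, v ≠ a → v ≠ j → flow β p q A v = 0) :
    (∑ s ∈ A, θ s) a = (∑ s ∈ A, θ s) j := by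
  have hsum : ∀ f : Fin n → ℂ, ∑ v, f v * flow β p q A v =
      f a * flow β p q A a + f j * flow β p q A j := by
    intro f
    rw [← Finset.sum_subset (Finset.subset_univ {a, j}), Finset.sum_pair haj]
    intro v _ hv
    simp only [Finset.mem_insert, Finset.mem_singleton, not_or] at hv
    rw [hflow v hv.1 hv.2, mul_zero]
  have hbalance := hsum fun _ => 1
  simp only [one_mul, sum_flow] at hbalance
  have hw : ∀ k, (((∑ s ∈ A, θ s) k : ℤ) : ℂ) =
      β k a * flow β p q A a + β k j * flow β p q A j := fun k =>
    (congrFun (sum_eq_mulVec_flow hβ hθ A) k).trans (hsum (β k))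
  have heq : (((∑ s ∈ A, θ s) a : ℤ) : ℂ) = ((∑ s ∈ A, θ s) j : ℤ) := by
    rw [hw, hw, apply_self_of_transpose_eq_neg hβ, apply_self_of_transpose_eq_neg hβ,
      apply_swap_of_transpose_eq_neg hβ j a]
    linear_combination (-β a j) * hbalance
  exact_mod_cast heq

variable [Fintype ι]

open Classical in
/-- The edges of a family that have an endpoint in `X`. -/
noncomputable def edgesMeeting (p q : ι → Fin n) (X : Set (Fin n)) : Finset ι :=
  Finset.univ.filter fun s => p s ∈ X ∨ q s ∈ X

theorem mem_edgesMeeting {X : Set (Fin n)} {s : ι} :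
    s ∈ edgesMeeting p q X ↔ p s ∈ X ∨ q s ∈ X := by
  simp [edgesMeeting]

theorem edgesMeeting_nonempty {v w : Fin n} {X : Set (Fin n)} (h : (edgeGraph p q).Adj v w)
    (hv : v ∈ X) : (edgesMeeting p q X).Nonempty := by
  obtain ⟨⟨s, hs⟩, _⟩ := (SimpleGraph.fromEdgeSet_adj _).mp h
  refine ⟨s, mem_edgesMeeting.mpr ?_⟩
  rcases Sym2.eq_iff.mp hs with ⟨h, _⟩ | ⟨_, h⟩
  · exact Or.inl (h ▸ hv)
  · exact Or.inr (h ▸ hv)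

theorem flow_edgesMeeting_of_mem {X : Set (Fin n)} {v : Fin n} (hv : v ∈ X) :
    flow β p q (edgesMeeting p q X) v = flow β p q Finset.univ v := by
  simp only [flow, Finset.sum_apply]
  refine Finset.sum_subset (Finset.subset_univ _) fun s _ hs => edgeVector_eq_zero ?_ ?_
  · rintro rfl
    exact hs (mem_edgesMeeting.mpr (Or.inl hv))
  · rintro rfl
    exact hs (mem_edgesMeeting.mpr (Or.inr hv))

section Gate

variable {X : Set (Fin n)} {j : Fin n}

theorem endpoints_of_mem_edgesMeeting (hθ : ∀ s, IsSmoothableWeight β (p s) (q s) (θ s))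
    (hX : IsGate (edgeGraph p q) X j) {s : ι} (hs : s ∈ edgesMeeting p q X) :
    (p s ∈ X ∨ p s = j) ∧ (q s ∈ X ∨ q s = j) := by
  rcases mem_edgesMeeting.mp hs with h | h
  · exact ⟨Or.inl h, hX _ h _ (edgeGraph_adj hθ s)⟩
  · exact ⟨hX _ h _ (edgeGraph_adj hθ s).symm, Or.inl h⟩

theorem flow_edgesMeeting_of_notMem (hθ : ∀ s, IsSmoothableWeight β (p s) (q s) (θ s))
    (hX : IsGate (edgeGraph p q) X j) {v : Fin n} (hv : v ∉ X) (hvj : v ≠ j) :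
    flow β p q (edgesMeeting p q X) v = 0 := by
  refine flow_eq_zero fun s hs => ?_
  obtain ⟨hp, hq⟩ := endpoints_of_mem_edgesMeeting hθ hX hs
  exact ⟨fun h => hp.elim (h ▸ hv) (h ▸ hvj), fun h => hq.elim (h ▸ hv) (h ▸ hvj)⟩

theorem exists_mem_flow_ne_zero (hβ : IsBiresidueMatrix lam β) (hG : G.IsAcyclic)
    (hadj : ∀ s, G.Adj (p s) (q s)) (hθ : ∀ s, IsSmoothableWeight β (p s) (q s) (θ s))
    (hX : IsGate (edgeGraph p q) X j) (hne : (edgesMeeting p q X).Nonempty) :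
    ∃ a ∈ X, flow β p q Finset.univ a ≠ 0 := by
  obtain ⟨a, haj, ha⟩ := exists_flow_ne_zero hβ hG hadj hθ hne j
  by_cases haX : a ∈ X
  · exact ⟨a, haX, (flow_edgesMeeting_of_mem haX).symm.trans_ne ha⟩
  · exact absurd (flow_edgesMeeting_of_notMem hθ hX haX haj) ha

theorem flow_ne_zero_of_isGate_singleton (hβ : IsBiresidueMatrix lam β) (hG : G.IsAcyclic)
    (hadj : ∀ s, G.Adj (p s) (q s)) (hθ : ∀ s, IsSmoothableWeight β (p s) (q s) (θ s))
    {v : Fin n} (hv : (edgeGraph p q).Adj v j) (huniq : ∀ l, (edgeGraph p q).Adj v l → l = j) :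
    flow β p q Finset.univ v ≠ 0 := by
  obtain ⟨a, rfl, ha⟩ := exists_mem_flow_ne_zero hβ hG hadj hθ (isGate_singleton huniq)
    (edgesMeeting_nonempty hv rfl)
  exact ha

theorem sum_edgesMeeting_le (hβ : β.transpose = -β)
    (hθ : ∀ s, IsSmoothableWeight β (p s) (q s) (θ s)) (hX : IsGate (edgeGraph p q) X j)
    (hj : j ∉ X) {a : Fin n} (ha : a ∈ X)
    (huniq : ∀ v ∈ X, flow β p q Finset.univ v ≠ 0 → v = a) :
    (∑ s ∈ edgesMeeting p q X, θ s) j ≤ (∑ s, θ s) a := by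
  have hflow : ∀ v, v ≠ a → v ≠ j → flow β p q (edgesMeeting p q X) v = 0 := by
    intro v hva hvj
    by_cases hv : v ∈ X
    · rw [flow_edgesMeeting_of_mem hv]
      exact not_not.mp (mt (huniq v hv) hva)
    · exact flow_edgesMeeting_of_notMem hθ hX hv hvj
  rw [← sum_apply_eq_of_flow hβ hθ (ne_of_mem_of_not_mem ha hj) hflow]
  simp only [Finset.sum_apply]
  refine Finset.sum_le_sum_of_subset_of_nonneg (Finset.subset_univ _) fun s _ hs => ?_
  refine (hθ s).nonneg ?_ ?_
  · rintro rfl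
    exact hs (mem_edgesMeeting.mpr (Or.inl ha))
  · rintro rfl
    exact hs (mem_edgesMeeting.mpr (Or.inr ha))

theorem sum_eq_sum_edgesMeeting_add_compl (hθ : ∀ s, IsSmoothableWeight β (p s) (q s) (θ s))
    (hX : IsGate (edgeGraph p q) X j) :
    ∑ s, θ s = ∑ s ∈ edgesMeeting p q X, θ s + ∑ s ∈ edgesMeeting p q (insert j X)ᶜ, θ s := by
  classical
  have hcompl : (edgesMeeting p q X)ᶜ = edgesMeeting p q (insert j X)ᶜ := by
    ext s
    simp only [Finset.mem_compl, mem_edgesMeeting, Set.mem_compl_iff, Set.mem_insert_iff]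
    have h := hX (p s) (l := q s)
    have h' := hX (q s) (l := p s)
    have hadj := edgeGraph_adj hθ s
    have hne := (hθ s).ne
    grind [SimpleGraph.Adj.symm]
  rw [← hcompl, Finset.sum_add_sum_compl]

/-- Two gated regions at `j` meeting the support of the flow once each contribute at most `-1`
each to the weight at `j`. -/
theorem exists_flow_ne_zero_of_branching (hβ : IsBiresidueMatrix lam β) (hG : G.IsAcyclic)
    (hadj : ∀ s, G.Adj (p s) (q s)) (hθ : ∀ s, IsSmoothableWeight β (p s) (q s) (θ s))
    (hge : ∀ v, -1 ≤ (∑ s, θ s) v) {i k : Fin n} (hi : (edgeGraph p q).Adj j i)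
    (hk : (edgeGraph p q).Adj j k) (hik : i ≠ k)
    (hcard : ((Finset.univ.filter fun v => flow β p q Finset.univ v ≠ 0).erase j).card ≤ 2) :
    ∃ v, flow β p q Finset.univ v ≠ 0 ∧ (∑ s, θ s) v ≠ -1 := by
  by_contra! h
  obtain ⟨X, hX, hj, hiX, hkX⟩ :=
    exists_isGate_of_isAcyclic (hG.anti (edgeGraph_le hadj)) hi hk hik
  have hkX' : k ∈ (insert j X)ᶜ := by simp [hk.ne.symm, hkX]
  obtain ⟨a, ha, hua⟩ :=
    exists_mem_flow_ne_zero hβ hG hadj hθ hX (edgesMeeting_nonempty hi.symm hiX)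
  obtain ⟨c, hc, huc⟩ :=
    exists_mem_flow_ne_zero hβ hG hadj hθ hX.compl (edgesMeeting_nonempty hk.symm hkX')
  simp only [Set.mem_compl_iff, Set.mem_insert_iff, not_or] at hc
  have hthree : ∀ v ≠ j, flow β p q Finset.univ v ≠ 0 → v = a ∨ v = c := by
    intro v hvj hv
    by_contra! hne
    refine hcard.not_gt (Finset.two_lt_card.mpr ⟨a, ?_, c, ?_, v, ?_, ?_, hne.1.symm, hne.2.symm⟩)
    · simp [hua, ne_of_mem_of_not_mem ha hj]
    · simp [huc, hc.1]
    · simp [hvj, hv]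
    · exact fun h => hc.2 (h ▸ ha)
  have hside := sum_edgesMeeting_le hβ.alternating hθ hX hj ha fun v hv hne =>
    (hthree v (ne_of_mem_of_not_mem hv hj) hne).resolve_right fun h => hc.2 (h ▸ hv)
  have hside' := sum_edgesMeeting_le hβ.alternating hθ hX.compl (by simp) (by simpa using hc)
    fun v hv hne => (hthree v (fun h => hv (Or.inl h)) hne).resolve_left
      fun h => hv (Or.inr (h.symm ▸ ha))
  have hsum := congrFun (sum_eq_sum_edgesMeeting_add_compl hθ hX) j
  rw [Pi.add_apply] at hsum
  linarith [hge j, h a hua, h c huc]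

end Gate

theorem exists_flow_ne_zero_of_no_branching (hβ : IsBiresidueMatrix lam β) (hG : G.IsAcyclic)
    (hadj : ∀ s, G.Adj (p s) (q s)) (hθ : ∀ s, IsSmoothableWeight β (p s) (q s) (θ s))
    (hm : 2 ≤ Fintype.card ι)
    (hcard : (Finset.univ.filter fun v => flow β p q Finset.univ v ≠ 0).card ≤ 3)
    (hbranch : ∀ j i k, (edgeGraph p q).Adj j i → (edgeGraph p q).Adj j k → i = k) :
    ∃ v, flow β p q Finset.univ v ≠ 0 ∧ (∑ s, θ s) v ≠ -1 := by
  have hT : ∀ v w, (edgeGraph p q).Adj v w →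
      v ∈ Finset.univ.filter fun v => flow β p q Finset.univ v ≠ 0 := by
    intro v w hvw
    simpa using flow_ne_zero_of_isGate_singleton hβ hG hadj hθ hvw fun l hl => hbranch v l w hl hvw
  obtain ⟨s₀⟩ : Nonempty ι := Fintype.card_pos_iff.mp (by omega)
  have hs₀ := edgeGraph_adj hθ s₀
  refine ⟨p s₀, (Finset.mem_filter.mp (hT _ _ hs₀)).2, ?_⟩
  have hone : ∀ s, θ s (p s₀) = -1 := by
    intro s
    have hs := edgeGraph_adj hθ s
    by_contra hne
    have hp : p s₀ ≠ p s := fun h => hne (h ▸ (hθ s).apply_left)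
    have hq : p s₀ ≠ q s := fun h => hne (h ▸ (hθ s).apply_right)
    refine hcard.not_gt (Finset.three_lt_card.mpr ⟨p s₀, hT _ _ hs₀, q s₀, hT _ _ hs₀.symm, p s,
      hT _ _ hs, q s, hT _ _ hs.symm, hs₀.ne, hp, hq, fun h => ?_, fun h => ?_, hs.ne⟩)
    · exact hq (hbranch (p s) _ _ (h ▸ hs₀.symm) hs)
    · exact hp (hbranch (q s) _ _ (h ▸ hs₀.symm) hs.symm)
  rw [Finset.sum_apply, Finset.sum_congr rfl fun s _ => hone s]
  simp only [Finset.sum_const, Finset.card_univ, nsmul_eq_mul]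
  omega

theorem card_flow_ne_zero_le_two (hβ : IsBiresidueMatrix lam β) (hG : G.IsAcyclic)
    (hadj : ∀ s, G.Adj (p s) (q s)) (hθ : ∀ s, IsSmoothableWeight β (p s) (q s) (θ s))
    (hcard : (Finset.univ.filter fun v => flow β p q Finset.univ v ≠ 0).card ≤ 3)
    (hbranch : ∀ j i k, flow β p q Finset.univ j ≠ 0 → (edgeGraph p q).Adj j i →
      (edgeGraph p q).Adj j k → i = k) :
    (Finset.univ.filter fun v => flow β p q Finset.univ v ≠ 0).card ≤ 2 := by
  classical
  have hsm : ∀ v w, (edgeGraph p q).Adj v w → IsSmoothableEdge β w v := by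
    intro v w hvw
    obtain ⟨⟨s, hs⟩, _⟩ := (SimpleGraph.fromEdgeSet_adj _).mp hvw
    rcases Sym2.eq_iff.mp hs with ⟨rfl, rfl⟩ | ⟨rfl, rfl⟩
    exacts [⟨_, (hθ s).symm hβ.alternating⟩, ⟨_, hθ s⟩]
  have hdeg : ∀ v, (edgeGraph p q).degree v ≤ 2 := by
    intro v
    by_contra! h
    obtain ⟨a, ha, b, hb, c, hc, hab, hac, hbc⟩ := Finset.two_lt_card.mp h
    rw [SimpleGraph.mem_neighborFinset] at ha hb hc
    exact not_three_isSmoothableEdge hβ.alternating hab hac hbc (hsm _ _ ha) (hsm _ _ hb)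
      (hsm _ _ hc)
  have hleaf : (Finset.univ.filter fun v => flow β p q Finset.univ v ≠ 0) =
      Finset.univ.filter fun v => (edgeGraph p q).degree v = 1 := by
    ext v
    simp only [Finset.mem_filter, Finset.mem_univ, true_and,
      SimpleGraph.degree_eq_one_iff_existsUnique_adj]
    constructor
    · intro hv
      obtain ⟨w, hw⟩ : ∃ w, (edgeGraph p q).Adj v w := by
        by_contra! h
        exact hv (flow_eq_zero fun s _ => ⟨fun e => h (q s) (e ▸ edgeGraph_adj hθ s),
          fun e => h (p s) (e ▸ (edgeGraph_adj hθ s).symm)⟩)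
      exact ⟨w, hw, fun l hl => hbranch v l w hv hl hw⟩
    · rintro ⟨w, hw, huniq⟩
      exact flow_ne_zero_of_isGate_singleton hβ hG hadj hθ hw huniq
  have heven := hleaf ▸ even_card_degree_eq_one hdeg
  obtain ⟨r, hr⟩ := heven
  omega

theorem exists_flow_ne_zero_sum_ne_neg_one (hβ : IsBiresidueMatrix lam β) (hG : G.IsAcyclic)
    (hadj : ∀ s, G.Adj (p s) (q s)) (hθ : ∀ s, IsSmoothableWeight β (p s) (q s) (θ s))
    (hm : 2 ≤ Fintype.card ι) (hge : ∀ v, -1 ≤ (∑ s, θ s) v)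
    (hcard : (Finset.univ.filter fun v => flow β p q Finset.univ v ≠ 0).card ≤ 3) :
    ∃ v, flow β p q Finset.univ v ≠ 0 ∧ (∑ s, θ s) v ≠ -1 := by
  by_cases hbranch : ∀ j i k, (edgeGraph p q).Adj j i → (edgeGraph p q).Adj j k → i = k
  · exact exists_flow_ne_zero_of_no_branching hβ hG hadj hθ hm hcard hbranch
  by_cases hT : ∀ j i k, flow β p q Finset.univ j ≠ 0 → (edgeGraph p q).Adj j i →
      (edgeGraph p q).Adj j k → i = k
  · push Not at hbranch
    obtain ⟨j, i, k, hi, hk, hik⟩ := hbranch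
    exact exists_flow_ne_zero_of_branching hβ hG hadj hθ hge hi hk hik
      ((Finset.card_erase_le).trans (card_flow_ne_zero_le_two hβ hG hadj hθ hcard hT))
  · push Not at hT
    obtain ⟨j, i, k, hj, hi, hk, hik⟩ := hT
    refine exists_flow_ne_zero_of_branching hβ hG hadj hθ hge hi hk hik ?_
    rw [Finset.card_erase_of_mem (by simpa using hj)]
    omega

end Flow

/-- The toric differential is exterior multiplication by `lam.mulVec W` in weight `W`, and `W` is a
weight of bivectors or trivectors when `-1 ≤ W` with at most three entries `-1`: in such weights the
complex is acyclic. -/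
theorem exists_mulVec_ne_zero_of_mem_Theta {n m : ℕ} {lam β : Matrix (Fin n) (Fin n) ℂ}
    {G : SimpleGraph (Fin n)} (hβ : IsBiresidueMatrix lam β) (hG : G.IsAcyclic) (hm : 2 ≤ m)
    {W : Fin n → ℤ} (hW : W ∈ Theta β G m) (hge : ∀ a, -1 ≤ W a)
    (hcard : (Finset.univ.filter fun a => W a = -1).card ≤ 3) :
    ∃ k, W k ≠ -1 ∧ lam.mulVec (fun a => (W a : ℂ)) k ≠ 0 := by
  obtain ⟨θ, h, rfl⟩ := hW
  choose p q hadj hθ using h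
  rw [mulVec_sum_eq_flow hβ hθ]
  by_contra! hzero
  have hsupport : ∀ v, flow β p q Finset.univ v ≠ 0 → (∑ s, θ s) v = -1 := fun v hv =>
    not_not.mp (mt (hzero v) hv)
  obtain ⟨v, hv, hne⟩ := exists_flow_ne_zero_sum_ne_neg_one hβ hG hadj hθ (by simpa using hm) hge
    ((Finset.card_le_card (Finset.monotone_filter_right _ fun v _ => hsupport v)).trans hcard)
  exact hne (hsupport v hv)

/-! ### The weight filtration of the polynomial ring -/

/-- A grading of weights of total degree zero by an order: pairwise disjoint sets of weights,
additive in the order. The example to keep in mind is `carrier m = Θ_m`. -/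
structure OrderedWeights (n : ℕ) where
  carrier : ℕ → Set (Fin n → ℤ)
  zero_mem : 0 ∈ carrier 0
  add_mem : ∀ {p q v w}, v ∈ carrier p → w ∈ carrier q → v + w ∈ carrier (p + q)
  sum_eq_zero : ∀ {m w}, w ∈ carrier m → ∑ k, w k = 0
  disjoint : ∀ {m m' w}, w ∈ carrier m → w ∈ carrier m' → m = m'

section Exponents

open MvPolynomial

variable {n : ℕ} {R : Type*} [CommRing R]

/-- The exponent vector of a monomial as an integral weight. -/
def toWeight (s : Fin n →₀ ℕ) : Fin n → ℤ := fun i => s i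

theorem toWeight_add (s t : Fin n →₀ ℕ) : toWeight (s + t) = toWeight s + toWeight t := by
  ext i; simp [toWeight]

theorem toWeight_single (a : Fin n) : toWeight (Finsupp.single a 1) = unitWeight a := by
  ext i; simp [toWeight, unitWeight, Finsupp.single_apply, Pi.single_apply, eq_comm]

theorem toWeight_zero : toWeight (0 : Fin n →₀ ℕ) = 0 := by
  ext i; simp [toWeight]

theorem unitWeight_nonneg (a : Fin n) : 0 ≤ unitWeight a := by
  intro i
  simp only [unitWeight, Pi.single_apply, Pi.zero_apply]
  split_ifs <;> simp

theorem sum_unitWeight (a : Fin n) : ∑ i, unitWeight a i = 1 := by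
  simp [unitWeight]

theorem abs_le_of_sum_le {s u : Fin n → ℤ} {b : ℤ} (hs : 0 ≤ s) (hu : 0 ≤ u)
    (hsb : ∑ i, s i ≤ b) (hub : ∑ i, u i ≤ b) (i : Fin n) : |s i - u i| ≤ b := by
  have h1 : s i ≤ b := (Finset.single_le_sum (fun i _ => hs i) (Finset.mem_univ i)).trans hsb
  have h2 : u i ≤ b := (Finset.single_le_sum (fun i _ => hu i) (Finset.mem_univ i)).trans hub
  have h3 : 0 ≤ s i := hs i
  have h4 : 0 ≤ u i := hu i
  rw [abs_le]
  constructor <;> linarith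

theorem derivation_eq_sum (D : Derivation R (MvPolynomial (Fin n) R) (MvPolynomial (Fin n) R))
    (f : MvPolynomial (Fin n) R) : D f = ∑ e, pderiv e f * D (X e) := by
  classical
  induction f using MvPolynomial.induction_on with
  | C a => simp
  | add f g hf hg => simp only [map_add, add_mul, Finset.sum_add_distrib, hf, hg]
  | mul_X f i hf =>
    simp only [Derivation.leibniz, smul_eq_mul, hf, pderiv_X, add_mul, Finset.sum_add_distrib,
      Finset.mul_sum, Pi.single_apply, mul_ite, ite_mul, mul_one, mul_zero, zero_mul,
      Finset.sum_ite_eq, Finset.mem_univ, if_true, mul_assoc]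

/-- The nonnegative part of an integral weight as an exponent vector. -/
noncomputable def toExponent (w : Fin n → ℤ) : Fin n →₀ ℕ :=
  Finsupp.equivFunOnFinite.symm fun i => (w i).toNat

theorem toWeight_toExponent {w : Fin n → ℤ} (h : 0 ≤ w) : toWeight (toExponent w) = w := by
  ext i
  simpa [toWeight, toExponent] using h i

theorem toExponent_toWeight (s : Fin n →₀ ℕ) : toExponent (toWeight s) = s := by
  ext i; simp [toExponent, toWeight]

theorem toWeight_nonneg (s : Fin n →₀ ℕ) : 0 ≤ toWeight s := fun i => by simp [toWeight]

open Classical in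
/-- The coefficient at an integral weight, zero unless the weight is nonnegative. -/
noncomputable def weightCoeff (w : Fin n → ℤ) : MvPolynomial (Fin n) R →ₗ[R] R :=
  if 0 ≤ w then lcoeff R (toExponent w) else 0

theorem weightCoeff_toWeight (s : Fin n →₀ ℕ) (f : MvPolynomial (Fin n) R) :
    weightCoeff (toWeight s) f = coeff s f := by
  rw [weightCoeff, if_pos (toWeight_nonneg s), toExponent_toWeight]; rfl

theorem weightCoeff_of_not_nonneg {w : Fin n → ℤ} (h : ¬ 0 ≤ w) (f : MvPolynomial (Fin n) R) :
    weightCoeff w f = 0 := by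
  rw [weightCoeff, if_neg h]; rfl

theorem nonneg_of_weightCoeff_ne_zero {w : Fin n → ℤ} {f : MvPolynomial (Fin n) R}
    (h : weightCoeff w f ≠ 0) : 0 ≤ w := by
  by_contra hw
  exact h (weightCoeff_of_not_nonneg hw f)

theorem exists_toWeight_eq {w : Fin n → ℤ} (h : 0 ≤ w) : ∃ s, toWeight s = w :=
  ⟨toExponent w, toWeight_toExponent h⟩

theorem sub_unitWeight_nonneg_iff {w : Fin n → ℤ} (h : 0 ≤ w) (a : Fin n) :
    0 ≤ w - unitWeight a ↔ w a ≠ 0 := by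
  constructor
  · intro hw h0
    simpa [unitWeight, h0] using hw a
  · intro ha i
    have hi : 0 ≤ w i := h i
    rcases eq_or_ne i a with rfl | hia
    · simp only [Pi.zero_apply, Pi.sub_apply, unitWeight, Pi.single_eq_same]
      omega
    · simpa [unitWeight, hia] using hi

theorem weightCoeff_X_mul (w : Fin n → ℤ) (a : Fin n) (f : MvPolynomial (Fin n) R) :
    weightCoeff w (X a * f) = weightCoeff (w - unitWeight a) f := by
  classical
  by_cases h : 0 ≤ w - unitWeight a
  · obtain ⟨t, ht⟩ := exists_toWeight_eq h
    obtain rfl : w = toWeight (Finsupp.single a 1 + t) := by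
      rw [toWeight_add, ht, toWeight_single, add_sub_cancel]
    rw [← ht, weightCoeff_toWeight, weightCoeff_toWeight, coeff_X_mul]
  · rw [weightCoeff_of_not_nonneg h]
    by_cases hw : 0 ≤ w
    · obtain ⟨s, rfl⟩ := exists_toWeight_eq hw
      rw [sub_unitWeight_nonneg_iff hw, not_not] at h
      rw [weightCoeff_toWeight, coeff_X_mul', if_neg]
      simpa [toWeight] using h
    · rw [weightCoeff_of_not_nonneg hw]

theorem weightCoeff_X_mul_pderiv (w : Fin n → ℤ) (a : Fin n) (f : MvPolynomial (Fin n) R) :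
    weightCoeff w (X a * pderiv a f) = (w a : R) * weightCoeff w f := by
  rw [weightCoeff_X_mul]
  by_cases hw : 0 ≤ w
  · by_cases h : 0 ≤ w - unitWeight a
    · obtain ⟨t, ht⟩ := exists_toWeight_eq h
      obtain rfl : w = toWeight (t + Finsupp.single a 1) := by
        rw [toWeight_add, ht, toWeight_single, sub_add_cancel]
      rw [← ht, weightCoeff_toWeight, weightCoeff_toWeight, coeff_pderiv, mul_comm]
      simp [toWeight]
    · rw [weightCoeff_of_not_nonneg h]
      rw [sub_unitWeight_nonneg_iff hw, not_not] at h
      rw [h, Int.cast_zero, zero_mul]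
  · rw [weightCoeff_of_not_nonneg hw, mul_zero, weightCoeff_of_not_nonneg]
    exact fun h => hw (h.trans (sub_le_self _ (unitWeight_nonneg a)))

end Exponents

section Filtration

open MvPolynomial

variable {n : ℕ} {R : Type*} [CommRing R] [Algebra ℂ R] (T : OrderedWeights n) (ε : R)

/-- The span of the powers `ε^m`, `m ≥ p`, such that `w` has order `m`. -/
def epsSpan (p : ℕ) (w : Fin n → ℤ) : Submodule ℂ R :=
  Submodule.span ℂ {r | ∃ m, p ≤ m ∧ w ∈ T.carrier m ∧ r = ε ^ m}

theorem epsSpan_mono {p q : ℕ} (h : p ≤ q) (w : Fin n → ℤ) : epsSpan T ε q w ≤ epsSpan T ε p w :=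
  Submodule.span_mono fun _ ⟨m, h1, h2⟩ => ⟨m, h.trans h1, h2⟩

theorem pow_mem_epsSpan {p m : ℕ} {w : Fin n → ℤ} (h : p ≤ m) (hw : w ∈ T.carrier m) :
    ε ^ m ∈ epsSpan T ε p w :=
  Submodule.subset_span ⟨m, h, hw, rfl⟩

theorem one_mem_epsSpan : (1 : R) ∈ epsSpan T ε 0 0 := by
  simpa using pow_mem_epsSpan T ε le_rfl T.zero_mem

variable {T ε}

theorem exists_of_mem_epsSpan {p : ℕ} {w : Fin n → ℤ} {r : R} (h : r ∈ epsSpan T ε p w)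
    (hr : r ≠ 0) : ∃ m, p ≤ m ∧ w ∈ T.carrier m := by
  by_contra! hcon
  have : {r | ∃ m, p ≤ m ∧ w ∈ T.carrier m ∧ r = ε ^ m} = ∅ := by
    ext r
    simp only [Set.mem_ofPred_eq, Set.mem_empty_iff_false, iff_false]
    rintro ⟨m, h1, h2, _⟩
    exact hcon m h1 h2
  rw [epsSpan, this, Submodule.span_empty] at h
  exact hr (by simpa using h)

theorem eq_zero_of_mem_epsSpan {p m : ℕ} {w : Fin n → ℤ} {r : R} (h : r ∈ epsSpan T ε p w)
    (hw : w ∈ T.carrier m) (hm : m < p) : r = 0 := by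
  by_contra hr
  obtain ⟨m', h1, h2⟩ := exists_of_mem_epsSpan h hr
  have := T.disjoint hw h2
  omega

theorem exists_smul_of_mem_epsSpan {p m : ℕ} {w : Fin n → ℤ} {r : R} (h : r ∈ epsSpan T ε p w)
    (hw : w ∈ T.carrier m) : ∃ c : ℂ, r = c • ε ^ m := by
  have hle : epsSpan T ε p w ≤ Submodule.span ℂ {ε ^ m} := by
    refine Submodule.span_mono ?_
    rintro r ⟨m', _, h2, rfl⟩
    rw [T.disjoint hw h2]; rfl
  obtain ⟨c, hc⟩ := Submodule.mem_span_singleton.mp (hle h)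
  exact ⟨c, hc.symm⟩

theorem mem_epsSpan_succ {p : ℕ} {w : Fin n → ℤ} {r : R} (h : r ∈ epsSpan T ε p w)
    (h0 : w ∈ T.carrier p → r = 0) : r ∈ epsSpan T ε (p + 1) w := by
  by_cases hr : r = 0
  · rw [hr]; exact zero_mem _
  obtain ⟨m, h1, h2⟩ := exists_of_mem_epsSpan h hr
  obtain ⟨c, rfl⟩ := exists_smul_of_mem_epsSpan h h2
  refine Submodule.smul_mem _ _ (pow_mem_epsSpan T ε ?_ h2)
  rcases h1.lt_or_eq with h3 | h3
  · exact h3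
  · exact absurd (h0 (h3 ▸ h2)) hr

theorem mul_mem_epsSpan {p q : ℕ} {v w : Fin n → ℤ} {r s : R} (hr : r ∈ epsSpan T ε p v)
    (hs : s ∈ epsSpan T ε q w) : r * s ∈ epsSpan T ε (p + q) (v + w) := by
  by_cases hr0 : r = 0
  · rw [hr0, zero_mul]; exact zero_mem _
  by_cases hs0 : s = 0
  · rw [hs0, mul_zero]; exact zero_mem _
  obtain ⟨m, h1, h2⟩ := exists_of_mem_epsSpan hr hr0
  obtain ⟨m', h1', h2'⟩ := exists_of_mem_epsSpan hs hs0
  obtain ⟨c, rfl⟩ := exists_smul_of_mem_epsSpan hr h2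
  obtain ⟨c', rfl⟩ := exists_smul_of_mem_epsSpan hs h2'
  rw [smul_mul_smul_comm, ← pow_add]
  exact Submodule.smul_mem _ _ (pow_mem_epsSpan T ε (add_le_add h1 h1') (T.add_mem h2 h2'))

variable (T ε) in
/-- The polynomials whose coefficient at `x^s` is a combination of those `ε^m`, `m ≥ p`, such that
`s - u` has order `m`. -/
def filtration (p : ℕ) (u : Fin n → ℤ) : Submodule ℂ (MvPolynomial (Fin n) R) where
  carrier := {f | ∀ s, coeff s f ∈ epsSpan T ε p (toWeight s - u)}
  zero_mem' s := by simp
  add_mem' hf hg s := by rw [coeff_add]; exact add_mem (hf s) (hg s)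
  smul_mem' c f hf s := by rw [coeff_smul]; exact Submodule.smul_mem _ _ (hf s)

theorem filtration_mono {p q : ℕ} (h : p ≤ q) {u : Fin n → ℤ} :
    filtration T ε q u ≤ filtration T ε p u :=
  fun _ hf s => epsSpan_mono T ε h _ (hf s)

theorem mul_mem_filtration {p q : ℕ} {u v : Fin n → ℤ} {f g : MvPolynomial (Fin n) R}
    (hf : f ∈ filtration T ε p u) (hg : g ∈ filtration T ε q v) :
    f * g ∈ filtration T ε (p + q) (u + v) := by
  classical
  intro s
  rw [coeff_mul]
  refine Submodule.sum_mem _ fun x hx => ?_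
  have : toWeight s - (u + v) = (toWeight x.1 - u) + (toWeight x.2 - v) := by
    rw [← Finset.HasAntidiagonal.mem_antidiagonal.mp hx, toWeight_add]; abel
  rw [this]
  exact mul_mem_epsSpan (hf _) (hg _)

theorem mul_mem_filtration_of_eq {p q r : ℕ} {u v w : Fin n → ℤ} {f g : MvPolynomial (Fin n) R}
    (hf : f ∈ filtration T ε p u) (hg : g ∈ filtration T ε q v) (hr : r = p + q) (hw : w = u + v) :
    f * g ∈ filtration T ε r w := by
  subst hr hw
  exact mul_mem_filtration hf hg

theorem monomial_mem_filtration {p : ℕ} {u : Fin n → ℤ} {s : Fin n →₀ ℕ} {r : R}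
    (h : r ∈ epsSpan T ε p (toWeight s - u)) : monomial s r ∈ filtration T ε p u := by
  classical
  intro t
  rw [coeff_monomial]
  split_ifs with hst
  · rw [← hst]; exact h
  · exact zero_mem _

theorem X_mem_filtration (a : Fin n) :
    (X a : MvPolynomial (Fin n) R) ∈ filtration T ε 0 (unitWeight a) := by
  refine monomial_mem_filtration ?_
  rw [toWeight_single, sub_self]
  exact one_mem_epsSpan T ε

theorem C_mul_mem_filtration (c : ℂ) {p : ℕ} {u : Fin n → ℤ} {f : MvPolynomial (Fin n) R}
    (hf : f ∈ filtration T ε p u) : C (algebraMap ℂ R c) * f ∈ filtration T ε p u := by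
  have : C (algebraMap ℂ R c) * f = c • f := by
    rw [Algebra.smul_def, MvPolynomial.algebraMap_apply]
  rw [this]
  exact Submodule.smul_mem _ _ hf

theorem pderiv_mem_filtration (d : Fin n) {p : ℕ} {u : Fin n → ℤ} {f : MvPolynomial (Fin n) R}
    (hf : f ∈ filtration T ε p u) : pderiv d f ∈ filtration T ε p (u - unitWeight d) := by
  intro s
  rw [coeff_pderiv]
  have : toWeight s - (u - unitWeight d) = toWeight (s + Finsupp.single d 1) - u := by
    rw [toWeight_add, toWeight_single]; abel
  rw [this]
  have h2 := Submodule.smul_mem _ ((s d : ℂ) + 1) (hf (s + Finsupp.single d 1))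
  rw [Algebra.smul_def] at h2
  rw [mul_comm]
  simpa using h2

theorem derivation_mem_filtration
    {D : Derivation R (MvPolynomial (Fin n) R) (MvPolynomial (Fin n) R)}
    {p q : ℕ} {u v : Fin n → ℤ} {f : MvPolynomial (Fin n) R}
    (hD : ∀ e, D (X e) ∈ filtration T ε q (v + unitWeight e)) (hf : f ∈ filtration T ε p u) :
    D f ∈ filtration T ε (p + q) (u + v) := by
  rw [derivation_eq_sum]
  refine Submodule.sum_mem _ fun e _ => ?_
  exact mul_mem_filtration_of_eq (pderiv_mem_filtration e hf) (hD e) rfl (by abel)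

theorem weightCoeff_mem_epsSpan {p : ℕ} {u w : Fin n → ℤ} {f : MvPolynomial (Fin n) R}
    (hf : f ∈ filtration T ε p u) : weightCoeff (w + u) f ∈ epsSpan T ε p w := by
  by_cases h : 0 ≤ w + u
  · rw [← toWeight_toExponent h, weightCoeff_toWeight]
    have := hf (toExponent (w + u))
    rwa [toWeight_toExponent h, add_sub_cancel_right] at this
  · rw [weightCoeff_of_not_nonneg h]; exact zero_mem _

theorem weightCoeff_eq_zero {p m : ℕ} {u w : Fin n → ℤ} {f : MvPolynomial (Fin n) R}
    (hf : f ∈ filtration T ε p u) (hw : w ∈ T.carrier m) (hm : m < p) : weightCoeff (w + u) f = 0 :=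
  eq_zero_of_mem_epsSpan (weightCoeff_mem_epsSpan hf) hw hm

theorem mem_filtration_succ {p : ℕ} {u : Fin n → ℤ} {f : MvPolynomial (Fin n) R}
    (hf : f ∈ filtration T ε p u) (h : ∀ w ∈ T.carrier p, weightCoeff (w + u) f = 0) :
    f ∈ filtration T ε (p + 1) u := by
  intro s
  refine mem_epsSpan_succ (hf s) fun hw => ?_
  have := h _ hw
  rwa [sub_add_cancel, weightCoeff_toWeight] at this

theorem exists_order_bound (T : OrderedWeights n) (b : ℤ) :
    ∃ K, ∀ m, K ≤ m → ∀ w ∈ T.carrier m, ¬ ∀ i, |w i| ≤ b := by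
  have hfin : (Set.Icc (fun _ => -b) (fun _ => b) : Set (Fin n → ℤ)).Finite := Set.finite_Icc _ _
  have h : ∀ w : Fin n → ℤ, ∃ K, ∀ m, K ≤ m → w ∉ T.carrier m := by
    intro w
    by_cases hw : ∃ m, w ∈ T.carrier m
    · obtain ⟨m, hm⟩ := hw
      refine ⟨m + 1, fun m' hm' h' => ?_⟩
      have := T.disjoint hm h'
      omega
    · exact ⟨0, fun m _ hm => hw ⟨m, hm⟩⟩
  choose K hK using h
  refine ⟨hfin.toFinset.sup K, fun m hm w hw hb => ?_⟩
  refine hK w m (le_trans (Finset.le_sup (f := K) ?_) hm) hw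
  rw [Set.Finite.mem_toFinset, Set.mem_Icc]
  exact ⟨fun i => (abs_le.mp (hb i)).1, fun i => (abs_le.mp (hb i)).2⟩

theorem sum_toWeight_eq {p : ℕ} {u : Fin n → ℤ} {f : MvPolynomial (Fin n) R}
    (hf : f ∈ filtration T ε p u)
    {s : Fin n →₀ ℕ} (hs : coeff s f ≠ 0) : ∑ i, toWeight s i = ∑ i, u i := by
  obtain ⟨m, _, hw⟩ := exists_of_mem_epsSpan (hf s) hs
  have := T.sum_eq_zero hw
  simp only [Pi.sub_apply, Finset.sum_sub_distrib] at this
  omega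

theorem eq_zero_of_mem_filtration {b : ℤ} {K : ℕ}
    (hK : ∀ m, K ≤ m → ∀ w ∈ T.carrier m, ¬ ∀ i, |w i| ≤ b) {p : ℕ} (hp : K ≤ p)
    {u : Fin n → ℤ} (hu : 0 ≤ u) (hub : ∑ i, u i ≤ b) {f : MvPolynomial (Fin n) R}
    (hf : f ∈ filtration T ε p u) : f = 0 := by
  ext s
  rw [coeff_zero]
  by_contra hs
  obtain ⟨m, hm, hw⟩ := exists_of_mem_epsSpan (hf s) hs
  refine hK m (hp.trans hm) _ hw fun i => ?_
  exact abs_le_of_sum_le (toWeight_nonneg s) hu ((sum_toWeight_eq hf hs).trans_le hub) hub i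

end Filtration

/-! ### Biderivations of the polynomial ring -/

section Brackets

open MvPolynomial

variable {n : ℕ} {R : Type*} [CommRing R]

/-- The Hamiltonian derivation `g ↦ ∑ P_ab ∂_a f ∂_b g` of `f`, for the biderivation with matrix
`P`. -/
noncomputable def hamiltonian (P : Fin n → Fin n → MvPolynomial (Fin n) R)
    (f : MvPolynomial (Fin n) R) :
    Derivation R (MvPolynomial (Fin n) R) (MvPolynomial (Fin n) R) :=
  mkDerivation R fun b => ∑ a, pderiv a f * P a b

/-- The biderivation with `{x_a, x_b} = P_ab`, for a matrix `P` that need be neither alternating nor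
Poisson. -/
noncomputable def bracketOf (P : Fin n → Fin n → MvPolynomial (Fin n) R)
    (f g : MvPolynomial (Fin n) R) : MvPolynomial (Fin n) R :=
  hamiltonian P f g

variable (P Q : Fin n → Fin n → MvPolynomial (Fin n) R)

theorem bracketOf_X_right (f : MvPolynomial (Fin n) R) (b : Fin n) :
    bracketOf P f (X b) = ∑ a, pderiv a f * P a b := by
  rw [bracketOf, hamiltonian, mkDerivation_X]

theorem bracketOf_eq (f g : MvPolynomial (Fin n) R) :
    bracketOf P f g = ∑ b, pderiv b g * ∑ a, pderiv a f * P a b := by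
  rw [bracketOf, derivation_eq_sum]
  exact Finset.sum_congr rfl fun b _ => congrArg _ (bracketOf_X_right P f b)

theorem bracketOf_X_left (a : Fin n) (g : MvPolynomial (Fin n) R) :
    bracketOf P (X a) g = ∑ b, pderiv b g * P a b := by
  classical
  rw [bracketOf_eq]
  refine Finset.sum_congr rfl fun b _ => ?_
  simp [pderiv_X, Pi.single_apply]

theorem bracketOf_X_X (a b : Fin n) : bracketOf P (X a) (X b) = P a b := by
  classical
  rw [bracketOf_X_left]
  simp [pderiv_X, Pi.single_apply]

theorem bracketOf_add (f g : MvPolynomial (Fin n) R) :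
    bracketOf (P + Q) f g = bracketOf P f g + bracketOf Q f g := by
  simp only [bracketOf_eq, Pi.add_apply, mul_add, Finset.sum_add_distrib]

theorem bracketOf_sub (f g : MvPolynomial (Fin n) R) :
    bracketOf (P - Q) f g = bracketOf P f g - bracketOf Q f g := by
  simp only [bracketOf_eq, Pi.sub_apply, mul_sub, Finset.sum_sub_distrib]

theorem bracketOf_add_right (f g h : MvPolynomial (Fin n) R) :
    bracketOf P f (g + h) = bracketOf P f g + bracketOf P f h :=
  map_add _ _ _

theorem bracketOf_sub_right (f g h : MvPolynomial (Fin n) R) :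
    bracketOf P f (g - h) = bracketOf P f g - bracketOf P f h :=
  map_sub _ _ _

theorem bracketOf_neg_right (f g : MvPolynomial (Fin n) R) :
    bracketOf P f (-g) = -bracketOf P f g :=
  map_neg _ _

theorem bracketOf_C_mul_right (c : R) (f g : MvPolynomial (Fin n) R) :
    bracketOf P f (C c * g) = C c * bracketOf P f g := by
  rw [← smul_eq_C_mul, ← smul_eq_C_mul]; exact Derivation.map_smul _ c g

theorem bracketOf_mul_right (f g h : MvPolynomial (Fin n) R) :
    bracketOf P f (g * h) = g * bracketOf P f h + h * bracketOf P f g :=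
  (hamiltonian P f).leibniz g h

theorem bracketOf_smul_right (c : R) (f g : MvPolynomial (Fin n) R) :
    bracketOf P f (c • g) = c • bracketOf P f g :=
  Derivation.map_smul _ c g

theorem bracketOf_add_left (f g h : MvPolynomial (Fin n) R) :
    bracketOf P (f + g) h = bracketOf P f h + bracketOf P g h := by
  simp only [bracketOf_eq, map_add, add_mul, mul_add, Finset.sum_add_distrib]

theorem bracketOf_smul_left (c : R) (f g : MvPolynomial (Fin n) R) :
    bracketOf P (c • f) g = c • bracketOf P f g := by
  simp only [bracketOf_eq, Derivation.map_smul, smul_mul_assoc, ← Finset.smul_sum, mul_smul_comm]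

variable {P Q}

theorem bracketOf_swap (hP : ∀ a b, P a b = -P b a) (f g : MvPolynomial (Fin n) R) :
    bracketOf P f g = -bracketOf P g f := by
  rw [bracketOf_eq, bracketOf_eq]
  simp only [Finset.mul_sum]
  rw [Finset.sum_comm, ← Finset.sum_neg_distrib]
  refine Finset.sum_congr rfl fun a _ => ?_
  rw [← Finset.sum_neg_distrib]
  refine Finset.sum_congr rfl fun b _ => ?_
  rw [hP a b]; ring

variable (P) in
/-- The Jacobiator of the biderivation `bracketOf P`, which measures the failure of the Jacobi
identity. -/
noncomputable def jacobiator (f g h : MvPolynomial (Fin n) R) : MvPolynomial (Fin n) R :=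
  bracketOf P f (bracketOf P g h) + bracketOf P g (bracketOf P h f) +
    bracketOf P h (bracketOf P f g)

theorem jacobiator_cyclic (f g h : MvPolynomial (Fin n) R) :
    jacobiator P f g h = jacobiator P g h f := by
  simp only [jacobiator]; abel

theorem jacobiator_swap (hP : ∀ a b, P a b = -P b a) (f g h : MvPolynomial (Fin n) R) :
    jacobiator P f g h = -jacobiator P g f h := by
  simp only [jacobiator]
  rw [bracketOf_swap hP g h, bracketOf_swap hP h f, bracketOf_swap hP f g, bracketOf_neg_right,
    bracketOf_neg_right, bracketOf_neg_right]
  abel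

theorem exists_jacobiator_derivation (hP : ∀ a b, P a b = -P b a) (f g : MvPolynomial (Fin n) R) :
    ∃ D : Derivation R (MvPolynomial (Fin n) R) (MvPolynomial (Fin n) R),
      ∀ h, jacobiator P f g h = D h := by
  refine ⟨⁅hamiltonian P f, hamiltonian P g⁆ - hamiltonian P (bracketOf P f g), fun h => ?_⟩
  rw [Derivation.sub_apply, Derivation.commutator_apply]
  change jacobiator P f g h = bracketOf P f (bracketOf P g h) -
    bracketOf P g (bracketOf P f h) - bracketOf P (bracketOf P f g) h
  rw [jacobiator, bracketOf_swap hP h f, bracketOf_swap hP h (bracketOf P f g), bracketOf_neg_right]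
  abel

theorem jacobiator_eq_sum (hP : ∀ a b, P a b = -P b a) (f g h : MvPolynomial (Fin n) R) :
    jacobiator P f g h = ∑ e, pderiv e h * jacobiator P f g (X e) := by
  obtain ⟨D, hD⟩ := exists_jacobiator_derivation hP f g
  simp only [hD]
  exact derivation_eq_sum D h

theorem jacobiator_eq_zero (hP : ∀ a b, P a b = -P b a)
    (h0 : ∀ a b c, jacobiator P (X a) (X b) (X c) = 0) (f g h : MvPolynomial (Fin n) R) :
    jacobiator P f g h = 0 := by
  have h1 : ∀ a b h, jacobiator P (X a) (X b) h = 0 := fun a b h => by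
    rw [jacobiator_eq_sum hP]; simp [h0]
  have h2 : ∀ a g h, jacobiator P (X a) g h = 0 := fun a g h => by
    rw [jacobiator_cyclic, jacobiator_cyclic, jacobiator_eq_sum hP]
    refine Finset.sum_eq_zero fun e _ => ?_
    rw [jacobiator_cyclic, h1, mul_zero]
  rw [jacobiator_eq_sum hP]
  refine Finset.sum_eq_zero fun e _ => ?_
  rw [jacobiator_cyclic, jacobiator_cyclic, h2, mul_zero]

/-- The identity `[P, [P, P]] = 0` for the Schouten bracket, evaluated on four functions. -/
theorem jacobiator_cocycle (hP : ∀ a b, P a b = -P b a) (a b c d : MvPolynomial (Fin n) R) :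
    bracketOf P a (jacobiator P b c d) - bracketOf P b (jacobiator P a c d) +
      bracketOf P c (jacobiator P a b d) - bracketOf P d (jacobiator P a b c) =
    jacobiator P (bracketOf P a b) c d - jacobiator P (bracketOf P a c) b d +
      jacobiator P (bracketOf P a d) b c + jacobiator P (bracketOf P b c) a d
      - jacobiator P (bracketOf P b d) a c + jacobiator P (bracketOf P c d) a b := by
  have s := bracketOf_swap hP
  simp only [jacobiator, s c a, s d a, s d b, bracketOf_add_right, bracketOf_neg_right,
    s (bracketOf P a b) c, s (bracketOf P a c) b, s (bracketOf P a d) b, s (bracketOf P b c) a,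
    s (bracketOf P b d) a, s (bracketOf P c d) a, s (bracketOf P c d) (bracketOf P a b),
    s (bracketOf P b d) (bracketOf P a c), s (bracketOf P b c) (bracketOf P a d)]
  abel

/-- The Poisson bracket with `{x_a, x_b} = P_ab`. Over a domain of characteristic zero it suffices
that `P` is skew and that the Jacobi identity holds on the variables. -/
noncomputable def poissonOfMatrix [IsDomain R] [CharZero R]
    (P : Fin n → Fin n → MvPolynomial (Fin n) R) (hP : ∀ a b, P a b = -P b a)
    (hj : ∀ a b c, jacobiator P (X a) (X b) (X c) = 0) :
    PoissonBracket R (MvPolynomial (Fin n) R) where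
  bracket := LinearMap.mk₂ R (bracketOf P) (bracketOf_add_left P) (bracketOf_smul_left P)
    (bracketOf_add_right P) (bracketOf_smul_right P)
  bracket_self f := self_eq_neg.mp (bracketOf_swap hP f f)
  jacobi f g h := jacobiator_eq_zero hP hj f g h
  leibniz f g h := by
    rw [LinearMap.mk₂_apply, LinearMap.mk₂_apply, LinearMap.mk₂_apply, bracketOf_mul_right]
    ring

/-- The matrix of brackets of the variables. -/
noncomputable def PoissonBracket.matrix (B : PoissonBracket R (MvPolynomial (Fin n) R))
    (a b : Fin n) : MvPolynomial (Fin n) R := B.bracket (X a) (X b)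

theorem PoissonBracket.swap {A : Type*} [CommRing A] [Algebra R A] (B : PoissonBracket R A)
    (f g : A) : B.bracket f g = -B.bracket g f := by
  have := B.bracket_self (f + g)
  simp only [map_add, LinearMap.add_apply, B.bracket_self, zero_add, add_zero] at this
  exact eq_neg_of_add_eq_zero_right this

theorem PoissonBracket.eq_sum (B : PoissonBracket R (MvPolynomial (Fin n) R))
    (f g : MvPolynomial (Fin n) R) :
    B.bracket f g = ∑ b, pderiv b g * B.bracket f (X b) :=
  derivation_eq_sum (Derivation.mk' (B.bracket f) fun g h => by
    rw [B.leibniz, smul_eq_mul, smul_eq_mul]; ring) g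

theorem PoissonBracket.eq_bracketOf (B : PoissonBracket R (MvPolynomial (Fin n) R))
    (f g : MvPolynomial (Fin n) R) : B.bracket f g = bracketOf B.matrix f g := by
  rw [B.eq_sum, bracketOf_eq]
  refine Finset.sum_congr rfl fun b _ => congrArg _ ?_
  rw [B.swap, B.eq_sum, ← Finset.sum_neg_distrib]
  refine Finset.sum_congr rfl fun a _ => ?_
  rw [PoissonBracket.matrix, B.swap (X a)]; ring

theorem PoissonBracket.jacobiator_eq_zero (B : PoissonBracket R (MvPolynomial (Fin n) R))
    (f g h : MvPolynomial (Fin n) R) : jacobiator B.matrix f g h = 0 := by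
  simp only [jacobiator, ← B.eq_bracketOf]
  exact B.jacobi f g h

theorem PoissonBracket.matrix_sub_swap (B B' : PoissonBracket R (MvPolynomial (Fin n) R))
    (a b : Fin n) : (B.matrix - B'.matrix) a b = -(B.matrix - B'.matrix) b a := by
  simp only [Pi.sub_apply, PoissonBracket.matrix, B.swap (X a), B'.swap (X a)]
  ring

theorem PoissonBracket.eq_of_matrix_eq {B B' : PoissonBracket R (MvPolynomial (Fin n) R)}
    (h : B.matrix = B'.matrix) (f g : MvPolynomial (Fin n) R) :
    B.bracket f g = B'.bracket f g := by
  rw [B.eq_bracketOf, B'.eq_bracketOf, h]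

theorem jacobiator_add_sub_jacobiator (P Q : Fin n → Fin n → MvPolynomial (Fin n) R)
    (a b c : Fin n) :
    jacobiator (P + Q) (X a) (X b) (X c) - jacobiator P (X a) (X b) (X c) =
      (bracketOf (P + Q) (X a) (Q b c) + bracketOf Q (X a) (P b c)) +
      (bracketOf (P + Q) (X b) (Q c a) + bracketOf Q (X b) (P c a)) +
      (bracketOf (P + Q) (X c) (Q a b) + bracketOf Q (X c) (P a b)) := by
  simp only [jacobiator, bracketOf_X_X, bracketOf_add, Pi.add_apply, bracketOf_add_right]
  abel

/-- The coefficients of order `W` of a biderivation with matrix `Q`, that is the coefficient of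
`Q a b` at the weight `W + e_a + e_b`. -/
noncomputable def bivectorCoeff (Q : Fin n → Fin n → MvPolynomial (Fin n) R) (W : Fin n → ℤ)
    (a b : Fin n) : R :=
  weightCoeff (W + (unitWeight a + unitWeight b)) (Q a b)

/-- The coefficients of order `W` of the Jacobiator, that is the coefficient of its value on
`x_a, x_b, x_c` at the weight `W + e_a + e_b + e_c`. -/
noncomputable def jacobiatorCoeff (P : Fin n → Fin n → MvPolynomial (Fin n) R) (W : Fin n → ℤ)
    (a b c : Fin n) : R :=
  weightCoeff (W + (unitWeight a + unitWeight b + unitWeight c)) (jacobiator P (X a) (X b) (X c))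

theorem bivectorCoeff_swap {Q : Fin n → Fin n → MvPolynomial (Fin n) R}
    (hQ : ∀ a b, Q a b = -Q b a) (W : Fin n → ℤ) (a b : Fin n) :
    bivectorCoeff Q W a b = -bivectorCoeff Q W b a := by
  rw [bivectorCoeff, bivectorCoeff, hQ a b, map_neg, add_comm (unitWeight a)]

theorem jacobiatorCoeff_cyclic (P : Fin n → Fin n → MvPolynomial (Fin n) R) (W : Fin n → ℤ)
    (a b c : Fin n) : jacobiatorCoeff P W a b c = jacobiatorCoeff P W b c a := by
  rw [jacobiatorCoeff, jacobiatorCoeff, jacobiator_cyclic,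
    add_rotate (unitWeight a) (unitWeight b) (unitWeight c)]

theorem jacobiatorCoeff_swap {P : Fin n → Fin n → MvPolynomial (Fin n) R}
    (hP : ∀ a b, P a b = -P b a) (W : Fin n → ℤ) (a b c : Fin n) :
    jacobiatorCoeff P W a b c = -jacobiatorCoeff P W b a c := by
  rw [jacobiatorCoeff, jacobiatorCoeff, jacobiator_swap hP, map_neg, add_comm (unitWeight a)]

end Brackets

/-! ### Filtered brackets -/

section Filtered

open MvPolynomial

variable {n : ℕ} {R : Type*} [CommRing R] [Algebra ℂ R] {T : OrderedWeights n} {ε : R}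

theorem bracketOf_mem_filtration {P : Fin n → Fin n → MvPolynomial (Fin n) R} {p q r m : ℕ}
    {u v w : Fin n → ℤ}
    (hP : ∀ a b, P a b ∈ filtration T ε r (unitWeight a + unitWeight b))
    {f g : MvPolynomial (Fin n) R} (hf : f ∈ filtration T ε p u) (hg : g ∈ filtration T ε q v)
    (hm : m = p + q + r) (hw : w = u + v) : bracketOf P f g ∈ filtration T ε m w := by
  have hD : ∀ e, hamiltonian P f (X e) ∈ filtration T ε (p + r) (u + unitWeight e) := by
    intro e
    change bracketOf P f (X e) ∈ _
    rw [bracketOf_X_right]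
    refine Submodule.sum_mem _ fun a _ => ?_
    exact mul_mem_filtration_of_eq (pderiv_mem_filtration a hf) (hP a e) rfl (by abel)
  have := derivation_mem_filtration hD hg
  rw [hm, hw, show p + q + r = q + (p + r) by ring, add_comm u v]
  exact this

/-- The matrix of brackets of the variables of the toric Poisson structure. -/
noncomputable def toricMatrix (R : Type*) [CommRing R] [Algebra ℂ R]
    (lam : Matrix (Fin n) (Fin n) ℂ) (a b : Fin n) : MvPolynomial (Fin n) R :=
  C (algebraMap ℂ R (lam a b)) * X a * X b

/-- The image in `R` of the `a`-th coordinate of `λ w`: up to the factor `x_a x^w` it is the toric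
bracket of `x_a` with the Laurent monomial `x^w`. -/
noncomputable def pairing (R : Type*) [CommRing R] [Algebra ℂ R]
    (lam : Matrix (Fin n) (Fin n) ℂ) (w : Fin n → ℤ) (a : Fin n) : R :=
  algebraMap ℂ R (lam.mulVec (fun k => (w k : ℂ)) a)

variable {lam : Matrix (Fin n) (Fin n) ℂ}

theorem pairing_add (v w : Fin n → ℤ) (a : Fin n) :
    pairing R lam (v + w) a = pairing R lam v a + pairing R lam w a := by
  rw [pairing, pairing, pairing, ← map_add, ← Pi.add_apply, ← Matrix.mulVec_add]
  congr 3
  ext k; simp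

theorem pairing_unitWeight (a b : Fin n) :
    pairing R lam (unitWeight b) a = algebraMap ℂ R (lam a b) := by
  rw [pairing]
  congr 1
  simp [Matrix.mulVec, dotProduct, unitWeight, Pi.single_apply]

theorem toricMatrix_mem_filtration (a b : Fin n) :
    toricMatrix R lam a b ∈ filtration T ε 0 (unitWeight a + unitWeight b) := by
  rw [toricMatrix, mul_assoc]
  exact C_mul_mem_filtration _
    (mul_mem_filtration_of_eq (X_mem_filtration a) (X_mem_filtration b) (zero_add 0).symm rfl)

theorem toricMatrix_swap (halt : lam.transpose = -lam) (a b : Fin n) :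
    toricMatrix R lam a b = -toricMatrix R lam b a := by
  rw [toricMatrix, toricMatrix, apply_swap_of_transpose_eq_neg halt a b, map_neg, map_neg]; ring

theorem bracketOf_toric (a : Fin n) (f : MvPolynomial (Fin n) R) :
    bracketOf (toricMatrix R lam) (X a) f =
      X a * ∑ b, C (algebraMap ℂ R (lam a b)) * (X b * pderiv b f) := by
  rw [bracketOf_X_left, Finset.mul_sum]
  refine Finset.sum_congr rfl fun b _ => ?_
  rw [toricMatrix]; ring

theorem weightCoeff_bracketOf_toric (w : Fin n → ℤ) (a : Fin n) (f : MvPolynomial (Fin n) R) :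
    weightCoeff (w + unitWeight a) (bracketOf (toricMatrix R lam) (X a) f) =
      pairing R lam w a * weightCoeff w f := by
  rw [bracketOf_toric, weightCoeff_X_mul, add_sub_cancel_right, map_sum]
  simp only [← smul_eq_C_mul, map_smul, weightCoeff_X_mul_pderiv, smul_eq_mul, pairing,
    Matrix.mulVec, dotProduct, map_sum, map_mul, Finset.sum_mul, map_intCast, mul_assoc]

theorem jacobiator_toric (halt : lam.transpose = -lam) (a b c : Fin n) :
    jacobiator (toricMatrix R lam) (X a) (X b) (X c) = 0 := by
  have hlam := apply_swap_of_transpose_eq_neg halt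
  have hbr : ∀ a b c : Fin n, bracketOf (toricMatrix R lam) (X a) (toricMatrix R lam b c) =
      C (algebraMap ℂ R (lam b c)) * (C (algebraMap ℂ R (lam a b)) + C (algebraMap ℂ R (lam a c))) *
        (X a * X b * X c) := by
    intro a b c
    conv_lhs => rw [toricMatrix, mul_assoc, bracketOf_C_mul_right, bracketOf_mul_right,
      bracketOf_X_X, bracketOf_X_X]
    simp only [toricMatrix]
    ring
  rw [jacobiator, bracketOf_X_X, bracketOf_X_X, bracketOf_X_X, hbr, hbr, hbr, hlam b a, hlam c a,
    hlam c b]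
  simp only [map_neg]
  ring

variable (T ε lam) in
/-- The skew matrices of brackets which agree with the toric one to order zero. -/
structure IsNearToric (P : Fin n → Fin n → MvPolynomial (Fin n) R) : Prop where
  swap : ∀ a b, P a b = -P b a
  sub_mem : ∀ a b, P a b - toricMatrix R lam a b ∈ filtration T ε 1 (unitWeight a + unitWeight b)

theorem IsNearToric.mem {P : Fin n → Fin n → MvPolynomial (Fin n) R}
    (hP : IsNearToric T ε lam P) (a b : Fin n) :
    P a b ∈ filtration T ε 0 (unitWeight a + unitWeight b) := by
  have := add_mem (filtration_mono zero_le_one (hP.sub_mem a b))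
    (toricMatrix_mem_filtration (lam := lam) a b)
  rwa [sub_add_cancel] at this

theorem isNearToric_toric (halt : lam.transpose = -lam) :
    IsNearToric T ε lam (toricMatrix R lam) :=
  ⟨toricMatrix_swap halt, fun a b => by rw [sub_self]; exact zero_mem _⟩

theorem IsNearToric.add {P Q : Fin n → Fin n → MvPolynomial (Fin n) R}
    (hP : IsNearToric T ε lam P) (hQs : ∀ a b, Q a b = -Q b a)
    (hQ : ∀ a b, Q a b ∈ filtration T ε 1 (unitWeight a + unitWeight b)) :
    IsNearToric T ε lam (P + Q) :=
  ⟨fun a b => by simp only [Pi.add_apply]; rw [hP.swap, hQs, neg_add],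
    fun a b => by
      have := add_mem (hP.sub_mem a b) (hQ a b)
      rwa [sub_add_eq_add_sub] at this⟩

theorem IsNearToric.bracketOf_sub_mem {P : Fin n → Fin n → MvPolynomial (Fin n) R}
    (hP : IsNearToric T ε lam P) {p q m : ℕ} {u v w : Fin n → ℤ}
    {f g : MvPolynomial (Fin n) R} (hf : f ∈ filtration T ε q v)
    (hg : g ∈ filtration T ε p u) (hm : m = q + p + 1) (hw : w = v + u) :
    bracketOf P f g - bracketOf (toricMatrix R lam) f g ∈ filtration T ε m w := by
  rw [← bracketOf_sub]
  exact bracketOf_mem_filtration hP.sub_mem hf hg hm hw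

theorem IsNearToric.weightCoeff_bracketOf {P : Fin n → Fin n → MvPolynomial (Fin n) R}
    (hP : IsNearToric T ε lam P) {m : ℕ} {u W w : Fin n → ℤ} {f : MvPolynomial (Fin n) R}
    (hf : f ∈ filtration T ε m u) (hW : W ∈ T.carrier m) (a : Fin n)
    (hw : w = W + u + unitWeight a) :
    weightCoeff w (bracketOf P (X a) f) =
      (pairing R lam W a + pairing R lam u a) * weightCoeff (W + u) f := by
  have h1 := hP.bracketOf_sub_mem (X_mem_filtration a) hf (show m + 1 = 0 + m + 1 by ring) rfl
  have h2 := weightCoeff_eq_zero h1 hW (Nat.lt_succ_self m)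
  rw [map_sub, show W + (unitWeight a + u) = W + u + unitWeight a by abel,
    weightCoeff_bracketOf_toric, pairing_add] at h2
  rw [hw]
  exact sub_eq_zero.mp h2

theorem weightCoeff_bracketOf_of_mem {P Q : Fin n → Fin n → MvPolynomial (Fin n) R}
    (hP : IsNearToric T ε lam P) {m : ℕ} {W w : Fin n → ℤ}
    (hQ : ∀ a b, Q a b ∈ filtration T ε m (unitWeight a + unitWeight b))
    (hW : W ∈ T.carrier m) (a b c : Fin n)
    (hw : w = W + (unitWeight b + unitWeight c) + unitWeight a) :
    weightCoeff w (bracketOf Q (X a) (P b c)) =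
      algebraMap ℂ R (lam b c) * (bivectorCoeff Q W a b + bivectorCoeff Q W a c) := by
  have hmem : bracketOf Q (X a) (P b c) - bracketOf Q (X a) (toricMatrix R lam b c) ∈
      filtration T ε (m + 1) (unitWeight a + (unitWeight b + unitWeight c)) := by
    rw [← bracketOf_sub_right]
    exact bracketOf_mem_filtration hQ (X_mem_filtration a) (hP.sub_mem b c) (by ring) rfl
  have hcoeff := weightCoeff_eq_zero hmem hW (Nat.lt_succ_self m)
  rw [map_sub, sub_eq_zero] at hcoeff
  rw [hw, add_assoc, add_comm (unitWeight b + unitWeight c),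
    hcoeff, toricMatrix, mul_assoc, bracketOf_C_mul_right, bracketOf_mul_right, bracketOf_X_X,
    bracketOf_X_X, ← smul_eq_C_mul, map_smul, map_add, weightCoeff_X_mul, weightCoeff_X_mul,
    smul_eq_mul, bivectorCoeff, bivectorCoeff, add_comm (weightCoeff _ (Q a b))]
  congr 4 <;> abel

/-- To leading order the Jacobiator changes by the toric Poisson differential of the
perturbation. -/
theorem jacobiatorCoeff_add (halt : lam.transpose = -lam)
    {P Q : Fin n → Fin n → MvPolynomial (Fin n) R} (hP : IsNearToric T ε lam P)
    (hQs : ∀ a b, Q a b = -Q b a) {m : ℕ} (hm : 1 ≤ m)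
    (hQ : ∀ a b, Q a b ∈ filtration T ε m (unitWeight a + unitWeight b)) {W : Fin n → ℤ}
    (hW : W ∈ T.carrier m) (a b c : Fin n) :
    jacobiatorCoeff (P + Q) W a b c = jacobiatorCoeff P W a b c +
      (pairing R lam W a * bivectorCoeff Q W b c + pairing R lam W b * bivectorCoeff Q W c a +
        pairing R lam W c * bivectorCoeff Q W a b) := by
  have hPQ : IsNearToric T ε lam (P + Q) := hP.add hQs fun a b => filtration_mono hm (hQ a b)
  have hlam := apply_swap_of_transpose_eq_neg halt
  have hswap := bivectorCoeff_swap hQs W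
  rw [← sub_eq_iff_eq_add', jacobiatorCoeff, jacobiatorCoeff, ← map_sub,
    jacobiator_add_sub_jacobiator]
  simp only [map_add]
  rw [hPQ.weightCoeff_bracketOf (hQ b c) hW a (by abel),
    hPQ.weightCoeff_bracketOf (hQ c a) hW b (by abel),
    hPQ.weightCoeff_bracketOf (hQ a b) hW c (by abel),
    weightCoeff_bracketOf_of_mem hP hQ hW a b c (by abel),
    weightCoeff_bracketOf_of_mem hP hQ hW b c a (by abel),
    weightCoeff_bracketOf_of_mem hP hQ hW c a b (by abel)]
  simp only [bivectorCoeff, pairing_add, pairing_unitWeight] at hswap ⊢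
  rw [hswap a c, hswap b a, hswap c b, hlam a c, hlam b a, hlam c b]
  simp only [map_neg]
  ring

theorem IsNearToric.jacobiator_sub_mem {P Q : Fin n → Fin n → MvPolynomial (Fin n) R}
    (hP : IsNearToric T ε lam P) {m : ℕ}
    (hQ : ∀ a b, Q a b ∈ filtration T ε m (unitWeight a + unitWeight b)) (a b c : Fin n) :
    jacobiator (P + Q) (X a) (X b) (X c) - jacobiator P (X a) (X b) (X c) ∈
      filtration T ε m (unitWeight a + unitWeight b + unitWeight c) := by
  have hPQ : ∀ a b, (P + Q) a b ∈ filtration T ε 0 (unitWeight a + unitWeight b) := fun a b =>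
    add_mem (hP.mem a b) (filtration_mono (Nat.zero_le m) (hQ a b))
  have hterm : ∀ {w : Fin n → ℤ} (a b c), w = unitWeight a + unitWeight b + unitWeight c →
      bracketOf (P + Q) (X a) (Q b c) + bracketOf Q (X a) (P b c) ∈ filtration T ε m w :=
    fun a b c hw => add_mem
      (bracketOf_mem_filtration hPQ (X_mem_filtration a) (hQ b c) (by ring) (by rw [hw]; abel))
      (bracketOf_mem_filtration hQ (X_mem_filtration a) (hP.mem b c) (by ring) (by rw [hw]; abel))
  rw [jacobiator_add_sub_jacobiator]
  exact add_mem (add_mem (hterm a b c rfl) (hterm b c a (by abel))) (hterm c a b (by abel))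

theorem derivation_C_mul_X_mul_X {R : Type*} [CommRing R]
    (D : Derivation R (MvPolynomial (Fin n) R) (MvPolynomial (Fin n) R)) (r : R) (a b : Fin n) :
    D (C r * (X a * X b)) = C r * (X a * D (X b) + X b * D (X a)) := by
  rw [← smul_eq_C_mul, ← smul_eq_C_mul, Derivation.map_smul, Derivation.leibniz]
  rfl

theorem IsNearToric.weightCoeff_jacobiator_bracketOf
    {P : Fin n → Fin n → MvPolynomial (Fin n) R}
    (hP : IsNearToric T ε lam P) {m : ℕ} {W w : Fin n → ℤ} (hW : W ∈ T.carrier m)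
    (hJ : ∀ a b c, jacobiator P (X a) (X b) (X c) ∈
      filtration T ε m (unitWeight a + unitWeight b + unitWeight c)) (a b c d : Fin n)
    (hw : w = W + (unitWeight a + unitWeight b + unitWeight c + unitWeight d)) :
    weightCoeff w (jacobiator P (bracketOf P (X a) (X b)) (X c) (X d)) =
      algebraMap ℂ R (lam a b) * (jacobiatorCoeff P W a c d + jacobiatorCoeff P W b c d) := by
  obtain ⟨D, hD⟩ := exists_jacobiator_derivation hP.swap (X c) (X d)
  have hDX : ∀ e, D (X e) ∈ filtration T ε m (unitWeight c + unitWeight d + unitWeight e) :=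
    fun e => by rw [← hD]; exact hJ c d e
  have hmem : D (P a b) - D (toricMatrix R lam a b) ∈
      filtration T ε (1 + m) (unitWeight a + unitWeight b + (unitWeight c + unitWeight d)) := by
    rw [← map_sub]
    exact derivation_mem_filtration hDX (hP.sub_mem a b)
  have hcoeff := weightCoeff_eq_zero hmem hW (by omega)
  rw [map_sub, sub_eq_zero, ← add_assoc (unitWeight a + unitWeight b), ← hw] at hcoeff
  rw [jacobiator_cyclic, bracketOf_X_X, hD, hcoeff, toricMatrix, mul_assoc,
    derivation_C_mul_X_mul_X, ← smul_eq_C_mul, map_smul, map_add, smul_eq_mul, weightCoeff_X_mul,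
    weightCoeff_X_mul, ← hD, ← hD, ← jacobiator_cyclic (X a), ← jacobiator_cyclic (X b), hw,
    jacobiatorCoeff, jacobiatorCoeff, add_comm (weightCoeff _ _)]
  congr 4 <;> abel

/-- To leading order the Jacobiator is closed for the toric Poisson differential. -/
theorem IsNearToric.jacobiatorCoeff_cocycle (halt : lam.transpose = -lam)
    {P : Fin n → Fin n → MvPolynomial (Fin n) R}
    (hP : IsNearToric T ε lam P) {m : ℕ} {W : Fin n → ℤ} (hW : W ∈ T.carrier m)
    (hJ : ∀ a b c, jacobiator P (X a) (X b) (X c) ∈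
      filtration T ε m (unitWeight a + unitWeight b + unitWeight c)) (a b c d : Fin n) :
    pairing R lam W a * jacobiatorCoeff P W b c d - pairing R lam W b * jacobiatorCoeff P W a c d +
      pairing R lam W c * jacobiatorCoeff P W a b d -
      pairing R lam W d * jacobiatorCoeff P W a b c = 0 := by
  have hlam := apply_swap_of_transpose_eq_neg halt
  have hswap := jacobiatorCoeff_swap hP.swap W
  have hcyc := jacobiatorCoeff_cyclic P W
  have h := congrArg
    (weightCoeff (W + (unitWeight a + unitWeight b + unitWeight c + unitWeight d)))
    (jacobiator_cocycle hP.swap (X a) (X b) (X c) (X d))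
  simp only [map_add, map_sub] at h
  rw [hP.weightCoeff_bracketOf (hJ b c d) hW a (by abel),
    hP.weightCoeff_bracketOf (hJ a c d) hW b (by abel),
    hP.weightCoeff_bracketOf (hJ a b d) hW c (by abel),
    hP.weightCoeff_bracketOf (hJ a b c) hW d (by abel),
    hP.weightCoeff_jacobiator_bracketOf hW hJ a b c d (by abel),
    hP.weightCoeff_jacobiator_bracketOf hW hJ a c b d (by abel),
    hP.weightCoeff_jacobiator_bracketOf hW hJ a d b c (by abel),
    hP.weightCoeff_jacobiator_bracketOf hW hJ b c a d (by abel),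
    hP.weightCoeff_jacobiator_bracketOf hW hJ b d a c (by abel),
    hP.weightCoeff_jacobiator_bracketOf hW hJ c d a b (by abel)] at h
  simp only [jacobiatorCoeff, pairing_add, pairing_unitWeight] at h hswap hcyc ⊢
  rw [hlam b a, hlam c a, hlam d a, hlam c b, hlam d b, hlam d c, hswap c b d, hcyc d b c,
    hswap c a d, hswap b a d, hcyc d a c, hswap b a c, hcyc d a b, hcyc c a b] at h
  simp only [map_neg] at h
  linear_combination h

end Filtered

/-! ### Existence of a Poisson bracket with given terms of first order -/

section Existence

open MvPolynomial

variable {n : ℕ} {R : Type*} [CommRing R] [Algebra ℂ R] {T : OrderedWeights n} {ε : R}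
  {lam : Matrix (Fin n) (Fin n) ℂ}

/-- The homogeneous polynomial of degree `d` with coefficient `f w` at the weight `w + u`. -/
noncomputable def polyOfCoeff (d : ℕ) (u : Fin n → ℤ) (f : (Fin n → ℤ) → R) :
    MvPolynomial (Fin n) R :=
  ∑ s ∈ Finset.finsuppAntidiag Finset.univ d, monomial s (f (toWeight s - u))

theorem polyOfCoeff_mem_filtration {d p : ℕ} {u : Fin n → ℤ} {f : (Fin n → ℤ) → R}
    (hf : ∀ w, f w ∈ epsSpan T ε p w) : polyOfCoeff d u f ∈ filtration T ε p u :=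
  Submodule.sum_mem _ fun _ _ => monomial_mem_filtration (hf _)

theorem weightCoeff_polyOfCoeff {R : Type*} [CommRing R] {d : ℕ} {u w : Fin n → ℤ}
    {f : (Fin n → ℤ) → R} (h : 0 ≤ w + u) (hd : ∑ i, (w + u) i = d) :
    weightCoeff (w + u) (polyOfCoeff d u f) = f w := by
  classical
  obtain ⟨s, hs⟩ := exists_toWeight_eq h
  obtain rfl : w = toWeight s - u := by rw [hs, add_sub_cancel_right]
  have hdeg : ∑ i, s i = d := by
    simp only [← hs, toWeight] at hd
    exact_mod_cast hd
  have hmem : s ∈ Finset.finsuppAntidiag Finset.univ d :=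
    Finset.mem_finsuppAntidiag.mpr ⟨hdeg, Finset.subset_univ _⟩
  simp only [sub_add_cancel, weightCoeff_toWeight, polyOfCoeff, coeff_sum, coeff_monomial,
    Finset.sum_ite_eq', hmem, if_true]

theorem exists_bivector_of_coeff {m : ℕ} (q : (Fin n → ℤ) → Fin n → Fin n → R)
    (hswap : ∀ W ∈ T.carrier m, ∀ a b, q W a b = -q W b a)
    (hmem : ∀ W ∈ T.carrier m, ∀ a b, q W a b ∈ epsSpan T ε m W)
    (hpos : ∀ W ∈ T.carrier m, ∀ a b, q W a b ≠ 0 → 0 ≤ W + (unitWeight a + unitWeight b)) :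
    ∃ Q : Fin n → Fin n → MvPolynomial (Fin n) R, (∀ a b, Q a b = -Q b a) ∧
      (∀ a b, Q a b ∈ filtration T ε m (unitWeight a + unitWeight b)) ∧
      ∀ W ∈ T.carrier m, ∀ a b, bivectorCoeff Q W a b = q W a b := by
  classical
  let f (a b : Fin n) (W : Fin n → ℤ) : R := if W ∈ T.carrier m then q W a b else 0
  refine ⟨fun a b => polyOfCoeff 2 (unitWeight a + unitWeight b) (f a b), fun a b => ?_,
    fun a b => polyOfCoeff_mem_filtration fun w => ?_, fun W hW a b => ?_⟩
  · have hf : ∀ W, f a b W = -f b a W := fun W => by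
      by_cases hW : W ∈ T.carrier m
      · simp only [f, if_pos hW, hswap W hW a b]
      · simp only [f, if_neg hW, neg_zero]
    simp only [polyOfCoeff, hf, add_comm (unitWeight a), map_neg, Finset.sum_neg_distrib]
  · by_cases hw : w ∈ T.carrier m
    · simpa only [f, if_pos hw] using hmem w hw a b
    · simp only [f, if_neg hw, zero_mem]
  · by_cases h : 0 ≤ W + (unitWeight a + unitWeight b)
    · rw [bivectorCoeff, weightCoeff_polyOfCoeff h]
      · exact if_pos hW
      · simp [Finset.sum_add_distrib, T.sum_eq_zero hW, sum_unitWeight]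
    · rw [bivectorCoeff, weightCoeff_of_not_nonneg h]
      by_contra hne
      exact h (hpos W hW a b (Ne.symm hne))

theorem eq_zero_of_eq_neg {M : Type*} [AddCommGroup M] [Module ℂ M] {r : M} (h : r = -r) :
    r = 0 := by
  have h2 : (2 : ℂ) • r = 0 := by rw [two_smul, ← eq_neg_iff_add_eq_zero, ← h]
  exact (smul_eq_zero.mp h2).resolve_left two_ne_zero

theorem neg_one_le_of_add_sum_unitWeight_nonneg {W : Fin n → ℤ} {s : Finset (Fin n)}
    (h : 0 ≤ W + ∑ a ∈ s, unitWeight a) :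
    (∀ i, -1 ≤ W i) ∧ (Finset.univ.filter fun i => W i = -1).card ≤ s.card := by
  classical
  have hs : ∀ i, 0 ≤ W i + if i ∈ s then 1 else 0 := fun i => by
    simpa [Finset.sum_apply, unitWeight, Pi.single_apply] using h i
  refine ⟨fun i => ?_, Finset.card_le_card fun i hi => ?_⟩
  · have := hs i
    split_ifs at this <;> omega
  · by_contra hmem
    simpa [hmem, (Finset.mem_filter.mp hi).2] using hs i

theorem nonneg_of_add_unitWeight {W v : Fin n → ℤ} (hv : 0 ≤ v) (hW : ∀ i, -1 ≤ W i) {k : Fin n}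
    (hk : W k ≠ -1) (h : 0 ≤ W + (unitWeight k + v)) : 0 ≤ W + v := by
  intro i
  rcases eq_or_ne i k with rfl | hik
  · have hWi := hW i
    have hvi := hv i
    simp only [Pi.zero_apply, Pi.add_apply] at hvi ⊢
    omega
  · simpa [unitWeight, hik] using h i

variable (lam) in
/-- The weights `W` with at most three coordinates `-1` and no smaller ones are those of
multivector fields of degree at most three. For them, `λ W` is asked not to vanish at some
coordinate `k` with `W k ≠ -1`: contraction with `dx_k / x_k` is then a homotopy which kills the
toric Poisson cohomology of weight `W`. -/
def IsAcyclicWeight (W : Fin n → ℤ) : Prop :=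
  (∀ a, -1 ≤ W a) → (Finset.univ.filter fun a => W a = -1).card ≤ 3 →
    ∃ k, W k ≠ -1 ∧ lam.mulVec (fun a => (W a : ℂ)) k ≠ 0

theorem algebraMap_inv_mul_pairing {W : Fin n → ℤ} {k : Fin n}
    (hk : lam.mulVec (fun a => (W a : ℂ)) k ≠ 0) :
    algebraMap ℂ R (lam.mulVec (fun a => (W a : ℂ)) k)⁻¹ * pairing R lam W k = 1 := by
  rw [pairing, ← map_mul, inv_mul_cancel₀ hk, map_one]

theorem exists_bivector_of_cocycle {W : Fin n → ℤ} (hW : IsAcyclicWeight lam W)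
    (E : Submodule ℂ R) {t : Fin n → Fin n → Fin n → R} (hE : ∀ a b c, t a b c ∈ E)
    (hswap : ∀ a b c, t a b c = -t b a c) (hcyc : ∀ a b c, t a b c = t b c a)
    (hpos : ∀ a b c, t a b c ≠ 0 → 0 ≤ W + (unitWeight a + unitWeight b + unitWeight c))
    (hco : ∀ a b c d, pairing R lam W a * t b c d - pairing R lam W b * t a c d +
      pairing R lam W c * t a b d - pairing R lam W d * t a b c = 0) :
    ∃ q : Fin n → Fin n → R, (∀ a b, q a b = -q b a) ∧ (∀ a b, q a b ∈ E) ∧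
      (∀ a b, q a b ≠ 0 → 0 ≤ W + (unitWeight a + unitWeight b)) ∧
      ∀ a b c, pairing R lam W a * q b c + pairing R lam W b * q c a + pairing R lam W c * q a b =
        -t a b c := by
  by_cases h0 : ∀ a b c, t a b c = 0
  · exact ⟨fun _ _ => 0, by simp, by simp, by simp, by simp [h0]⟩
  push Not at h0
  obtain ⟨a₀, b₀, c₀, hne⟩ := h0
  have hdiag : ∀ a b, t a a b = 0 := fun a b => eq_zero_of_eq_neg (hswap a a b)
  have hab : a₀ ≠ b₀ := by rintro rfl; exact hne (hdiag _ _)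
  have hbc : b₀ ≠ c₀ := by rintro rfl; rw [hcyc] at hne; exact hne (hdiag _ _)
  have hac : a₀ ≠ c₀ := by rintro rfl; rw [hcyc, hcyc] at hne; exact hne (hdiag _ _)
  obtain ⟨hge, hcard⟩ := neg_one_le_of_add_sum_unitWeight_nonneg (W := W) (s := {a₀, b₀, c₀})
    (by simpa [hab, hbc, hac, add_assoc] using hpos _ _ _ hne)
  obtain ⟨k, hk, hxk⟩ := hW hge (hcard.trans Finset.card_le_three)
  have hinv := algebraMap_inv_mul_pairing (R := R) hxk
  set y := (lam.mulVec (fun a => (W a : ℂ)) k)⁻¹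
  have hlast : ∀ a b, t k a b = -t k b a := fun a b => by rw [hcyc k a b, hswap, ← hcyc k b a]
  refine ⟨fun a b => -(y • t k a b), fun a b => ?_,
    fun a b => neg_mem (Submodule.smul_mem _ _ (hE _ _ _)), fun a b h => ?_, fun a b c => ?_⟩
  · simp only [hlast a b, smul_neg]
  · refine nonneg_of_add_unitWeight (add_nonneg (unitWeight_nonneg a) (unitWeight_nonneg b)) hge hk
      ?_
    rw [← add_assoc (unitWeight k)]
    exact hpos _ _ _ fun h' => h (by simp only [h', smul_zero, neg_zero])
  · simp only [Algebra.smul_def, hlast c a]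
    linear_combination algebraMap ℂ R y * hco k a b c - t a b c * hinv

theorem exists_jacobi_step (halt : lam.transpose = -lam)
    {P : Fin n → Fin n → MvPolynomial (Fin n) R} (hP : IsNearToric T ε lam P) {m : ℕ} (hm : 1 ≤ m)
    (hacy : ∀ W ∈ T.carrier m, IsAcyclicWeight lam W)
    (hJ : ∀ a b c, jacobiator P (X a) (X b) (X c) ∈
      filtration T ε m (unitWeight a + unitWeight b + unitWeight c)) :
    ∃ Q : Fin n → Fin n → MvPolynomial (Fin n) R, (∀ a b, Q a b = -Q b a) ∧
      (∀ a b, Q a b ∈ filtration T ε m (unitWeight a + unitWeight b)) ∧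
      ∀ a b c, jacobiator (P + Q) (X a) (X b) (X c) ∈
        filtration T ε (m + 1) (unitWeight a + unitWeight b + unitWeight c) := by
  have hprimitive : ∀ W : Fin n → ℤ, ∃ q : Fin n → Fin n → R, W ∈ T.carrier m →
      (∀ a b, q a b = -q b a) ∧ (∀ a b, q a b ∈ epsSpan T ε m W) ∧
      (∀ a b, q a b ≠ 0 → 0 ≤ W + (unitWeight a + unitWeight b)) ∧
      ∀ a b c, pairing R lam W a * q b c + pairing R lam W b * q c a + pairing R lam W c * q a b =
        -jacobiatorCoeff P W a b c := by
    intro W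
    by_cases hW : W ∈ T.carrier m
    · obtain ⟨q, hq⟩ := exists_bivector_of_cocycle (hacy W hW) (epsSpan T ε m W)
        (fun a b c => weightCoeff_mem_epsSpan (hJ a b c)) (jacobiatorCoeff_swap hP.swap W)
        (jacobiatorCoeff_cyclic P W) (fun a b c => nonneg_of_weightCoeff_ne_zero)
        (hP.jacobiatorCoeff_cocycle halt hW hJ)
      exact ⟨q, fun _ => hq⟩
    · exact ⟨fun _ _ => 0, fun h => absurd h hW⟩
  choose q hswap hmem hpos hq using hprimitive
  obtain ⟨Q, hQs, hQ, hQq⟩ := exists_bivector_of_coeff q hswap hmem hpos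
  refine ⟨Q, hQs, hQ, fun a b c => mem_filtration_succ ?_ fun W hW => ?_⟩
  · simpa only [sub_add_cancel] using add_mem (hP.jacobiator_sub_mem hQ a b c) (hJ a b c)
  · change jacobiatorCoeff (P + Q) W a b c = 0
    rw [jacobiatorCoeff_add halt hP hQs hm hQ hW, hQq W hW, hQq W hW, hQq W hW, hq W hW,
      add_neg_cancel]

theorem exists_jacobi (halt : lam.transpose = -lam)
    {P : Fin n → Fin n → MvPolynomial (Fin n) R} (hP : IsNearToric T ε lam P)
    (hacy : ∀ m, 2 ≤ m → ∀ W ∈ T.carrier m, IsAcyclicWeight lam W)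
    (hJ : ∀ a b c, jacobiator P (X a) (X b) (X c) ∈
      filtration T ε 2 (unitWeight a + unitWeight b + unitWeight c)) :
    ∃ P' : Fin n → Fin n → MvPolynomial (Fin n) R, IsNearToric T ε lam P' ∧
      (∀ a b, P' a b - P a b ∈ filtration T ε 2 (unitWeight a + unitWeight b)) ∧
      ∀ a b c, jacobiator P' (X a) (X b) (X c) = 0 := by
  have happrox : ∀ k, ∃ P' : Fin n → Fin n → MvPolynomial (Fin n) R, IsNearToric T ε lam P' ∧
      (∀ a b, P' a b - P a b ∈ filtration T ε 2 (unitWeight a + unitWeight b)) ∧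
      ∀ a b c, jacobiator P' (X a) (X b) (X c) ∈
        filtration T ε (2 + k) (unitWeight a + unitWeight b + unitWeight c) := by
    intro k
    induction k with
    | zero => exact ⟨P, hP, fun a b => by rw [sub_self]; exact zero_mem _, hJ⟩
    | succ k ih =>
      obtain ⟨P', hP', hsub, hJ'⟩ := ih
      obtain ⟨Q, hQs, hQ, hQJ⟩ := exists_jacobi_step halt hP' (by omega) (hacy _ (by omega)) hJ'
      refine ⟨P' + Q, hP'.add hQs fun a b => filtration_mono (by omega) (hQ a b), fun a b => ?_,
        hQJ⟩
      have := add_mem (hsub a b) (filtration_mono (show 2 ≤ 2 + k by omega) (hQ a b))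
      rwa [sub_add_eq_add_sub] at this
  -- The order is bounded on the weights of a given total degree, so the process stops.
  obtain ⟨K, hK⟩ := exists_order_bound T 3
  obtain ⟨P', hP', hsub, hJ'⟩ := happrox K
  refine ⟨P', hP', hsub, fun a b c => eq_zero_of_mem_filtration hK (by omega) ?_ ?_ (hJ' a b c)⟩
  · exact add_nonneg (add_nonneg (unitWeight_nonneg a) (unitWeight_nonneg b)) (unitWeight_nonneg c)
  · simp [Finset.sum_add_distrib, sum_unitWeight]

end Existence

/-! ### Filtered automorphisms -/

section Automorphisms

open MvPolynomial

variable {n : ℕ} {R : Type*} [CommRing R]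

/-- The linear form with coefficients `v`. -/
noncomputable def linearForm (v : Fin n → R) : MvPolynomial (Fin n) R := ∑ d, C (v d) * X d

theorem weightCoeff_linearForm (v : Fin n → R) (d : Fin n) :
    weightCoeff (unitWeight d) (linearForm v) = v d := by
  rw [← toWeight_single, weightCoeff_toWeight, linearForm, coeff_sum, Finset.sum_eq_single d]
  · rw [coeff_C_mul, coeff_X, if_pos rfl, mul_one]
  · intro e _ he
    rw [coeff_C_mul, coeff_X, if_neg, mul_zero]
    exact fun h => he (Finsupp.single_left_injective one_ne_zero h)
  · simp

theorem linearForm_one_add (M : Matrix (Fin n) (Fin n) R) (a : Fin n) :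
    linearForm ((1 + M) a) = X a + linearForm (M a) := by
  simp [linearForm, Matrix.one_apply, add_mul, Finset.sum_add_distrib]

/-- The linear substitution with matrix `g`. -/
noncomputable def linearSubst (g : Matrix (Fin n) (Fin n) R) :
    MvPolynomial (Fin n) R →ₐ[R] MvPolynomial (Fin n) R :=
  aeval fun a => linearForm (g a)

theorem linearSubst_X (g : Matrix (Fin n) (Fin n) R) (a : Fin n) :
    linearSubst g (X a) = linearForm (g a) := aeval_X _ _

theorem linearSubst_linearForm (g : Matrix (Fin n) (Fin n) R) (v : Fin n → R) :
    linearSubst g (linearForm v) = linearForm (Matrix.vecMul v g) := by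
  simp only [linearForm, linearSubst, map_sum, map_mul, algHom_C, algebraMap_eq, aeval_X,
    Finset.mul_sum, Matrix.vecMul, dotProduct, Finset.sum_mul, mul_assoc]
  exact Finset.sum_comm

theorem linearSubst_comp {g h : Matrix (Fin n) (Fin n) R} (hhg : h * g = 1) :
    (linearSubst g).comp (linearSubst h) = AlgHom.id R _ := by
  refine MvPolynomial.algHom_ext fun a => ?_
  have hrow : Matrix.vecMul (h a) g = (1 : Matrix (Fin n) (Fin n) R) a := by
    rw [← hhg]; rfl
  rw [AlgHom.comp_apply, linearSubst_X, linearSubst_linearForm, hrow, AlgHom.id_apply]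
  simp [linearForm, Matrix.one_apply]

/-- The automorphism given by an invertible linear substitution. -/
noncomputable def linearSubstEquiv (g h : Matrix (Fin n) (Fin n) R) (hgh : g * h = 1)
    (hhg : h * g = 1) : MvPolynomial (Fin n) R ≃ₐ[R] MvPolynomial (Fin n) R :=
  AlgEquiv.ofAlgHom (linearSubst g) (linearSubst h) (linearSubst_comp hhg) (linearSubst_comp hgh)

variable [Algebra ℂ R] {T : OrderedWeights n} {ε : R}

theorem linearForm_mem_filtration {v : Fin n → R} {m : ℕ} {u : Fin n → ℤ}
    (hv : ∀ d, v d ∈ epsSpan T ε m (unitWeight d - u)) : linearForm v ∈ filtration T ε m u := by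
  refine Submodule.sum_mem _ fun d _ => ?_
  rw [C_mul_X_eq_monomial]
  exact monomial_mem_filtration (by rw [toWeight_single]; exact hv d)

theorem exists_eq_unitWeight {w : Fin n → ℤ} (h : 0 ≤ w) (hs : ∑ i, w i = 1) :
    ∃ d, w = unitWeight d := by
  obtain ⟨s, rfl⟩ := exists_toWeight_eq h
  have hdeg : s.sum (fun _ k => k) = 1 := by
    simp only [toWeight] at hs
    rw [Finsupp.sum_fintype _ _ fun _ => rfl]
    exact_mod_cast hs
  obtain ⟨d, rfl⟩ := s.sum_eq_one_iff.mp hdeg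
  exact ⟨d, toWeight_single d⟩

variable (T ε) in
/-- The matrices of the linear maps `x_a ↦ ∑_d N_ad x_d` which raise the order by at least `m`. -/
def IsFilteredMatrix (m : ℕ) (N : Matrix (Fin n) (Fin n) R) : Prop :=
  ∀ a d, N a d ∈ epsSpan T ε m (unitWeight d - unitWeight a)

theorem exists_matrix_of_coeff {m : ℕ} (v : (Fin n → ℤ) → Fin n → R)
    (hmem : ∀ W ∈ T.carrier m, ∀ a, v W a ∈ epsSpan T ε m W)
    (hpos : ∀ W ∈ T.carrier m, ∀ a, v W a ≠ 0 → 0 ≤ W + unitWeight a) :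
    ∃ N : Matrix (Fin n) (Fin n) R, IsFilteredMatrix T ε m N ∧
      ∀ W ∈ T.carrier m, ∀ a, weightCoeff (W + unitWeight a) (linearForm (N a)) = v W a := by
  classical
  refine ⟨fun a d => if unitWeight d - unitWeight a ∈ T.carrier m then
    v (unitWeight d - unitWeight a) a else 0, fun a d => ?_, fun W hW a => ?_⟩
  · dsimp only
    split_ifs with h
    · exact hmem _ h a
    · exact zero_mem _
  · by_cases h : 0 ≤ W + unitWeight a
    · obtain ⟨d, hd⟩ := exists_eq_unitWeight h (by
        simp [Finset.sum_add_distrib, T.sum_eq_zero hW, sum_unitWeight])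
      obtain rfl : W = unitWeight d - unitWeight a := by rw [← hd, add_sub_cancel_right]
      rw [hd, weightCoeff_linearForm]
      exact if_pos hW
    · rw [weightCoeff_of_not_nonneg h]
      by_contra hne
      exact h (hpos W hW a (Ne.symm hne))

theorem IsFilteredMatrix.mono {m m' : ℕ} (h : m ≤ m') {N : Matrix (Fin n) (Fin n) R}
    (hN : IsFilteredMatrix T ε m' N) : IsFilteredMatrix T ε m N :=
  fun a d => epsSpan_mono T ε h _ (hN a d)

theorem isFilteredMatrix_one : IsFilteredMatrix T ε 0 (1 : Matrix (Fin n) (Fin n) R) := by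
  intro a d
  rw [Matrix.one_apply]
  split_ifs with h
  · rw [h, sub_self]; exact one_mem_epsSpan T ε
  · exact zero_mem _

theorem IsFilteredMatrix.mul {p q : ℕ} {A B : Matrix (Fin n) (Fin n) R}
    (hA : IsFilteredMatrix T ε p A) (hB : IsFilteredMatrix T ε q B) :
    IsFilteredMatrix T ε (p + q) (A * B) := by
  intro a d
  rw [Matrix.mul_apply]
  refine Submodule.sum_mem _ fun e _ => ?_
  rw [← sub_add_sub_cancel (unitWeight d) (unitWeight e), add_comm (unitWeight d - _)]
  exact mul_mem_epsSpan (hA a e) (hB e d)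

theorem IsFilteredMatrix.pow {N : Matrix (Fin n) (Fin n) R} (hN : IsFilteredMatrix T ε 1 N)
    (k : ℕ) : IsFilteredMatrix T ε k (N ^ k) := by
  induction k with
  | zero => rw [pow_zero]; exact isFilteredMatrix_one
  | succ k ih => rw [pow_succ]; exact ih.mul hN

theorem IsFilteredMatrix.isNilpotent {N : Matrix (Fin n) (Fin n) R}
    (hN : IsFilteredMatrix T ε 1 N) : IsNilpotent N := by
  obtain ⟨K, hK⟩ := exists_order_bound T 1
  refine ⟨K, ?_⟩
  ext a d
  by_contra hne
  obtain ⟨k, hk, hw⟩ := exists_of_mem_epsSpan (hN.pow K a d) hne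
  exact hK k hk _ hw (abs_le_of_sum_le (unitWeight_nonneg d) (unitWeight_nonneg a)
    (sum_unitWeight d).le (sum_unitWeight a).le)

theorem IsFilteredMatrix.exists_inverse {N : Matrix (Fin n) (Fin n) R}
    (hN : IsFilteredMatrix T ε 1 N) :
    ∃ h : Matrix (Fin n) (Fin n) R, (1 + N) * h = 1 ∧ h * (1 + N) = 1 ∧
      IsFilteredMatrix T ε 1 (h - 1) := by
  have hneg : IsFilteredMatrix T ε 1 (-N) := fun a d => by
    rw [Matrix.neg_apply]
    exact neg_mem (hN a d)
  obtain ⟨K, hK⟩ := hneg.isNilpotent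
  have hright := mul_neg_geom_sum (-N) K
  have hleft := geom_sum_mul_neg (-N) K
  rw [hK, sub_zero, sub_neg_eq_add] at hright hleft
  have hmem : IsFilteredMatrix T ε 0 (∑ i ∈ Finset.range K, (-N) ^ i) := fun a d => by
    rw [Matrix.sum_apply]
    exact Submodule.sum_mem _ fun i _ => (hneg.pow i).mono (Nat.zero_le i) a d
  generalize ∑ i ∈ Finset.range K, (-N) ^ i = h at hright hleft hmem
  have hsub : h - 1 = -N * h := by
    rw [sub_eq_iff_eq_add, ← hright, add_mul, one_mul, neg_mul]
    abel
  refine ⟨h, hright, hleft, ?_⟩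
  rw [hsub, ← Nat.add_zero 1]
  exact IsFilteredMatrix.mul hneg hmem

theorem exists_unipotent_equiv {N : Matrix (Fin n) (Fin n) R} (hN : IsFilteredMatrix T ε 1 N) :
    ∃ φ : MvPolynomial (Fin n) R ≃ₐ[R] MvPolynomial (Fin n) R,
      (∀ a, φ (X a) = X a + linearForm (N a)) ∧
      ∀ a, φ.symm (X a) - X a ∈ filtration T ε 1 (unitWeight a) := by
  obtain ⟨h, hright, hleft, hmem⟩ := hN.exists_inverse
  refine ⟨linearSubstEquiv (1 + N) h hright hleft,
    fun a => (linearSubst_X _ a).trans (linearForm_one_add N a), fun a => ?_⟩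
  change linearSubst h (X a) - X a ∈ _
  rw [linearSubst_X, show h = 1 + (h - 1) by abel, linearForm_one_add, add_sub_cancel_left]
  exact linearForm_mem_filtration (hmem a)

theorem algHom_mul_sub_mem {φ : MvPolynomial (Fin n) R →ₐ[R] MvPolynomial (Fin n) R} {m : ℕ}
    {u v : Fin n → ℤ} {f g : MvPolynomial (Fin n) R} (hf : f ∈ filtration T ε 0 u)
    (hg : g ∈ filtration T ε 0 v) (hφf : φ f - f ∈ filtration T ε m u)
    (hφg : φ g - g ∈ filtration T ε m v) : φ (f * g) - f * g ∈ filtration T ε m (u + v) := by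
  have hexpand : φ (f * g) - f * g =
      (φ f - f) * (φ g - g) + (φ f - f) * g + f * (φ g - g) := by
    rw [map_mul]; ring
  rw [hexpand]
  exact add_mem (add_mem (filtration_mono (Nat.le_add_right m m) (mul_mem_filtration hφf hφg))
    (mul_mem_filtration_of_eq hφf hg (add_zero m).symm rfl))
    (mul_mem_filtration_of_eq hf hφg (zero_add m).symm rfl)

theorem algHom_monomial_sub_mem {φ : MvPolynomial (Fin n) R →ₐ[R] MvPolynomial (Fin n) R} {m : ℕ}
    (hφ : ∀ a, φ (X a) - X a ∈ filtration T ε m (unitWeight a)) (s : Fin n →₀ ℕ) :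
    φ (monomial s 1) - monomial s 1 ∈ filtration T ε m (toWeight s) := by
  have hmon : ∀ s : Fin n →₀ ℕ, (monomial s 1 : MvPolynomial (Fin n) R) ∈
      filtration T ε 0 (toWeight s) :=
    fun s => monomial_mem_filtration (by rw [sub_self]; exact one_mem_epsSpan T ε)
  have hzero : φ (monomial 0 1) - monomial 0 1 ∈ filtration T ε m (toWeight (0 : Fin n →₀ ℕ)) := by
    rw [monomial_zero', map_one, map_one, sub_self]
    exact zero_mem _
  have hadd : ∀ s t : Fin n →₀ ℕ,
      φ (monomial s 1) - monomial s 1 ∈ filtration T ε m (toWeight s) →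
      φ (monomial t 1) - monomial t 1 ∈ filtration T ε m (toWeight t) →
      φ (monomial (s + t) 1) - monomial (s + t) 1 ∈ filtration T ε m (toWeight (s + t)) := by
    intro s t hs ht
    have hst : (monomial (s + t) 1 : MvPolynomial (Fin n) R) = monomial s 1 * monomial t 1 := by
      rw [monomial_mul, one_mul]
    rw [toWeight_add, hst]
    exact algHom_mul_sub_mem (hmon s) (hmon t) hs ht
  induction s using Finsupp.induction_linear with
  | zero => exact hzero
  | add s t hs ht => exact hadd s t hs ht
  | single a k =>
    induction k with
    | zero => rw [Finsupp.single_zero]; exact hzero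
    | succ k ih =>
      rw [Finsupp.single_add]
      refine hadd _ _ ih ?_
      rw [toWeight_single]
      exact hφ a

theorem algHom_sub_mem {φ : MvPolynomial (Fin n) R →ₐ[R] MvPolynomial (Fin n) R} {m p r : ℕ}
    (hφ : ∀ a, φ (X a) - X a ∈ filtration T ε m (unitWeight a)) {u : Fin n → ℤ}
    {f : MvPolynomial (Fin n) R} (hf : f ∈ filtration T ε p u) (hr : r = p + m) :
    φ f - f ∈ filtration T ε r u := by
  have hsum : φ f - f = ∑ s ∈ f.support, C (coeff s f) * (φ (monomial s 1) - monomial s 1) := by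
    conv_lhs => rw [f.as_sum]
    rw [map_sum, ← Finset.sum_sub_distrib]
    refine Finset.sum_congr rfl fun s _ => ?_
    rw [mul_sub, C_mul_monomial, mul_one, ← smul_eq_C_mul, ← map_smul, smul_monomial,
      smul_eq_mul, mul_one]
  rw [hsum]
  refine Submodule.sum_mem _ fun s _ => ?_
  refine mul_mem_filtration_of_eq (u := u - toWeight s) ?_ (algHom_monomial_sub_mem hφ s) hr
    (by abel)
  rw [← monomial_zero']
  refine monomial_mem_filtration ?_
  rw [toWeight_zero, zero_sub, neg_sub]
  exact hf s

theorem algHom_mem_filtration {φ : MvPolynomial (Fin n) R →ₐ[R] MvPolynomial (Fin n) R}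
    (hφ : ∀ a, φ (X a) - X a ∈ filtration T ε 0 (unitWeight a)) {p : ℕ} {u : Fin n → ℤ}
    {f : MvPolynomial (Fin n) R} (hf : f ∈ filtration T ε p u) : φ f ∈ filtration T ε p u := by
  simpa only [sub_add_cancel] using add_mem (algHom_sub_mem hφ hf (add_zero p).symm) hf

/-- Transport of a Poisson bracket along an automorphism. -/
def PoissonBracket.conj {R A : Type*} [CommRing R] [CommRing A] [Algebra R A]
    (B : PoissonBracket R A) (φ : A ≃ₐ[R] A) : PoissonBracket R A where
  bracket := LinearMap.mk₂ R (fun f g => φ (B.bracket (φ.symm f) (φ.symm g)))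
    (by intro f f' g; simp) (by intro c f g; simp) (by intro f g g'; simp) (by intro c f g; simp)
  bracket_self f := by simp [B.bracket_self]
  jacobi f g h := by
    simp only [LinearMap.mk₂_apply, AlgEquiv.symm_apply_apply]
    rw [← map_add, ← map_add, B.jacobi, map_zero]
  leibniz f g h := by simp [B.leibniz]

theorem PoissonBracket.conj_bracket {R A : Type*} [CommRing R] [CommRing A] [Algebra R A]
    (B : PoissonBracket R A) (φ : A ≃ₐ[R] A) (f g : A) :
    (B.conj φ).bracket f g = φ (B.bracket (φ.symm f) (φ.symm g)) := rfl

theorem intertwines_conj {R A : Type*} [CommRing R] [CommRing A] [Algebra R A]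
    (B : PoissonBracket R A) (φ : A ≃ₐ[R] A) : Intertwines φ B (B.conj φ) := by
  intro f g
  rw [B.conj_bracket, φ.symm_apply_apply, φ.symm_apply_apply]

end Automorphisms

/-! ### Uniqueness of a Poisson bracket with given terms of first order -/

section Uniqueness

open MvPolynomial

variable {n : ℕ} {R : Type*} [CommRing R] [Algebra ℂ R] {T : OrderedWeights n} {ε : R}
  {lam : Matrix (Fin n) (Fin n) ℂ} {P P' : PoissonBracket R (MvPolynomial (Fin n) R)}
  {φ : MvPolynomial (Fin n) R ≃ₐ[R] MvPolynomial (Fin n) R}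

theorem exists_vector_of_cocycle {W : Fin n → ℤ} (hW : IsAcyclicWeight lam W)
    (E : Submodule ℂ R) {q : Fin n → Fin n → R} (hE : ∀ a b, q a b ∈ E)
    (hswap : ∀ a b, q a b = -q b a)
    (hpos : ∀ a b, q a b ≠ 0 → 0 ≤ W + (unitWeight a + unitWeight b))
    (hco : ∀ a b c, pairing R lam W a * q b c + pairing R lam W b * q c a +
      pairing R lam W c * q a b = 0) :
    ∃ v : Fin n → R, (∀ a, v a ∈ E) ∧ (∀ a, v a ≠ 0 → 0 ≤ W + unitWeight a) ∧
      ∀ a b, pairing R lam W b * v a - pairing R lam W a * v b = q a b := by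
  by_cases h0 : ∀ a b, q a b = 0
  · exact ⟨fun _ => 0, by simp, by simp, by simp [h0]⟩
  push Not at h0
  obtain ⟨a₀, b₀, hne⟩ := h0
  have hab : a₀ ≠ b₀ := by rintro rfl; exact hne (eq_zero_of_eq_neg (hswap _ _))
  obtain ⟨hge, hcard⟩ := neg_one_le_of_add_sum_unitWeight_nonneg (W := W) (s := {a₀, b₀})
    (by simpa [hab] using hpos _ _ hne)
  obtain ⟨k, hk, hxk⟩ := hW hge (hcard.trans (Finset.card_le_two.trans (by norm_num)))
  have hinv := algebraMap_inv_mul_pairing (R := R) hxk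
  set y := (lam.mulVec (fun a => (W a : ℂ)) k)⁻¹
  refine ⟨fun a => -(y • q k a), fun a => neg_mem (Submodule.smul_mem _ _ (hE _ _)),
    fun a h => ?_, fun a b => ?_⟩
  · exact nonneg_of_add_unitWeight (unitWeight_nonneg a) hge hk
      (hpos _ _ fun h' => h (by simp only [h', smul_zero, neg_zero]))
  · have hcyc := hco k a b
    rw [hswap b k] at hcyc
    simp only [Algebra.smul_def]
    linear_combination q a b * hinv - algebraMap ℂ R y * hcyc

theorem bracketOf_sub_mem_filtration {M : Fin n → Fin n → MvPolynomial (Fin n) R}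
    (hM : ∀ a b, M a b ∈ filtration T ε 0 (unitWeight a + unitWeight b)) {m : ℕ}
    {f g : MvPolynomial (Fin n) R} {a b : Fin n} (hf : f - X a ∈ filtration T ε m (unitWeight a))
    (hg : g - X b ∈ filtration T ε m (unitWeight b)) :
    bracketOf M f g - M a b ∈ filtration T ε m (unitWeight a + unitWeight b) := by
  have hexpand : bracketOf M f g - M a b = bracketOf M (X a) (g - X b) +
      bracketOf M (f - X a) (X b) + bracketOf M (f - X a) (g - X b) := by
    rw [← bracketOf_X_X M a b]
    conv_lhs => rw [← add_sub_cancel (X a) f, ← add_sub_cancel (X b) g]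
    simp only [bracketOf_add_left, bracketOf_add_right]
    ring
  rw [hexpand]
  exact add_mem (add_mem (bracketOf_mem_filtration hM (X_mem_filtration a) hg (by ring) rfl)
    (bracketOf_mem_filtration hM hf (X_mem_filtration b) (by ring) rfl))
    (filtration_mono (Nat.le_add_left m m) (bracketOf_mem_filtration hM hf hg (by ring) rfl))

theorem IsNearToric.conj (hP : IsNearToric T ε lam P.matrix)
    (hφ : ∀ a, φ (X a) - X a ∈ filtration T ε 1 (unitWeight a))
    (hφsymm : ∀ a, φ.symm (X a) - X a ∈ filtration T ε 1 (unitWeight a)) :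
    IsNearToric T ε lam (P.conj φ).matrix := by
  refine ⟨fun a b => (P.conj φ).swap _ _, fun a b => ?_⟩
  have hsplit : (P.conj φ).matrix a b - toricMatrix R lam a b =
      φ (bracketOf P.matrix (φ.symm (X a)) (φ.symm (X b)) - P.matrix a b) +
      (φ (P.matrix a b) - P.matrix a b) + (P.matrix a b - toricMatrix R lam a b) := by
    rw [PoissonBracket.matrix, P.conj_bracket, P.eq_bracketOf, map_sub]
    ring
  have hφ0 : ∀ a, φ.toAlgHom (X a) - X a ∈ filtration T ε 0 (unitWeight a) := fun a =>
    filtration_mono zero_le_one (hφ a)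
  rw [hsplit]
  exact add_mem (add_mem
    (algHom_mem_filtration hφ0 (bracketOf_sub_mem_filtration hP.mem (hφsymm a) (hφsymm b)))
    (algHom_sub_mem (φ := φ.toAlgHom) hφ (hP.mem a b) (by ring))) (hP.sub_mem a b)

/-- The variation of the value `C l * x_a * x_b` of a bracket with matrix `M` when each `x_a` is
changed into `x_a + η a`, to first order in `η`. -/
noncomputable def linearVariation (M : Fin n → Fin n → MvPolynomial (Fin n) R) (l : R)
    (η : Fin n → MvPolynomial (Fin n) R) (a b : Fin n) : MvPolynomial (Fin n) R :=
  C l * (X a * η b + X b * η a) - (bracketOf M (X a) (η b) - bracketOf M (X b) (η a))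

theorem conj_matrix_sub_linearVariation_mem (hP : IsNearToric T ε lam P.matrix)
    (hQ : IsNearToric T ε lam (P.conj φ).matrix) {m : ℕ} (hm : 1 ≤ m)
    {η : Fin n → MvPolynomial (Fin n) R} (hη : ∀ a, η a ∈ filtration T ε m (unitWeight a))
    (hφ : ∀ a, φ (X a) = X a + η a) (a b : Fin n) :
    (P.conj φ).matrix a b - P.matrix a b -
        linearVariation (P.conj φ).matrix (algebraMap ℂ R (lam a b)) η a b ∈
      filtration T ε (m + 1) (unitWeight a + unitWeight b) := by
  set M := (P.conj φ).matrix
  have hφm : ∀ a, φ.toAlgHom (X a) - X a ∈ filtration T ε m (unitWeight a) := fun a => by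
    have : φ (X a) - X a = η a := by rw [hφ, add_sub_cancel_left]
    exact this ▸ hη a
  have hbracket : φ (P.matrix a b) = bracketOf M (X a + η a) (X b + η b) := by
    rw [← hφ, ← hφ, ← (P.conj φ).eq_bracketOf]
    exact intertwines_conj P φ (X a) (X b)
  have htoric : φ (toricMatrix R lam a b) =
      C (algebraMap ℂ R (lam a b)) * (X a + η a) * (X b + η b) := by
    rw [toricMatrix, map_mul, map_mul, hφ, hφ]
    congr 2
    exact φ.commutes _
  have hremainder : M a b - P.matrix a b - linearVariation M (algebraMap ℂ R (lam a b)) η a b =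
      (φ (P.matrix a b - toricMatrix R lam a b) - (P.matrix a b - toricMatrix R lam a b)) +
        C (algebraMap ℂ R (lam a b)) * (η a * η b) - bracketOf M (η a) (η b) := by
    rw [map_sub, hbracket, htoric, linearVariation, bracketOf_swap hQ.swap (X b) (η a)]
    simp only [bracketOf_add_left, bracketOf_add_right, bracketOf_X_X, toricMatrix]
    ring
  rw [hremainder]
  exact sub_mem (add_mem (algHom_sub_mem hφm (hP.sub_mem a b) (add_comm _ _))
    (C_mul_mem_filtration _ (filtration_mono (by omega) (mul_mem_filtration (hη a) (hη b)))))
    (filtration_mono (by omega) (bracketOf_mem_filtration hQ.mem (hη a) (hη b) rfl rfl))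

theorem linearVariation_mem_filtration {M : Fin n → Fin n → MvPolynomial (Fin n) R}
    (hM : IsNearToric T ε lam M) {m : ℕ} {η : Fin n → MvPolynomial (Fin n) R}
    (hη : ∀ a, η a ∈ filtration T ε m (unitWeight a)) (l : ℂ) (a b : Fin n) :
    linearVariation M (algebraMap ℂ R l) η a b ∈
      filtration T ε m (unitWeight a + unitWeight b) := by
  refine sub_mem (C_mul_mem_filtration _ (add_mem ?_ ?_)) (sub_mem ?_ ?_)
  · exact mul_mem_filtration_of_eq (X_mem_filtration a) (hη b) (zero_add m).symm rfl
  · exact mul_mem_filtration_of_eq (X_mem_filtration b) (hη a) (zero_add m).symm (add_comm _ _)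
  · exact bracketOf_mem_filtration hM.mem (X_mem_filtration a) (hη b) (by ring) rfl
  · exact bracketOf_mem_filtration hM.mem (X_mem_filtration b) (hη a) (by ring) (add_comm _ _)

theorem weightCoeff_linearVariation (halt : lam.transpose = -lam)
    {M : Fin n → Fin n → MvPolynomial (Fin n) R} (hM : IsNearToric T ε lam M) {m : ℕ}
    {η : Fin n → MvPolynomial (Fin n) R} (hη : ∀ a, η a ∈ filtration T ε m (unitWeight a))
    {W : Fin n → ℤ} (hW : W ∈ T.carrier m) (a b : Fin n) :
    weightCoeff (W + (unitWeight a + unitWeight b))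
        (linearVariation M (algebraMap ℂ R (lam a b)) η a b) =
      pairing R lam W b * weightCoeff (W + unitWeight a) (η a) -
        pairing R lam W a * weightCoeff (W + unitWeight b) (η b) := by
  rw [linearVariation, map_sub, map_sub, ← smul_eq_C_mul, map_smul, map_add, weightCoeff_X_mul,
    weightCoeff_X_mul, hM.weightCoeff_bracketOf (hη a) hW b (by abel),
    hM.weightCoeff_bracketOf (hη b) hW a (by abel),
    show W + (unitWeight a + unitWeight b) - unitWeight a = W + unitWeight b by abel,
    show W + (unitWeight a + unitWeight b) - unitWeight b = W + unitWeight a by abel,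
    pairing_unitWeight, pairing_unitWeight, smul_eq_mul,
    apply_swap_of_transpose_eq_neg halt b a, map_neg]
  ring

theorem IsNearToric.bivectorCoeff_sub_cocycle (halt : lam.transpose = -lam)
    (hP : IsNearToric T ε lam P.matrix) {m : ℕ} (hm : 1 ≤ m)
    (hD : ∀ a b, P'.matrix a b - P.matrix a b ∈ filtration T ε m (unitWeight a + unitWeight b))
    {W : Fin n → ℤ} (hW : W ∈ T.carrier m) (a b c : Fin n) :
    pairing R lam W a * bivectorCoeff (P'.matrix - P.matrix) W b c +
      pairing R lam W b * bivectorCoeff (P'.matrix - P.matrix) W c a +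
      pairing R lam W c * bivectorCoeff (P'.matrix - P.matrix) W a b = 0 := by
  have hadd := jacobiatorCoeff_add halt hP (P'.matrix_sub_swap P) hm hD hW a b c
  rwa [add_sub_cancel, jacobiatorCoeff, jacobiatorCoeff, P.jacobiator_eq_zero,
    P'.jacobiator_eq_zero, map_zero, zero_add, eq_comm] at hadd

theorem exists_conj_step (halt : lam.transpose = -lam) (hP : IsNearToric T ε lam P.matrix)
    {m : ℕ} (hm : 1 ≤ m) (hacy : ∀ W ∈ T.carrier m, IsAcyclicWeight lam W)
    (hD : ∀ a b, P'.matrix a b - P.matrix a b ∈ filtration T ε m (unitWeight a + unitWeight b)) :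
    ∃ φ : MvPolynomial (Fin n) R ≃ₐ[R] MvPolynomial (Fin n) R,
      (∀ a, φ (X a) - X a ∈ filtration T ε 1 (unitWeight a)) ∧
      IsNearToric T ε lam (P.conj φ).matrix ∧
      ∀ a b, P'.matrix a b - (P.conj φ).matrix a b ∈
        filtration T ε (m + 1) (unitWeight a + unitWeight b) := by
  have hprimitive : ∀ W : Fin n → ℤ, ∃ v : Fin n → R, W ∈ T.carrier m →
      (∀ a, v a ∈ epsSpan T ε m W) ∧ (∀ a, v a ≠ 0 → 0 ≤ W + unitWeight a) ∧
      ∀ a b, pairing R lam W b * v a - pairing R lam W a * v b =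
        bivectorCoeff (P'.matrix - P.matrix) W a b := by
    intro W
    by_cases hW : W ∈ T.carrier m
    · obtain ⟨v, hv⟩ := exists_vector_of_cocycle (hacy W hW) (epsSpan T ε m W)
        (fun a b => weightCoeff_mem_epsSpan (hD a b)) (bivectorCoeff_swap (P'.matrix_sub_swap P) W)
        (fun a b => nonneg_of_weightCoeff_ne_zero) (hP.bivectorCoeff_sub_cocycle halt hm hD hW)
      exact ⟨v, fun _ => hv⟩
    · exact ⟨fun _ => 0, fun h => absurd h hW⟩
  choose v hmem hpos hv using hprimitive
  obtain ⟨N, hN, hNv⟩ := exists_matrix_of_coeff v hmem hpos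
  obtain ⟨φ, hφ, hφsymm⟩ := exists_unipotent_equiv (hN.mono hm)
  have hη : ∀ a, linearForm (N a) ∈ filtration T ε m (unitWeight a) :=
    fun a => linearForm_mem_filtration (hN a)
  have hφ1 : ∀ a, φ (X a) - X a ∈ filtration T ε 1 (unitWeight a) := fun a => by
    rw [hφ, add_sub_cancel_left]
    exact filtration_mono hm (hη a)
  have hQ := hP.conj hφ1 hφsymm
  refine ⟨φ, hφ1, hQ, fun a b => ?_⟩
  set ℓ := linearVariation (P.conj φ).matrix (algebraMap ℂ R (lam a b))
    (fun a => linearForm (N a)) a b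
  have hlead : P'.matrix a b - P.matrix a b - ℓ ∈
      filtration T ε (m + 1) (unitWeight a + unitWeight b) := by
    refine mem_filtration_succ
      (sub_mem (hD a b) (linearVariation_mem_filtration hQ hη _ a b)) fun W hW => ?_
    rw [map_sub, weightCoeff_linearVariation halt hQ hη hW, hNv W hW, hNv W hW, hv W hW]
    exact sub_self _
  have hremainder := conj_matrix_sub_linearVariation_mem hP hQ hm hη hφ a b
  have := sub_mem hlead hremainder
  rwa [sub_sub_sub_cancel_right, sub_sub_sub_cancel_right] at this

theorem algEquiv_trans_sub_mem {φ' : MvPolynomial (Fin n) R ≃ₐ[R] MvPolynomial (Fin n) R} {m : ℕ}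
    (hφ : ∀ a, φ (X a) - X a ∈ filtration T ε m (unitWeight a))
    (hφ' : ∀ a, φ' (X a) - X a ∈ filtration T ε m (unitWeight a)) (a : Fin n) :
    (φ.trans φ') (X a) - X a ∈ filtration T ε m (unitWeight a) := by
  have hsplit : (φ.trans φ') (X a) - X a = φ' (φ (X a) - X a) + (φ' (X a) - X a) := by
    rw [AlgEquiv.trans_apply, map_sub]; ring
  rw [hsplit]
  exact add_mem (algHom_mem_filtration (φ := φ'.toAlgHom)
    (fun a => filtration_mono (Nat.zero_le m) (hφ' a)) (hφ a)) (hφ' a)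

theorem exists_filtered_intertwiner (halt : lam.transpose = -lam)
    (hacy : ∀ m, 2 ≤ m → ∀ W ∈ T.carrier m, IsAcyclicWeight lam W)
    (hP : IsNearToric T ε lam P.matrix)
    (hD : ∀ a b, P'.matrix a b - P.matrix a b ∈ filtration T ε 2 (unitWeight a + unitWeight b)) :
    ∃ φ : MvPolynomial (Fin n) R ≃ₐ[R] MvPolynomial (Fin n) R,
      (∀ a, φ (X a) - X a ∈ filtration T ε 1 (unitWeight a)) ∧ Intertwines φ P P' := by
  obtain ⟨K, hK⟩ := exists_order_bound T 2
  suffices hdescent : ∀ k m, 2 ≤ m → K ≤ m + k →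
      ∀ P : PoissonBracket R (MvPolynomial (Fin n) R), IsNearToric T ε lam P.matrix →
      (∀ a b, P'.matrix a b - P.matrix a b ∈ filtration T ε m (unitWeight a + unitWeight b)) →
      ∃ φ : MvPolynomial (Fin n) R ≃ₐ[R] MvPolynomial (Fin n) R,
        (∀ a, φ (X a) - X a ∈ filtration T ε 1 (unitWeight a)) ∧ Intertwines φ P P' from
    hdescent K 2 le_rfl (by omega) P hP hD
  intro k
  induction k with
  | zero =>
    intro m _ hKm P _ hD
    have heq : P.matrix = P'.matrix := by
      ext1 a; ext1 b
      refine (sub_eq_zero.mp (eq_zero_of_mem_filtration hK hKm ?_ ?_ (hD a b))).symm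
      · exact add_nonneg (unitWeight_nonneg a) (unitWeight_nonneg b)
      · simp [Finset.sum_add_distrib, sum_unitWeight]
    refine ⟨AlgEquiv.refl, fun a => ?_, PoissonBracket.eq_of_matrix_eq heq⟩
    rw [AlgEquiv.coe_refl, id, sub_self]; exact zero_mem _
  | succ k ih =>
    intro m hm hKm P hP hD
    obtain ⟨φ, hφ, hconj, hD'⟩ := exists_conj_step halt hP (by omega) (hacy m hm) hD
    obtain ⟨φ', hφ', hint⟩ := ih (m + 1) (by omega) (by omega) (P.conj φ) hconj hD'
    refine ⟨φ.trans φ', algEquiv_trans_sub_mem hφ hφ', fun f g => ?_⟩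
    rw [AlgEquiv.trans_apply, AlgEquiv.trans_apply, AlgEquiv.trans_apply, ← hint,
      intertwines_conj P φ f g]

end Uniqueness

/-! ### Deformed brackets -/

section Forms

open MvPolynomial

variable {n : ℕ} {R : Type*} [CommRing R]

/-- The quadratic form with coefficients `v k l`, `k ≤ l`. -/
noncomputable def quadraticForm (v : Fin n → Fin n → R) : MvPolynomial (Fin n) R :=
  ∑ k, ∑ l, if k ≤ l then C (v k l) * X k * X l else 0

theorem coeff_single_linearForm (v : Fin n → R) (d : Fin n) :
    coeff (Finsupp.single d 1) (linearForm v) = v d := by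
  rw [← weightCoeff_toWeight, toWeight_single, weightCoeff_linearForm]

theorem single_add_single_eq_iff {k l k' l' : Fin n} (h : k ≤ l) (h' : k' ≤ l') :
    (Finsupp.single k' 1 + Finsupp.single l' 1 : Fin n →₀ ℕ) =
      Finsupp.single k 1 + Finsupp.single l 1 ↔ k' = k ∧ l' = l := by
  refine ⟨fun heq => ?_, fun ⟨hk, hl⟩ => by rw [hk, hl]⟩
  rcases (Finsupp.single_add_single_eq_single_add_single one_ne_zero one_ne_zero).mp heq with
    heq | ⟨_, rfl, rfl⟩ | ⟨htwo, _⟩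
  · exact heq
  · exact ⟨le_antisymm h' h, le_antisymm h h'⟩
  · exact absurd htwo (by norm_num)

theorem coeff_single_add_single_quadraticForm (v : Fin n → Fin n → R) {k l : Fin n} (h : k ≤ l) :
    coeff (Finsupp.single k 1 + Finsupp.single l 1) (quadraticForm v) = v k l := by
  classical
  have hterm : ∀ k' l', coeff (Finsupp.single k 1 + Finsupp.single l 1)
      (if k' ≤ l' then C (v k' l') * X k' * X l' else 0) =
      if k' = k then if l' = l then v k l else 0 else 0 := by
    intro k' l'
    rw [C_mul_X_eq_monomial, X, monomial_mul, mul_one, apply_ite (coeff _), coeff_monomial,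
      coeff_zero]
    by_cases hkl : k' ≤ l'
    · rw [if_pos hkl, if_congr (single_add_single_eq_iff h hkl) rfl rfl, ite_and]
      split_ifs with hk hl <;> simp only [*]
    · rw [if_neg hkl]
      split_ifs with hk hl
      · exact absurd (hk ▸ hl ▸ h) hkl
      · rfl
      · rfl
  simp [quadraticForm, coeff_sum, hterm]

theorem C_mul_quadraticForm (r : R) (v : Fin n → Fin n → R) :
    C r * quadraticForm v = quadraticForm fun k l => r * v k l := by
  simp only [quadraticForm, Finset.mul_sum, mul_ite, mul_zero, map_mul, mul_assoc]

theorem quadraticForm_sub (v v' : Fin n → Fin n → R) :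
    quadraticForm v - quadraticForm v' = quadraticForm fun k l => v k l - v' k l := by
  simp only [quadraticForm, ← Finset.sum_sub_distrib]
  refine Finset.sum_congr rfl fun k _ => Finset.sum_congr rfl fun l _ => ?_
  split_ifs
  · rw [map_sub]; ring
  · exact sub_zero 0

theorem map_quadraticForm {S : Type*} [CommRing S] (φ : R →+* S) (v : Fin n → Fin n → R) :
    map φ (quadraticForm v) = quadraticForm fun k l => φ (v k l) := by
  simp only [quadraticForm, map_sum, apply_ite (map φ), map_mul, map_C, map_X, map_zero]

theorem isHomogeneous_linearForm (v : Fin n → R) : (linearForm v).IsHomogeneous 1 :=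
  IsHomogeneous.sum _ _ _ fun d _ => isHomogeneous_C_mul_X (v d) d

theorem isHomogeneous_quadraticForm (v : Fin n → Fin n → R) :
    (quadraticForm v).IsHomogeneous 2 := by
  refine IsHomogeneous.sum _ _ _ fun k _ => IsHomogeneous.sum _ _ _ fun l _ => ?_
  split_ifs
  · exact (isHomogeneous_C_mul_X (v k l) k).mul (isHomogeneous_X R l)
  · exact isHomogeneous_zero _ _ _

theorem exists_single_add_single_of_degree_eq_two {s : Fin n →₀ ℕ} (hs : s.degree = 2) :
    ∃ k l, k ≤ l ∧ s = Finsupp.single k 1 + Finsupp.single l 1 := by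
  obtain ⟨k, hk⟩ : ∃ k, s k ≠ 0 := by
    by_contra! h0
    obtain rfl : s = 0 := Finsupp.ext h0
    exact two_ne_zero (hs.symm.trans (map_zero _))
  have hsplit : Finsupp.single k 1 + (s - Finsupp.single k 1) = s :=
    add_tsub_cancel_of_le (Finsupp.single_le_iff.mpr (Nat.one_le_iff_ne_zero.mpr hk))
  have hdeg : (s - Finsupp.single k 1).degree = 1 := by
    rw [← hsplit, map_add, Finsupp.degree_single] at hs
    omega
  obtain ⟨l, hl⟩ := (Finsupp.sum_eq_one_iff _).mp hdeg
  rw [hl] at hsplit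
  rcases le_total k l with h | h
  · exact ⟨k, l, h, hsplit.symm⟩
  · exact ⟨l, k, h, by rw [← hsplit, add_comm]⟩

theorem eq_linearForm_of_isHomogeneous {f : MvPolynomial (Fin n) R} (hf : f.IsHomogeneous 1) :
    f = linearForm fun d => coeff (Finsupp.single d 1) f := by
  ext s
  by_cases hs : s.degree = 1
  · obtain ⟨d, rfl⟩ := (Finsupp.sum_eq_one_iff _).mp hs
    rw [coeff_single_linearForm]
  · rw [hf.coeff_eq_zero hs, (isHomogeneous_linearForm _).coeff_eq_zero hs]

theorem eq_quadraticForm_of_isHomogeneous {f : MvPolynomial (Fin n) R} (hf : f.IsHomogeneous 2) :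
    f = quadraticForm fun k l => coeff (Finsupp.single k 1 + Finsupp.single l 1) f := by
  ext s
  by_cases hs : s.degree = 2
  · obtain ⟨k, l, hkl, rfl⟩ := exists_single_add_single_of_degree_eq_two hs
    rw [coeff_single_add_single_quadraticForm _ hkl]
  · rw [hf.coeff_eq_zero hs, (isHomogeneous_quadraticForm _).coeff_eq_zero hs]

end Forms

section Deformed

open MvPolynomial

variable {n : ℕ} {R : Type*} [CommRing R] [Algebra ℂ R] {T : OrderedWeights n} {ε : R}

theorem isHomogeneous_of_mem_filtration {p d : ℕ} {u : Fin n → ℤ} (hu : ∑ i, u i = d)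
    {f : MvPolynomial (Fin n) R} (hf : f ∈ filtration T ε p u) : f.IsHomogeneous d := by
  intro s hs
  have h := (sum_toWeight_eq hf hs).trans hu
  refine (DFunLike.congr_fun Finsupp.degree_eq_weight_one s).symm.trans ?_
  rw [Finsupp.degree_eq_sum]
  simp only [toWeight] at h
  exact_mod_cast h

theorem toWeight_single_add_single_sub (a b k l : Fin n) :
    toWeight (Finsupp.single k 1 + Finsupp.single l 1) - (unitWeight a + unitWeight b) =
      quadWeight a b k l := by
  rw [toWeight_add, toWeight_single, toWeight_single, quadWeight]; abel

theorem quadraticForm_mem_filtration {v : Fin n → Fin n → R} {p : ℕ} {a b : Fin n}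
    (hv : ∀ k l, k ≤ l → v k l ∈ epsSpan T ε p (quadWeight a b k l)) :
    quadraticForm v ∈ filtration T ε p (unitWeight a + unitWeight b) := by
  refine Submodule.sum_mem _ fun k _ => Submodule.sum_mem _ fun l _ => ?_
  split_ifs with hkl
  · rw [C_mul_X_eq_monomial, X, monomial_mul, mul_one]
    exact monomial_mem_filtration (by rw [toWeight_single_add_single_sub]; exact hv k l hkl)
  · exact zero_mem _

open Classical in
variable (T ε) in
/-- The term `z ε^m`, where `m` is the order of the weight `w`. It is zero if `w` has no order
between `1` and `N`. -/
noncomputable def epsTerm (N : ℕ) (z : ℂ) (w : Fin n → ℤ) : R :=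
  ∑ m ∈ Finset.Icc 1 N, ε ^ m * if w ∈ T.carrier m then algebraMap ℂ R z else 0

theorem epsTerm_eq_smul {m N : ℕ} (h1 : 1 ≤ m) (hN : m ≤ N) (z : ℂ) {w : Fin n → ℤ}
    (hw : w ∈ T.carrier m) : epsTerm T ε N z w = z • ε ^ m := by
  rw [epsTerm, Finset.sum_eq_single_of_mem m (Finset.mem_Icc.mpr ⟨h1, hN⟩), if_pos hw, mul_comm,
    Algebra.smul_def]
  intro m' _ hne
  rw [if_neg fun hw' => hne (T.disjoint hw' hw), mul_zero]

theorem epsTerm_mem_epsSpan (N : ℕ) (z : ℂ) (w : Fin n → ℤ) :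
    epsTerm T ε N z w ∈ epsSpan T ε 1 w := by
  refine Submodule.sum_mem _ fun m hm => ?_
  split_ifs with hw
  · rw [mul_comm, ← Algebra.smul_def]
    exact Submodule.smul_mem _ _ (pow_mem_epsSpan T ε (Finset.mem_Icc.mp hm).1 hw)
  · rw [mul_zero]; exact zero_mem _

theorem exists_eq_epsTerm {r : R} {w : Fin n → ℤ} (hr : r ∈ epsSpan T ε 1 w) :
    ∃ z m, ∀ N, m ≤ N → r = epsTerm T ε N z w := by
  by_cases h0 : r = 0
  · exact ⟨0, 0, fun N _ => by simp [h0, epsTerm]⟩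
  · obtain ⟨m, h1, hw⟩ := exists_of_mem_epsSpan hr h0
    obtain ⟨z, hz⟩ := exists_smul_of_mem_epsSpan hr hw
    exact ⟨z, m, fun N hN => by rw [hz, epsTerm_eq_smul h1 hN z hw]⟩

theorem exists_forall_eq_epsTerm {ι : Type*} [Finite ι] {r : ι → R} {w : ι → Fin n → ℤ}
    (hr : ∀ i, r i ∈ epsSpan T ε 1 (w i)) :
    ∃ (N : ℕ) (z : ι → ℂ), 1 ≤ N ∧ ∀ i, r i = epsTerm T ε N (z i) (w i) := by
  cases nonempty_fintype ι
  choose z m hzm using fun i => exists_eq_epsTerm (hr i)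
  refine ⟨max 1 (Finset.univ.sup m), z, le_max_left _ _, fun i => hzm i _ ?_⟩
  exact (Finset.le_sup (Finset.mem_univ i)).trans (le_max_right _ _)

open Classical in
theorem linearForm_epsTerm (N : ℕ) (v : Fin n → ℂ) (w : Fin n → Fin n → ℤ) :
    linearForm (fun d => epsTerm T ε N (v d) (w d)) = ∑ m ∈ Finset.Icc 1 N, C (ε ^ m) *
      ∑ d, if w d ∈ T.carrier m then C (algebraMap ℂ R (v d)) * X d else 0 := by
  simp only [linearForm, epsTerm, map_sum, Finset.sum_mul, Finset.mul_sum]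
  rw [Finset.sum_comm]
  refine Finset.sum_congr rfl fun m _ => Finset.sum_congr rfl fun d _ => ?_
  split_ifs
  · rw [map_mul, mul_assoc]
  · simp only [mul_zero, map_zero, zero_mul]

open Classical in
theorem quadraticForm_epsTerm (N : ℕ) (v : Fin n → Fin n → ℂ) (w : Fin n → Fin n → Fin n → ℤ) :
    quadraticForm (fun k l => epsTerm T ε N (v k l) (w k l)) = ∑ m ∈ Finset.Icc 1 N, C (ε ^ m) *
      ∑ k, ∑ l, if k ≤ l ∧ w k l ∈ T.carrier m then
        C (algebraMap ℂ R (v k l)) * X k * X l else 0 := by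
  simp only [Finset.mul_sum]
  rw [Finset.sum_comm, quadraticForm]
  refine Finset.sum_congr rfl fun k _ => ?_
  rw [Finset.sum_comm]
  refine Finset.sum_congr rfl fun l _ => ?_
  by_cases hkl : k ≤ l
  · simp only [hkl, true_and, epsTerm, map_sum, Finset.sum_mul]
    refine Finset.sum_congr rfl fun m _ => ?_
    split_ifs
    · rw [map_mul]; ring
    · simp only [mul_zero, map_zero, zero_mul]
  · simp only [hkl, false_and, if_false, mul_zero, Finset.sum_const_zero]

theorem exists_linearForm_epsTerm {f : Fin n → MvPolynomial (Fin n) R}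
    (hf : ∀ a, f a ∈ filtration T ε 1 (unitWeight a)) :
    ∃ (N : ℕ) (α : Matrix (Fin n) (Fin n) ℂ), ∀ a,
      f a = linearForm fun d => epsTerm T ε N (α a d) (unitWeight d - unitWeight a) := by
  obtain ⟨N, z, _, hz⟩ := exists_forall_eq_epsTerm (ι := Fin n × Fin n)
    (r := fun i => coeff (Finsupp.single i.2 1) (f i.1))
    (w := fun i => unitWeight i.2 - unitWeight i.1) fun i => by
      have h := hf i.1 (Finsupp.single i.2 1)
      rwa [toWeight_single] at h
  refine ⟨N, fun a d => z (a, d), fun a => ?_⟩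
  rw [eq_linearForm_of_isHomogeneous (isHomogeneous_of_mem_filtration (sum_unitWeight a) (hf a))]
  exact congrArg linearForm (funext fun d => hz (a, d))

theorem exists_quadraticForm_epsTerm {f : Fin n → Fin n → MvPolynomial (Fin n) R}
    (hf : ∀ a b, f a b ∈ filtration T ε 1 (unitWeight a + unitWeight b)) :
    ∃ (N : ℕ) (c : Fin n → Fin n → Fin n → Fin n → ℂ), 1 ≤ N ∧ ∀ a b,
      f a b = quadraticForm fun k l => epsTerm T ε N (c b a k l) (quadWeight a b k l) := by
  obtain ⟨N, z, hN, hz⟩ := exists_forall_eq_epsTerm (ι := Fin n × Fin n × Fin n × Fin n)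
    (r := fun i => coeff (Finsupp.single i.2.2.1 1 + Finsupp.single i.2.2.2 1) (f i.1 i.2.1))
    (w := fun i => quadWeight i.1 i.2.1 i.2.2.1 i.2.2.2) fun i => by
      have h := hf i.1 i.2.1 (Finsupp.single i.2.2.1 1 + Finsupp.single i.2.2.2 1)
      rwa [toWeight_single_add_single_sub] at h
  refine ⟨N, fun b a k l => z (a, b, k, l), hN, fun a b => ?_⟩
  have hdeg : ∑ i, (unitWeight a + unitWeight b) i = (2 : ℕ) := by
    simp [Finset.sum_add_distrib, sum_unitWeight]
  rw [eq_quadraticForm_of_isHomogeneous (isHomogeneous_of_mem_filtration hdeg (hf a b))]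
  exact congrArg quadraticForm (funext₂ fun k l => hz (a, b, k, l))

end Deformed

section Theta

variable {n : ℕ} {lam β : Matrix (Fin n) (Fin n) ℂ} {G : SimpleGraph (Fin n)}

/-- The weights `Θ_m` of a forest of smoothable edges. -/
def thetaWeights (hβ : IsBiresidueMatrix lam β) (hG : G.IsAcyclic) : OrderedWeights n where
  carrier := Theta β G
  zero_mem := by rw [Theta_zero]; rfl
  add_mem := add_mem_Theta
  sum_eq_zero := sum_eq_zero_of_mem_Theta hβ
  disjoint := eq_of_mem_Theta hβ hG

theorem isAcyclicWeight_of_mem_Theta (hβ : IsBiresidueMatrix lam β) (hG : G.IsAcyclic) {m : ℕ}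
    (hm : 2 ≤ m) {W : Fin n → ℤ} (hW : W ∈ Theta β G m) : IsAcyclicWeight lam W :=
  exists_mulVec_ne_zero_of_mem_Theta hβ hG hm hW

theorem IsSmoothableWeight.eq_or_eq {i j k : Fin n} {w : Fin n → ℤ}
    (h : IsSmoothableWeight β i j w) (hk : w k = -1) : k = i ∨ k = j := by
  by_contra! hne
  have := h.nonneg hne.1 hne.2
  omega

theorem IsSmoothableWeight.edge_unique {i j i' j' : Fin n} {w : Fin n → ℤ}
    (h : IsSmoothableWeight β i j w) (h' : IsSmoothableWeight β i' j' w) :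
    s(i, j) = s(i', j') := by
  rcases h'.eq_or_eq h.apply_left with rfl | rfl <;> rcases h'.eq_or_eq h.apply_right with rfl | rfl
  · exact absurd rfl h.ne
  · rfl
  · exact Sym2.eq_swap
  · exact absurd rfl h.ne

theorem quadWeight_comm (a b k l : Fin n) : quadWeight a b k l = quadWeight b a k l := by
  rw [quadWeight, quadWeight, neg_sub_comm]

variable (β G) in
theorem exists_hasLeadingCoeffs (γ : Sym2 (Fin n) → ℂ) :
    ∃ c, HasLeadingCoeffs β G γ c ∧ ∀ a b k l, c a b k l = -c b a k l := by
  have hval : ∀ w, ∃ z : ℂ, ∀ i j, IsSmoothableWeight β i j w → z = γ s(i, j) := by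
    intro w
    by_cases h : ∃ i j, IsSmoothableWeight β i j w
    · obtain ⟨i, j, hij⟩ := h
      exact ⟨γ s(i, j), fun i' j' h' => congrArg γ (hij.edge_unique h')⟩
    · exact ⟨0, fun i j hij => absurd ⟨i, j, hij⟩ h⟩
  choose z hz using hval
  refine ⟨fun b a k l => (Int.sign (b - a) : ℂ) * z (quadWeight a b k l), ?_, fun a b k l => ?_⟩
  · rintro i j _ _ hw a b k l hab _ rfl
    have hsign : Int.sign ((b : ℤ) - a) = 1 := Int.sign_eq_one_of_pos (by omega)
    simp only [hsign, Int.cast_one, one_mul, hz _ i j hw]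
  · beta_reduce
    rw [← neg_sub (b : ℤ) a, Int.sign_neg, Int.cast_neg, neg_mul, quadWeight_comm]

end Theta

section FirstOrder

open MvPolynomial

variable {n : ℕ} {R : Type*} [CommRing R] [Algebra ℂ R] {lam β : Matrix (Fin n) (Fin n) ℂ}
  {G : SimpleGraph (Fin n)} {T : OrderedWeights n} {ε : R}

theorem IsSmoothableWeight.pairing_eq_zero (hβ : IsBiresidueMatrix lam β) {i j : Fin n}
    {w : Fin n → ℤ} (h : IsSmoothableWeight β i j w) {a b c : Fin n}
    (hpos : 0 ≤ w + (unitWeight b + unitWeight c)) (hab : a ≠ b) (hac : a ≠ c) :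
    pairing R lam w a = 0 := by
  have hne : ∀ k, w k = -1 → a ≠ k := by
    rintro k hk rfl
    have := hpos a
    simp [unitWeight, hab, hac, hk] at this
  rw [pairing, h.mulVec_eq hβ, edgeVector_eq_zero (hne i h.apply_left) (hne j h.apply_right),
    map_zero]

theorem pairing_cyclic_sum_eq_zero (hβ : IsBiresidueMatrix lam β) {i j : Fin n} {w : Fin n → ℤ}
    (h : IsSmoothableWeight β i j w) {q : Fin n → Fin n → R} (hq : ∀ a b, q a b = -q b a)
    (hpos : ∀ a b, q a b ≠ 0 → 0 ≤ w + (unitWeight a + unitWeight b)) (a b c : Fin n) :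
    pairing R lam w a * q b c + pairing R lam w b * q c a + pairing R lam w c * q a b = 0 := by
  have hdiag : ∀ a, q a a = 0 := fun a => eq_zero_of_eq_neg (hq a a)
  have hdistinct : ∀ a b c, a ≠ b → a ≠ c → pairing R lam w a * q b c = 0 := by
    intro a b c hab hac
    by_cases h0 : q b c = 0
    · rw [h0, mul_zero]
    · rw [h.pairing_eq_zero hβ (hpos b c h0) hab hac, zero_mul]
  rcases eq_or_ne a b with rfl | hab
  · rw [hdiag, hq c a]; ring
  rcases eq_or_ne b c with rfl | hbc
  · rw [hdiag, hq b a]; ring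
  rcases eq_or_ne a c with rfl | hac
  · rw [hdiag, hq b a]; ring
  rw [hdistinct a b c hab hac, hdistinct b c a hbc hab.symm, hdistinct c a b hac.symm hbc.symm,
    add_zero, add_zero]

/-- The coefficients at a smoothable weight are cocycles for the differential of the toric
bracket, so the Jacobi identity has no obstruction of order one. -/
theorem IsNearToric.jacobiator_mem (halt : lam.transpose = -lam) (hβ : IsBiresidueMatrix lam β)
    (hT : ∀ w ∈ T.carrier 1, ∃ i j, IsSmoothableWeight β i j w)
    {P : Fin n → Fin n → MvPolynomial (Fin n) R} (hP : IsNearToric T ε lam P) (a b c : Fin n) :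
    jacobiator P (X a) (X b) (X c) ∈
      filtration T ε 2 (unitWeight a + unitWeight b + unitWeight c) := by
  have htoric : IsNearToric T ε lam (toricMatrix R lam) := isNearToric_toric halt
  obtain ⟨Q, rfl⟩ : ∃ Q, P = toricMatrix R lam + Q := ⟨P - toricMatrix R lam, by abel⟩
  have hQs : ∀ a b, Q a b = -Q b a := fun a b => by
    have h := hP.swap a b
    rw [Pi.add_apply, Pi.add_apply, Pi.add_apply, Pi.add_apply, toricMatrix_swap halt a b] at h
    linear_combination h
  have hQ : ∀ a b, Q a b ∈ filtration T ε 1 (unitWeight a + unitWeight b) := fun a b => by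
    simpa only [Pi.add_apply, add_sub_cancel_left] using hP.sub_mem a b
  refine mem_filtration_succ (p := 1) ?_ fun W hW => ?_
  · have h := htoric.jacobiator_sub_mem hQ a b c
    rwa [jacobiator_toric halt, sub_zero] at h
  · have h := jacobiatorCoeff_add halt htoric hQs le_rfl hQ hW a b c
    obtain ⟨i, j, hw⟩ := hT W hW
    rw [pairing_cyclic_sum_eq_zero hβ hw (bivectorCoeff_swap hQs W)
      fun _ _ => nonneg_of_weightCoeff_ne_zero, jacobiatorCoeff, jacobiatorCoeff,
      jacobiator_toric halt, map_zero, add_zero] at h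
    exact h

theorem quadraticForm_sub_mem_filtration {v v' : Fin n → Fin n → R} {a b : Fin n} {p : ℕ}
    (hv : ∀ k l, v k l ∈ epsSpan T ε p (quadWeight a b k l))
    (hv' : ∀ k l, v' k l ∈ epsSpan T ε p (quadWeight a b k l))
    (h : ∀ k l, k ≤ l → quadWeight a b k l ∈ T.carrier p → v k l = v' k l) :
    quadraticForm v - quadraticForm v' ∈ filtration T ε (p + 1) (unitWeight a + unitWeight b) := by
  rw [quadraticForm_sub]
  exact quadraticForm_mem_filtration fun k l hkl =>
    mem_epsSpan_succ (sub_mem (hv k l) (hv' k l)) fun hw => sub_eq_zero.mpr (h k l hkl hw)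

theorem mem_filtration_of_lt {D : Fin n → Fin n → MvPolynomial (Fin n) R}
    (hD : ∀ a b, D a b = -D b a) {p : ℕ}
    (h : ∀ a b, a < b → D a b ∈ filtration T ε p (unitWeight a + unitWeight b)) (a b : Fin n) :
    D a b ∈ filtration T ε p (unitWeight a + unitWeight b) := by
  rcases lt_trichotomy a b with hab | rfl | hab
  · exact h a b hab
  · rw [eq_zero_of_eq_neg (hD a a)]; exact zero_mem _
  · rw [hD, add_comm (unitWeight a)]; exact neg_mem (h b a hab)

end FirstOrder

section Perturbation

open MvPolynomial

variable {n : ℕ} {R : Type*} [CommRing R] [Algebra ℂ R] {lam β : Matrix (Fin n) (Fin n) ℂ}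
  {G : SimpleGraph (Fin n)} {T : OrderedWeights n} {ε : R}

variable (T ε) in
/-- The terms of positive order in the formula for the deformed bracket of `x_a` and `x_b`. -/
noncomputable def perturbation (N : ℕ) (c : Fin n → Fin n → Fin n → Fin n → ℂ) (a b : Fin n) :
    MvPolynomial (Fin n) R :=
  quadraticForm fun k l => epsTerm T ε N (c b a k l) (quadWeight a b k l)

theorem perturbation_mem_filtration (N : ℕ) (c : Fin n → Fin n → Fin n → Fin n → ℂ)
    (a b : Fin n) :
    perturbation T ε N c a b ∈ filtration T ε 1 (unitWeight a + unitWeight b) :=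
  quadraticForm_mem_filtration fun _ _ _ => epsTerm_mem_epsSpan _ _ _

theorem perturbation_swap (N : ℕ) {c : Fin n → Fin n → Fin n → Fin n → ℂ}
    (hc : ∀ a b k l, c a b k l = -c b a k l) (a b : Fin n) :
    perturbation T ε N c a b = -perturbation T ε N c b a := by
  rw [perturbation, perturbation, neg_eq_neg_one_mul, ← C_1, ← C_neg, C_mul_quadraticForm]
  congr 1
  ext k l
  rw [hc, quadWeight_comm a b, neg_one_mul, epsTerm, epsTerm, ← Finset.sum_neg_distrib]
  refine Finset.sum_congr rfl fun m _ => ?_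
  split_ifs
  · rw [map_neg, mul_neg]
  · rw [mul_zero, neg_zero]

theorem isDeformedBracket_iff (hβ : IsBiresidueMatrix lam β) (hG : G.IsAcyclic) {N : ℕ}
    {c : Fin n → Fin n → Fin n → Fin n → ℂ} {P : PoissonBracket R (MvPolynomial (Fin n) R)} :
    IsDeformedBracket lam β G N c ε P ↔ ∀ a b, a < b →
      P.matrix a b = toricMatrix R lam a b + perturbation (thetaWeights hβ hG) ε N c a b := by
  simp only [perturbation, quadraticForm_epsTerm]
  rfl

theorem HasLeadingCoeffs.epsTerm_eq (hβ : IsBiresidueMatrix lam β) (hG : G.IsAcyclic)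
    {γ : Sym2 (Fin n) → ℂ} {c : Fin n → Fin n → Fin n → Fin n → ℂ}
    (hc : HasLeadingCoeffs β G γ c) {N : ℕ} (hN : 1 ≤ N) {a b k l : Fin n} (hab : a < b)
    (hkl : k ≤ l) {i j : Fin n} (hij : G.Adj i j)
    (hw : IsSmoothableWeight β i j (quadWeight a b k l)) :
    epsTerm (thetaWeights hβ hG) ε N (c b a k l) (quadWeight a b k l) = γ s(i, j) • ε := by
  rw [epsTerm_eq_smul le_rfl hN _ (mem_Theta_one.mpr ⟨i, j, hij, hw⟩), pow_one,
    hc i j _ hij hw a b k l hab hkl rfl]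

theorem PoissonBracket.isNearToric_matrix (halt : lam.transpose = -lam)
    {P : PoissonBracket R (MvPolynomial (Fin n) R)} {v : Fin n → Fin n → Fin n → Fin n → R}
    (hP : ∀ a b, a < b → P.matrix a b = toricMatrix R lam a b + quadraticForm (v a b))
    (hv : ∀ a b k l, v a b k l ∈ epsSpan T ε 1 (quadWeight a b k l)) :
    IsNearToric T ε lam P.matrix := by
  refine ⟨fun a b => P.swap _ _, mem_filtration_of_lt (fun a b => ?_) fun a b hab => ?_⟩
  · rw [toricMatrix_swap halt, PoissonBracket.matrix, P.swap, PoissonBracket.matrix]; ring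
  · rw [hP a b hab, add_sub_cancel_left]
    exact quadraticForm_mem_filtration fun k l _ => hv a b k l

theorem PoissonBracket.matrix_sub_mem_filtration {P P' : PoissonBracket R (MvPolynomial (Fin n) R)}
    {v v' : Fin n → Fin n → Fin n → Fin n → R}
    (hP : ∀ a b, a < b → P.matrix a b = toricMatrix R lam a b + quadraticForm (v a b))
    (hP' : ∀ a b, a < b → P'.matrix a b = toricMatrix R lam a b + quadraticForm (v' a b))
    (hv : ∀ a b k l, v a b k l ∈ epsSpan T ε 1 (quadWeight a b k l))
    (hv' : ∀ a b k l, v' a b k l ∈ epsSpan T ε 1 (quadWeight a b k l))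
    (h : ∀ a b k l, a < b → k ≤ l → quadWeight a b k l ∈ T.carrier 1 →
      v' a b k l = v a b k l) (a b : Fin n) :
    P'.matrix a b - P.matrix a b ∈ filtration T ε 2 (unitWeight a + unitWeight b) := by
  refine mem_filtration_of_lt (D := P'.matrix - P.matrix) (P'.matrix_sub_swap P)
    (fun a b hab => ?_) a b
  rw [Pi.sub_apply, Pi.sub_apply, hP a b hab, hP' a b hab, add_sub_add_left_eq_sub]
  exact quadraticForm_sub_mem_filtration (hv' a b) (hv a b) (h a b · · hab)

theorem exists_perturbed_matrix (halt : lam.transpose = -lam) (hβ : IsBiresidueMatrix lam β)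
    (hG : G.IsAcyclic) {c : Fin n → Fin n → Fin n → Fin n → ℂ}
    (hc : ∀ a b k l, c a b k l = -c b a k l) (ε : R) :
    ∃ P, IsNearToric (thetaWeights hβ hG) ε lam P ∧
      (∀ a b, P a b - toricMatrix R lam a b - perturbation (thetaWeights hβ hG) ε 1 c a b ∈
        filtration (thetaWeights hβ hG) ε 2 (unitWeight a + unitWeight b)) ∧
      ∀ a b c, jacobiator P (X a) (X b) (X c) = 0 := by
  have hnear := (isNearToric_toric (T := thetaWeights hβ hG) (ε := ε) halt).add
    (perturbation_swap 1 hc) (perturbation_mem_filtration 1 c)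
  have hT : ∀ w ∈ (thetaWeights hβ hG).carrier 1, ∃ i j, IsSmoothableWeight β i j w :=
    fun w hw => (mem_Theta_one.mp hw).imp fun i ⟨j, _, h⟩ => ⟨j, h⟩
  obtain ⟨P, hP, hsub, hjacobi⟩ := exists_jacobi halt hnear
    (fun m hm W hW => isAcyclicWeight_of_mem_Theta hβ hG hm hW) (hnear.jacobiator_mem halt hβ hT)
  exact ⟨P, hP, fun a b => by rw [sub_sub]; exact hsub a b, hjacobi⟩

theorem exists_deformed_matrix (halt : lam.transpose = -lam) (hβ : IsBiresidueMatrix lam β)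
    (hG : G.IsAcyclic) (γ : Sym2 (Fin n) → ℂ) :
    ∃ N c, 1 ≤ N ∧ HasLeadingCoeffs β G γ c ∧ ∃ P,
      IsNearToric (thetaWeights hβ hG) (Polynomial.X : ℂ[X]) lam P ∧
      (∀ a b, P a b =
        toricMatrix ℂ[X] lam a b + perturbation (thetaWeights hβ hG) Polynomial.X N c a b) ∧
      ∀ a b c, jacobiator P (X a) (X b) (X c) = 0 := by
  obtain ⟨c₀, hc₀, hc₀s⟩ := exists_hasLeadingCoeffs β G γ
  obtain ⟨P, hP, hlead, hjacobi⟩ :=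
    exists_perturbed_matrix halt hβ hG hc₀s (Polynomial.X : ℂ[X])
  obtain ⟨N, c, hN, hc⟩ := exists_quadraticForm_epsTerm hP.sub_mem
  refine ⟨N, c, hN, ?_, P, hP, fun a b => sub_eq_iff_eq_add'.mp (hc a b), hjacobi⟩
  rintro i j _ hij hw a b k l hab hkl rfl
  have hΘ : quadWeight a b k l ∈ (thetaWeights hβ hG).carrier 1 :=
    mem_Theta_one.mpr ⟨i, j, hij, hw⟩
  have h := hlead a b (Finsupp.single k 1 + Finsupp.single l 1)
  rw [toWeight_single_add_single_sub] at h
  have h0 := eq_zero_of_mem_epsSpan h hΘ one_lt_two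
  rw [hc, perturbation, coeff_sub, coeff_single_add_single_quadraticForm _ hkl,
    coeff_single_add_single_quadraticForm _ hkl, hc₀.epsTerm_eq hβ hG le_rfl hab hkl hij hw,
    epsTerm_eq_smul le_rfl hN _ hΘ, pow_one, ← sub_smul] at h0
  exact sub_eq_zero.mp ((smul_eq_zero.mp h0).resolve_right Polynomial.X_ne_zero)

end Perturbation

section Specialization

open MvPolynomial

variable {n : ℕ} {R S : Type*} [CommRing R] [CommRing S]

theorem map_bracketOf (φ : R →+* S) (P : Fin n → Fin n → MvPolynomial (Fin n) R)
    (f g : MvPolynomial (Fin n) R) :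
    map φ (bracketOf P f g) = bracketOf (fun a b => map φ (P a b)) (map φ f) (map φ g) := by
  simp only [bracketOf_eq, map_sum, map_mul, pderiv_map]

theorem map_jacobiator (φ : R →+* S) (P : Fin n → Fin n → MvPolynomial (Fin n) R)
    (f g h : MvPolynomial (Fin n) R) :
    map φ (jacobiator P f g h) =
      jacobiator (fun a b => map φ (P a b)) (map φ f) (map φ g) (map φ h) := by
  simp only [jacobiator, map_add, map_bracketOf]

theorem poissonOfMatrix_matrix [IsDomain R] [CharZero R]
    (P : Fin n → Fin n → MvPolynomial (Fin n) R) (hP : ∀ a b, P a b = -P b a)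
    (hj : ∀ a b c, jacobiator P (X a) (X b) (X c) = 0) : (poissonOfMatrix P hP hj).matrix = P :=
  funext₂ (bracketOf_X_X P)

variable [Algebra ℂ R] [Algebra ℂ S] {lam : Matrix (Fin n) (Fin n) ℂ} {T : OrderedWeights n}

theorem map_toricMatrix (φ : R →ₐ[ℂ] S) (a b : Fin n) :
    map (φ : R →+* S) (toricMatrix R lam a b) = toricMatrix S lam a b := by
  simp only [toricMatrix, map_mul, map_C, map_X, RingHom.coe_coe, AlgHom.commutes]

theorem map_perturbation (φ : R →ₐ[ℂ] S) (ε : R) (N : ℕ)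
    (c : Fin n → Fin n → Fin n → Fin n → ℂ) (a b : Fin n) :
    map (φ : R →+* S) (perturbation T ε N c a b) = perturbation T (φ ε) N c a b := by
  simp only [perturbation, map_quadraticForm, epsTerm, RingHom.coe_coe, map_sum, map_mul, map_pow,
    apply_ite φ, AlgHom.commutes, map_zero]

theorem toricPoisson_matrix (halt : lam.transpose = -lam) :
    (toricPoisson lam halt).matrix = toricMatrix ℂ lam :=
  funext₂ (toricPoisson_X lam halt)

end Specialization

section FilteredDeformation

open MvPolynomial

variable {n : ℕ} {lam β : Matrix (Fin n) (Fin n) ℂ} {G : SimpleGraph (Fin n)}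
  {T : OrderedWeights n}

theorem coeff_epsCoeff (m : ℕ) (f : MvPolynomial (Fin n) ℂ[X]) (s : Fin n →₀ ℕ) :
    coeff s (epsCoeff m f) = (coeff s f).coeff m := by
  classical
  simp only [epsCoeff, coeff_sum, coeff_monomial, Finset.sum_ite_eq']
  split_ifs with h
  · rfl
  · rw [notMem_support_iff.mp h, Polynomial.coeff_zero]

theorem epsCoeff_zero_eq_map (f : MvPolynomial (Fin n) ℂ[X]) :
    epsCoeff 0 f = map (Polynomial.aeval (R := ℂ) (0 : ℂ) : ℂ[X] →+* ℂ) f := by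
  ext s
  rw [coeff_epsCoeff, coeff_map, RingHom.coe_coe, Polynomial.coe_aeval_eq_eval,
    Polynomial.coeff_zero_eq_eval_zero]

theorem le_and_mem_carrier_of_coeff_ne_zero {p m : ℕ} {w : Fin n → ℤ} {r : ℂ[X]}
    (hr : r ∈ epsSpan T (Polynomial.X : ℂ[X]) p w) (hm : r.coeff m ≠ 0) :
    p ≤ m ∧ w ∈ T.carrier m := by
  have h0 : r ≠ 0 := fun h0 => hm (by rw [h0, Polynomial.coeff_zero])
  obtain ⟨m', hp, hw⟩ := exists_of_mem_epsSpan hr h0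
  obtain ⟨z, rfl⟩ := exists_smul_of_mem_epsSpan hr hw
  obtain rfl : m = m' := by
    by_contra hne
    rw [Polynomial.coeff_smul, Polynomial.coeff_X_pow, if_neg hne, smul_zero] at hm
    exact hm rfl
  exact ⟨hp, hw⟩

theorem epsCoeff_zero_of_mem_filtration {u : Fin n → ℤ} {f : MvPolynomial (Fin n) ℂ[X]}
    (hf : f ∈ filtration T (Polynomial.X : ℂ[X]) 1 u) : epsCoeff 0 f = 0 := by
  ext s
  rw [coeff_epsCoeff, coeff_zero]
  by_contra hne
  exact absurd (le_and_mem_carrier_of_coeff_ne_zero (hf s) hne).1 (by norm_num)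

theorem mem_smoothableFiltration {p : ℕ} {f : MvPolynomial (Fin n) ℂ}
    (h : ∀ s, coeff s f ≠ 0 → ∃ m, p ≤ m ∧ ∃ θ ∈ Theta β G m, θ ≤ toWeight s) :
    f ∈ smoothableFiltration β G p := by
  rw [f.as_sum]
  refine Submodule.sum_mem _ fun s hs => ?_
  rw [← mul_one (coeff s f), ← smul_eq_mul, ← smul_monomial]
  exact Submodule.smul_mem _ _ (Submodule.subset_span ⟨s, h s (mem_support_iff.mp hs), rfl⟩)

/-- The operation `μ_m` in the expansion `{f, g} = ∑ ε^m μ_m(f, g)` of the biderivation with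
matrix `P`. -/
noncomputable def bracketCoeff (P : Fin n → Fin n → MvPolynomial (Fin n) ℂ[X]) (m : ℕ) :
    MvPolynomial (Fin n) ℂ →ₗ[ℂ] MvPolynomial (Fin n) ℂ →ₗ[ℂ] MvPolynomial (Fin n) ℂ :=
  LinearMap.mk₂ ℂ
    (fun f g => epsCoeff m (bracketOf P (map Polynomial.C f) (map Polynomial.C g)))
    (fun f f' g => by ext s; simp [coeff_epsCoeff, bracketOf_add_left])
    (fun r f g => by
      ext s
      rw [smul_eq_C_mul, map_mul, map_C, ← smul_eq_C_mul, bracketOf_smul_left]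
      simp [coeff_epsCoeff])
    (fun f g g' => by ext s; simp [coeff_epsCoeff, bracketOf_add_right])
    (fun r f g => by
      ext s
      rw [smul_eq_C_mul, map_mul, map_C, ← smul_eq_C_mul, bracketOf_smul_right]
      simp [coeff_epsCoeff])

theorem bracketCoeff_monomial_mem (hβ : IsBiresidueMatrix lam β) (hG : G.IsAcyclic)
    {P : Fin n → Fin n → MvPolynomial (Fin n) ℂ[X]}
    (hP : IsNearToric (thetaWeights hβ hG) Polynomial.X lam P) {p q m : ℕ} {s t : Fin n →₀ ℕ}
    (hs : ∃ k, p ≤ k ∧ ∃ θ ∈ Theta β G k, ∀ i, θ i ≤ (s i : ℤ))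
    (ht : ∃ k, q ≤ k ∧ ∃ θ ∈ Theta β G k, ∀ i, θ i ≤ (t i : ℤ)) :
    bracketCoeff P m (monomial s 1) (monomial t 1) ∈ smoothableFiltration β G (p + q + m) := by
  obtain ⟨k, hk, θ, hθ, hs⟩ := hs
  obtain ⟨l, hl, η, hη, ht⟩ := ht
  refine mem_smoothableFiltration fun r hr => ?_
  rw [bracketCoeff, LinearMap.mk₂_apply, map_monomial, map_monomial, map_one, coeff_epsCoeff] at hr
  have hmon : ∀ s : Fin n →₀ ℕ, monomial s (1 : ℂ[X]) ∈
      filtration (thetaWeights hβ hG) Polynomial.X 0 (toWeight s) :=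
    fun s => monomial_mem_filtration (by rw [sub_self]; exact one_mem_epsSpan _ _)
  have hmem := bracketOf_mem_filtration hP.mem (hmon s) (hmon t) (add_zero (0 + 0)).symm rfl r
  have hw := (le_and_mem_carrier_of_coeff_ne_zero hmem hr).2
  refine ⟨k + l + m, by lia, _, add_mem_Theta (add_mem_Theta hθ hη) hw, ?_⟩
  exact le_sub_iff_add_le'.mp (sub_le_sub_left (add_le_add hs ht) _)

theorem bracketCoeff_mem (hβ : IsBiresidueMatrix lam β) (hG : G.IsAcyclic)
    {P : Fin n → Fin n → MvPolynomial (Fin n) ℂ[X]}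
    (hP : IsNearToric (thetaWeights hβ hG) Polynomial.X lam P) {p q m : ℕ}
    {f g : MvPolynomial (Fin n) ℂ} (hf : f ∈ smoothableFiltration β G p)
    (hg : g ∈ smoothableFiltration β G q) :
    bracketCoeff P m f g ∈ smoothableFiltration β G (p + q + m) := by
  have hspan : Submodule.map₂ (bracketCoeff P m) (smoothableFiltration β G p)
      (smoothableFiltration β G q) ≤ smoothableFiltration β G (p + q + m) := by
    rw [smoothableFiltration, smoothableFiltration, Submodule.map₂_span_span, Submodule.span_le]
    rintro _ ⟨_, ⟨s, hs, rfl⟩, _, ⟨t, ht, rfl⟩, rfl⟩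
    exact bracketCoeff_monomial_mem hβ hG hP hs ht
  exact hspan (Submodule.apply_mem_map₂ _ hf hg)

theorem bracketCoeff_zero_eq_toric (halt : lam.transpose = -lam)
    {P : Fin n → Fin n → MvPolynomial (Fin n) ℂ[X]}
    (hP : IsNearToric T (Polynomial.X : ℂ[X]) lam P) (f g : MvPolynomial (Fin n) ℂ) :
    bracketCoeff P 0 f g = (toricPoisson lam halt).bracket f g := by
  have hmatrix : (fun a b => epsCoeff 0 (P a b)) = toricMatrix ℂ lam := by
    ext1 a
    ext1 b
    have h := epsCoeff_zero_of_mem_filtration (hP.sub_mem a b)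
    rw [epsCoeff_zero_eq_map, map_sub, map_toricMatrix, sub_eq_zero] at h
    rw [epsCoeff_zero_eq_map, h]
  have hC : ((Polynomial.aeval (R := ℂ) (0 : ℂ) : ℂ[X] →+* ℂ)).comp Polynomial.C =
      RingHom.id ℂ := by
    ext
    simp
  simp only [epsCoeff_zero_eq_map] at hmatrix
  rw [bracketCoeff, LinearMap.mk₂_apply, epsCoeff_zero_eq_map, map_bracketOf, hmatrix, map_map,
    map_map, hC, map_id, map_id, PoissonBracket.eq_bracketOf, toricPoisson_matrix]

theorem isFilteredDeformation_of_isNearToric (halt : lam.transpose = -lam)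
    (hβ : IsBiresidueMatrix lam β) (hG : G.IsAcyclic)
    {P : PoissonBracket ℂ[X] (MvPolynomial (Fin n) ℂ[X])}
    (hP : IsNearToric (thetaWeights hβ hG) (Polynomial.X : ℂ[X]) lam P.matrix) :
    IsFilteredDeformation (smoothableFiltration β G) (toricPoisson lam halt) P where
  specializes f g := by
    rw [P.eq_bracketOf]
    exact bracketCoeff_zero_eq_toric halt hP f g
  filtered p q m f g hf hg := by
    rw [P.eq_bracketOf]
    exact bracketCoeff_mem hβ hG hP hf hg

theorem exists_deformed_family (halt : lam.transpose = -lam) (hβ : IsBiresidueMatrix lam β)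
    (hG : G.IsAcyclic) (γ : Sym2 (Fin n) → ℂ) :
    ∃ (N : ℕ) (c : Fin n → Fin n → Fin n → Fin n → ℂ), 1 ≤ N ∧ HasLeadingCoeffs β G γ c ∧
      (∃ P : PoissonBracket ℂ[X] (MvPolynomial (Fin n) ℂ[X]),
        IsDeformedBracket lam β G N c Polynomial.X P ∧
        IsFilteredDeformation (smoothableFiltration β G) (toricPoisson lam halt) P) ∧
      ∀ ε : ℂ, ∃ P : PoissonBracket ℂ (MvPolynomial (Fin n) ℂ),
        IsDeformedBracket lam β G N c ε P := by
  obtain ⟨N, c, hN, hc, P, hP, hform, hjacobi⟩ := exists_deformed_matrix halt hβ hG γ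
  refine ⟨N, c, hN, hc, ⟨poissonOfMatrix P hP.swap hjacobi, ?_, ?_⟩, fun ε => ?_⟩
  · rw [isDeformedBracket_iff hβ hG, poissonOfMatrix_matrix]
    exact fun a b _ => hform a b
  · refine isFilteredDeformation_of_isNearToric halt hβ hG ?_
    rwa [poissonOfMatrix_matrix]
  · let φ : ℂ[X] →ₐ[ℂ] ℂ := Polynomial.aeval ε
    refine ⟨poissonOfMatrix (fun a b => map (φ : ℂ[X] →+* ℂ) (P a b))
      (fun a b => by rw [hP.swap, map_neg]) (fun a b c => ?_), ?_⟩
    · have h := map_jacobiator (φ : ℂ[X] →+* ℂ) P (X a) (X b) (X c)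
      rw [hjacobi, map_zero, map_X, map_X, map_X] at h
      exact h.symm
    · rw [isDeformedBracket_iff hβ hG, poissonOfMatrix_matrix]
      intro a b _
      rw [hform, map_add, map_toricMatrix, map_perturbation, Polynomial.aeval_X]

end FilteredDeformation

section Scaling

open MvPolynomial

variable {n : ℕ} {lam β : Matrix (Fin n) (Fin n) ℂ} {G : SimpleGraph (Fin n)}
  {T : OrderedWeights n}

theorem epsSpan_le_epsSpan_one (ε : ℂ) (p : ℕ) (w : Fin n → ℤ) :
    epsSpan T ε p w ≤ epsSpan T 1 p w := by
  refine Submodule.span_le.mpr ?_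
  rintro _ ⟨m, hm, hw, rfl⟩
  have h := Submodule.smul_mem _ (ε ^ m) (pow_mem_epsSpan T (1 : ℂ) hm hw)
  rwa [one_pow, smul_eq_mul, mul_one] at h

/-- The diagonal automorphism `x_a ↦ exp (τ_a) x_a`. -/
noncomputable def scaling (τ : Fin n → ℂ) : MvPolynomial (Fin n) ℂ ≃ₐ[ℂ] MvPolynomial (Fin n) ℂ :=
  linearSubstEquiv (Matrix.diagonal fun a => Complex.exp (τ a))
    (Matrix.diagonal fun a => Complex.exp (-τ a))
    (by simp [← Complex.exp_add]) (by simp [← Complex.exp_add])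

theorem linearForm_diagonal {R : Type*} [CommRing R] (t : Fin n → R) (a : Fin n) :
    linearForm (Matrix.diagonal t a) = C (t a) * X a := by
  rw [linearForm, Finset.sum_eq_single a]
  · rw [Matrix.diagonal_apply_eq]
  · intro d _ hd
    rw [Matrix.diagonal_apply_ne' _ hd, map_zero, zero_mul]
  · exact fun h => absurd (Finset.mem_univ a) h

theorem scaling_X (τ : Fin n → ℂ) (a : Fin n) :
    scaling τ (X a) = C (Complex.exp (τ a)) * X a :=
  (linearSubst_X _ a).trans (linearForm_diagonal _ a)

theorem scaling_symm_X (τ : Fin n → ℂ) (a : Fin n) :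
    (scaling τ).symm (X a) = C (Complex.exp (-τ a)) * X a :=
  (linearSubst_X _ a).trans (linearForm_diagonal _ a)

theorem conj_scaling_matrix (P : PoissonBracket ℂ (MvPolynomial (Fin n) ℂ)) (τ : Fin n → ℂ)
    (a b : Fin n) : (P.conj (scaling τ)).matrix a b =
      C (Complex.exp (-τ a) * Complex.exp (-τ b)) * scaling τ (P.matrix a b) := by
  simp only [PoissonBracket.matrix, P.conj_bracket, scaling_symm_X, ← smul_eq_C_mul, map_smul,
    LinearMap.smul_apply, smul_smul, mul_comm (Complex.exp (-τ b))]

theorem sum_mul_quadWeight (τ : Fin n → ℂ) (a b k l : Fin n) :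
    ∑ i, τ i * quadWeight a b k l i = -τ a - τ b + τ k + τ l := by
  have h : ∀ a, ∑ i, τ i * (unitWeight a i : ℂ) = τ a := fun a => by
    simp [unitWeight, Pi.single_apply]
  simp only [quadWeight, Pi.add_apply, Pi.sub_apply, Pi.neg_apply, Int.cast_add, Int.cast_sub,
    Int.cast_neg, mul_add, mul_sub, mul_neg, Finset.sum_add_distrib, Finset.sum_sub_distrib,
    Finset.sum_neg_distrib, h]

theorem C_exp_mul_scaling (τ : Fin n → ℂ) (a b k l : Fin n) (r : ℂ) :
    C (Complex.exp (-τ a) * Complex.exp (-τ b)) * scaling τ (C r * X k * X l) =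
      C (Complex.exp (∑ i, τ i * quadWeight a b k l i) * r) * X k * X l := by
  have hr : scaling τ (C r) = C r := (scaling τ).commutes r
  simp only [sum_mul_quadWeight, sub_eq_add_neg, Complex.exp_add, map_mul, scaling_X, hr]
  ring

theorem C_exp_mul_scaling_toricMatrix (τ : Fin n → ℂ) (a b : Fin n) :
    C (Complex.exp (-τ a) * Complex.exp (-τ b)) * scaling τ (toricMatrix ℂ lam a b) =
      toricMatrix ℂ lam a b := by
  rw [toricMatrix, C_exp_mul_scaling, sum_mul_quadWeight, show -τ a - τ b + τ a + τ b = 0 by ring,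
    Complex.exp_zero, one_mul]

theorem C_exp_mul_scaling_quadraticForm (τ : Fin n → ℂ) (a b : Fin n) (v : Fin n → Fin n → ℂ) :
    C (Complex.exp (-τ a) * Complex.exp (-τ b)) * scaling τ (quadraticForm v) =
      quadraticForm fun k l => Complex.exp (∑ i, τ i * quadWeight a b k l i) * v k l := by
  simp only [quadraticForm, map_sum, Finset.mul_sum, apply_ite (scaling τ), map_zero, mul_ite,
    mul_zero, C_exp_mul_scaling]

theorem exists_forall_mul_exp_eq (hβ : IsBiresidueMatrix lam β) (hG : G.IsAcyclic)
    {ρ ρ' : Sym2 (Fin n) → ℂ} (hρ : ∀ e ∈ G.edgeSet, ρ e ≠ 0) (hρ' : ∀ e ∈ G.edgeSet, ρ' e ≠ 0) :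
    ∃ τ : Fin n → ℂ, ∀ i j w, G.Adj i j → IsSmoothableWeight β i j w →
      Complex.exp (∑ a, τ a * w a) * ρ s(i, j) = ρ' s(i, j) := by
  obtain ⟨τ, hτ⟩ := exists_dual_smoothableWeight hβ hG fun e => Complex.log (ρ' e / ρ e)
  refine ⟨τ, fun i j w hij hw => ?_⟩
  rw [hτ i j w hij hw, Complex.exp_log (div_ne_zero (hρ' _ hij) (hρ _ hij)),
    div_mul_cancel₀ _ (hρ _ hij)]

theorem exists_scaling (halt : lam.transpose = -lam) (hβ : IsBiresidueMatrix lam β)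
    (hG : G.IsAcyclic) {γ γ' : Sym2 (Fin n) → ℂ} (hγ : ∀ e ∈ G.edgeSet, γ e ≠ 0)
    (hγ' : ∀ e ∈ G.edgeSet, γ' e ≠ 0) {ε ε' : ℂ} (hε : ε ≠ 0) (hε' : ε' ≠ 0) {N N' : ℕ}
    {c c' : Fin n → Fin n → Fin n → Fin n → ℂ}
    {P P' : PoissonBracket ℂ (MvPolynomial (Fin n) ℂ)} (hN : 1 ≤ N) (hN' : 1 ≤ N')
    (hc : HasLeadingCoeffs β G γ c) (hc' : HasLeadingCoeffs β G γ' c')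
    (hP : IsDeformedBracket lam β G N c ε P) (hP' : IsDeformedBracket lam β G N' c' ε' P') :
    ∃ τ : Fin n → ℂ,
      IsNearToric (thetaWeights hβ hG) (1 : ℂ) lam (P.conj (scaling τ)).matrix ∧
      ∀ a b, P'.matrix a b - (P.conj (scaling τ)).matrix a b ∈
        filtration (thetaWeights hβ hG) (1 : ℂ) 2 (unitWeight a + unitWeight b) := by
  rw [isDeformedBracket_iff hβ hG] at hP hP'
  obtain ⟨τ, hτ⟩ := exists_forall_mul_exp_eq hβ hG (ρ := fun e => γ e * ε)
    (ρ' := fun e => γ' e * ε') (fun e he => mul_ne_zero (hγ e he) hε)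
    (fun e he => mul_ne_zero (hγ' e he) hε')
  have hscaled : ∀ a b, a < b → (P.conj (scaling τ)).matrix a b = toricMatrix ℂ lam a b +
      quadraticForm fun k l => Complex.exp (∑ i, τ i * quadWeight a b k l i) *
        epsTerm (thetaWeights hβ hG) ε N (c b a k l) (quadWeight a b k l) := fun a b hab => by
    rw [conj_scaling_matrix, hP a b hab, map_add, mul_add, C_exp_mul_scaling_toricMatrix,
      perturbation, C_exp_mul_scaling_quadraticForm]
  have hmem : ∀ ε N z w, epsTerm (thetaWeights hβ hG) ε N z w ∈
      epsSpan (thetaWeights hβ hG) (1 : ℂ) 1 w :=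
    fun ε N z w => epsSpan_le_epsSpan_one ε 1 w (epsTerm_mem_epsSpan N z w)
  have hmem_scaled := fun a b k l => Submodule.smul_mem _
    (Complex.exp (∑ i, τ i * quadWeight a b k l i))
    (hmem ε N (c b a k l) (quadWeight a b k l))
  refine ⟨τ, PoissonBracket.isNearToric_matrix halt hscaled hmem_scaled,
    PoissonBracket.matrix_sub_mem_filtration hscaled hP' hmem_scaled (fun _ _ _ _ => hmem _ _ _ _)
      fun a b k l hab hkl hw => ?_⟩
  obtain ⟨i, j, hij, hw⟩ := mem_Theta_one.mp hw
  rw [hc.epsTerm_eq hβ hG hN hab hkl hij hw, hc'.epsTerm_eq hβ hG hN' hab hkl hij hw]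
  exact (hτ i j _ hij hw).symm

end Scaling

section Automorphisms

open MvPolynomial

variable {n : ℕ} {lam β : Matrix (Fin n) (Fin n) ℂ} {G : SimpleGraph (Fin n)}

theorem isFilteredLinear_of_mem (hβ : IsBiresidueMatrix lam β) (hG : G.IsAcyclic) {ε : ℂ}
    {φ : MvPolynomial (Fin n) ℂ ≃ₐ[ℂ] MvPolynomial (Fin n) ℂ}
    (hφ : ∀ a, φ (X a) ∈ filtration (thetaWeights hβ hG) ε 0 (unitWeight a)) :
    IsFilteredLinear β G φ := by
  refine ⟨fun a d => coeff (Finsupp.single d 1) (φ (X a)), fun a => ?_, fun a d h => ?_⟩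
  · have hdeg := isHomogeneous_of_mem_filtration (d := 1) (sum_unitWeight a) (hφ a)
    exact eq_linearForm_of_isHomogeneous hdeg
  · obtain ⟨m, _, hm⟩ := exists_of_mem_epsSpan (hφ a _) h
    rw [toWeight_single] at hm
    exact ⟨m, hm⟩

theorem isFilteredUnipotent_of_mem (hβ : IsBiresidueMatrix lam β) (hG : G.IsAcyclic)
    {φ : MvPolynomial (Fin n) ℂ[X] ≃ₐ[ℂ[X]] MvPolynomial (Fin n) ℂ[X]}
    (hφ : ∀ a, φ (X a) - X a ∈
      filtration (thetaWeights hβ hG) (Polynomial.X : ℂ[X]) 1 (unitWeight a)) :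
    IsFilteredUnipotent β G φ := by
  obtain ⟨M, α, h⟩ := exists_linearForm_epsTerm hφ
  refine ⟨M, α, fun a => sub_eq_iff_eq_add'.mp ?_⟩
  rw [h, linearForm_epsTerm]
  rfl

theorem exists_filteredUnipotent_intertwiner (halt : lam.transpose = -lam)
    (hβ : IsBiresidueMatrix lam β) (hG : G.IsAcyclic) {γ : Sym2 (Fin n) → ℂ} {N N' : ℕ}
    {c c' : Fin n → Fin n → Fin n → Fin n → ℂ}
    {P P' : PoissonBracket ℂ[X] (MvPolynomial (Fin n) ℂ[X])} (hN : 1 ≤ N) (hN' : 1 ≤ N')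
    (hc : HasLeadingCoeffs β G γ c) (hc' : HasLeadingCoeffs β G γ c')
    (hP : IsDeformedBracket lam β G N c Polynomial.X P)
    (hP' : IsDeformedBracket lam β G N' c' Polynomial.X P') :
    ∃ φ : MvPolynomial (Fin n) ℂ[X] ≃ₐ[ℂ[X]] MvPolynomial (Fin n) ℂ[X],
      IsFilteredUnipotent β G φ ∧ Intertwines φ P P' := by
  rw [isDeformedBracket_iff hβ hG] at hP hP'
  have hmem := fun N (c : Fin n → Fin n → Fin n → Fin n → ℂ) a b k l =>
    epsTerm_mem_epsSpan (T := thetaWeights hβ hG) (ε := (Polynomial.X : ℂ[X])) N (c b a k l)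
      (quadWeight a b k l)
  obtain ⟨φ, hφ, hint⟩ := exists_filtered_intertwiner halt
    (fun m hm W hW => isAcyclicWeight_of_mem_Theta hβ hG hm hW)
    (PoissonBracket.isNearToric_matrix halt hP (hmem N c))
    (PoissonBracket.matrix_sub_mem_filtration hP hP' (hmem N c) (hmem N' c')
      fun a b k l hab hkl hw => by
        obtain ⟨i, j, hij, hw⟩ := mem_Theta_one.mp hw
        rw [hc.epsTerm_eq hβ hG hN hab hkl hij hw, hc'.epsTerm_eq hβ hG hN' hab hkl hij hw])
  exact ⟨φ, isFilteredUnipotent_of_mem hβ hG hφ, hint⟩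

theorem exists_filteredLinear_intertwiner (halt : lam.transpose = -lam)
    (hβ : IsBiresidueMatrix lam β) (hG : G.IsAcyclic) {γ γ' : Sym2 (Fin n) → ℂ}
    (hγ : ∀ e ∈ G.edgeSet, γ e ≠ 0) (hγ' : ∀ e ∈ G.edgeSet, γ' e ≠ 0) {ε ε' : ℂ} (hε : ε ≠ 0)
    (hε' : ε' ≠ 0) {N N' : ℕ} {c c' : Fin n → Fin n → Fin n → Fin n → ℂ}
    {P P' : PoissonBracket ℂ (MvPolynomial (Fin n) ℂ)} (hN : 1 ≤ N) (hN' : 1 ≤ N')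
    (hc : HasLeadingCoeffs β G γ c) (hc' : HasLeadingCoeffs β G γ' c')
    (hP : IsDeformedBracket lam β G N c ε P) (hP' : IsDeformedBracket lam β G N' c' ε' P') :
    ∃ φ : MvPolynomial (Fin n) ℂ ≃ₐ[ℂ] MvPolynomial (Fin n) ℂ,
      IsFilteredLinear β G φ ∧ Intertwines φ P P' := by
  obtain ⟨τ, hnear, hsub⟩ := exists_scaling halt hβ hG hγ hγ' hε hε' hN hN' hc hc' hP hP'
  obtain ⟨φ, hφ, hint⟩ := exists_filtered_intertwiner halt
    (fun m hm W hW => isAcyclicWeight_of_mem_Theta hβ hG hm hW) hnear hsub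
  refine ⟨(scaling τ).trans φ, isFilteredLinear_of_mem hβ hG (ε := 1) fun a => ?_, fun f g => ?_⟩
  · have h := add_mem (filtration_mono zero_le_one (hφ a)) (X_mem_filtration a)
    rw [sub_add_cancel] at h
    rw [AlgEquiv.trans_apply, scaling_X, ← algebraMap_eq, map_mul, AlgEquiv.commutes]
    exact C_mul_mem_filtration (Complex.exp (τ a)) h
  · rw [AlgEquiv.trans_apply, intertwines_conj P (scaling τ) f g, hint]
    rfl

end Automorphisms

end TorusDeform

theorem mainTheorem8 {n : ℕ} (lam : Matrix (Fin n) (Fin n) ℂ)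
    (halt : lam.transpose = -lam) (hnorm : ∀ i, ∑ j, lam i j = 0) (hrank : lam.rank + 1 = n)
    (β : Matrix (Fin n) (Fin n) ℂ) (hβ : IsBiresidueMatrix lam β)
    (G : SimpleGraph (Fin n)) (hsm : ∀ i j, G.Adj i j → IsSmoothableEdge β i j)
    (hG : G.IsAcyclic) :
    -- existence of the filtered deformation
    (∀ γ : Sym2 (Fin n) → ℂ, (∀ e ∈ G.edgeSet, γ e ≠ 0) →
      ∃ (N : ℕ) (c : Fin n → Fin n → Fin n → Fin n → ℂ), 1 ≤ N ∧ HasLeadingCoeffs β G γ c ∧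
        (∃ P : PoissonBracket ℂ[X] (MvPolynomial (Fin n) ℂ[X]),
          IsDeformedBracket lam β G N c Polynomial.X P ∧
          IsFilteredDeformation (smoothableFiltration β G) (toricPoisson lam halt) P) ∧
        ∀ ε : ℂ, ∃ P : PoissonBracket ℂ (MvPolynomial (Fin n) ℂ),
          IsDeformedBracket lam β G N c ε P) ∧
    -- uniqueness of the family over `ℂ[ε]`, for given constants `γ`
    (∀ γ : Sym2 (Fin n) → ℂ, (∀ e ∈ G.edgeSet, γ e ≠ 0) →
      ∀ (N N' : ℕ) (c c' : Fin n → Fin n → Fin n → Fin n → ℂ)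
        (P P' : PoissonBracket ℂ[X] (MvPolynomial (Fin n) ℂ[X])),
        1 ≤ N → 1 ≤ N' → HasLeadingCoeffs β G γ c → HasLeadingCoeffs β G γ c' →
        IsDeformedBracket lam β G N c Polynomial.X P →
        IsDeformedBracket lam β G N' c' Polynomial.X P' →
        ∃ φ : MvPolynomial (Fin n) ℂ[X] ≃ₐ[ℂ[X]] MvPolynomial (Fin n) ℂ[X],
          IsFilteredUnipotent β G φ ∧ Intertwines φ P P') ∧
    -- uniqueness for nonzero complex `ε`, and independence of `ε` and of the constants `γ`
    (∀ γ γ' : Sym2 (Fin n) → ℂ, (∀ e ∈ G.edgeSet, γ e ≠ 0) → (∀ e ∈ G.edgeSet, γ' e ≠ 0) →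
      ∀ ε ε' : ℂ, ε ≠ 0 → ε' ≠ 0 →
      ∀ (N N' : ℕ) (c c' : Fin n → Fin n → Fin n → Fin n → ℂ)
        (P P' : PoissonBracket ℂ (MvPolynomial (Fin n) ℂ)),
        1 ≤ N → 1 ≤ N' → HasLeadingCoeffs β G γ c → HasLeadingCoeffs β G γ' c' →
        IsDeformedBracket lam β G N c ε P → IsDeformedBracket lam β G N' c' ε' P' →
        ∃ φ : MvPolynomial (Fin n) ℂ ≃ₐ[ℂ] MvPolynomial (Fin n) ℂ,
          IsFilteredLinear β G φ ∧ Intertwines φ P P') := by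
  refine ⟨fun γ _ => exists_deformed_family halt hβ hG γ, ?_, ?_⟩
  · intro γ _ N N' c c' P P' hN hN' hc hc' hP hP'
    exact exists_filteredUnipotent_intertwiner halt hβ hG hN hN' hc hc' hP hP'
  · intro γ γ' hγ hγ' ε ε' hε hε' N N' c c' P P' hN hN' hc hc' hP hP'
    exact exists_filteredLinear_intertwiner halt hβ hG hγ hγ' hε hε' hN hN' hc hc' hP hP'
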